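/- Let $n\ge 2$ and let $\lambda,\mu>0$. Write $\mathbb R^n_+=\{x\in\mathbb R^n: x_n>0\}$, $B_1^+=\{x\in\mathbb R^n_+:|x|<1\}$, $B_1'=\{x\in\mathbb R^{n-1}\times\{0\}:|x|<1\}$, and identify $\mathbb R^{n-1}\times\{0\}$ with $\mathbb R^{n-1}$. For an open set $\Omega\subset\mathbb R^n$ and vector fields $w,v$ with weak gradients in $L^2(\Omega)$ put $$a_\Omega(w,v)=\int_{\Omega} 2\mu\, e(w):e(v)+\lambda\,\operatorname{div}w\,\operatorname{div}v\,dx,\qquad e(w)=\tfrac12(\nabla w+(\nabla w)^T),\quad A:B=\sum_{i,j}A_{ij}B_{ij}.$$ *Obstacle problem for the half-Laplacian.* Let $\psi\in H^{1/2}(\mathbb R^{n-1})$. A function $u\in H^{1/2}(\mathbb R^{n-1})$ is a (weak) solution of $\min\{(-\Delta)^{1/2}u,\,u-\psi\}=0$ in $\mathbb R^{n-1}$ if $u\ge\psi$ a.e. and $$\int_{\mathbb R^{n-1}}(-\Delta)^{1/4}u\;(-\Delta)^{1/4}(\zeta-u)\,dx'\ \ge 0\quad\text{for all }\zeta\in H^{1/2}(\mathbb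 R^{n-1})\text{ with }\zeta\ge\psi\text{ a.e.}$$ *Lamé extension.* A Lamé extension of $u$ is a function $w\in C^\infty(\mathbb R^n_+;\mathbb R^n)\cap\dot H^1(\mathbb R^n_+;\mathbb R^n)$ with $w(\cdot,x_n)\in H^{1/2}(\mathbb R^{n-1})$ for every $x_n>0$ which solves $$\mu\Delta w^j+(\lambda+\mu)\,\partial_j\operatorname{div}w=0\ \text{ in }\mathbb R^n_+\quad(1\le j\le n),\qquad \partial_nw^j+\partial_jw^n=0\ \text{ on }\mathbb R^{n-1}\times\{0\}\quad(1\le j\le n-1),$$ the boundary condition being understood weakly, i.e. $a_{\mathbb R^n_+}(w,\zeta)=0$ for all $\zeta\in H^1(\mathbb R^n_+;\mathbb R^n)$ with $\zeta^n=0$ on $\mathbb R^{n-1}\times\{0\}$ in the sense of traces; and such that $w^n(\cdot,x_n)\to u$ in $H^{1/2}(\mathbb R^{n-1})$ as $x_n\to0_+$ and, for every $\delta>0$, $w(x)\to0$ as $|x|\to\infty$ with $x_n\ge\delta$. *Statement.* Let $\psi\in H^{1/2}(\mathbb R^{n-1})$, let $u\in H^{1/2}(\mathbb R^{n-1})$ be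 a solution of the obstacle problem for the half-Laplacian with obstacle $\psi$, and let $w$ be the Lamé extension of $u$. Then $w$ is a weak solution (in the sense of the variational inequality) of the thin obstacle problem for the Lamé system in $B_1^+$ with obstacle $\psi$ and inhomogeneity $F=0$: one has $w\in H^1(B_1^+;\mathbb R^n)$, $w^n\ge\psi$ on $B_1'$ in the sense of traces, and $$a_{B_1^+}(w,\zeta-w)\ \ge\ 0$$ for all $\zeta\in H^1(B_1^+;\mathbb R^n)$ with $\zeta^n\ge\psi$ on $B_1'$ and $\zeta=w$ on $\partial B_1\cap\{x_n>0\}$ in the sense of traces. -/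

import Mathlib

open MeasureTheory Filter Topology
open scoped ContDiff FourierTransform ENNReal

namespace LameObstacle

noncomputable section

/-- `ℝᵐ` with its Euclidean norm and Lebesgue measure. -/
abbrev E (m : ℕ) : Type := EuclideanSpace ℝ (Fin m)

/-! ### The space `H^{1/2}` and the obstacle problem for the half-Laplacian -/

/-- A real function viewed as a complex valued one. -/
def toC {d : ℕ} (u : E d → ℝ) : E d → ℂ := fun x => (u x : ℂ)

/-- `u ∈ H^{1/2}(ℝᵈ)`: `u` is an `L²` function and is a Sobolev function of order `1/2`
(Bessel potential space). -/
def MemHHalf {d : ℕ} (u : E d → ℝ) : Prop :=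
  ∃ h : MemLp (toC u) 2 volume,
    TemperedDistribution.MemSobolev (1 / 2) 2
      (MeasureTheory.Lp.toTemperedDistribution (h.toLp (toC u)))

open Classical in
/-- The (Plancherel) Fourier transform of an `L²` function, with kernel `e^{-2πi⟨x, ξ⟩}`.
The value is `0` when `u` is not in `L²`. -/
def l2Fourier {d : ℕ} (u : E d → ℝ) : E d → ℂ :=
  if h : MemLp (toC u) 2 volume then
    ((𝓕 (h.toLp (toC u)) : Lp (α := E d) ℂ 2 volume) : E d → ℂ)
  else 0

/-- The function `(2π|ξ|)^{1/2} û(ξ)`. -/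
def quarterSymbolMul {d : ℕ} (u : E d → ℝ) : E d → ℂ :=
  fun ξ => (((2 * Real.pi * ‖ξ‖) ^ (1 / 2 : ℝ) : ℝ) : ℂ) * l2Fourier u ξ

open Classical in
/-- `(-Δ)^{1/4} u = 𝓕⁻¹((2π|ξ|)^{1/2} û)` as an `L²` function, for `u ∈ H^{1/2}(ℝᵈ)`.
The value is `0` when `(2π|ξ|)^{1/2} û` is not in `L²`. -/
def quarterLaplacian {d : ℕ} (u : E d → ℝ) : E d → ℂ :=
  if h : MemLp (quarterSymbolMul u) 2 volume then
    ((𝓕⁻ (h.toLp (quarterSymbolMul u)) : Lp (α := E d) ℂ 2 volume) : E d → ℂ)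
  else 0

/-- The bilinear form `∫ (-Δ)^{1/4} u (-Δ)^{1/4} v dx` of the half-Laplacian.  For real `u`, `v`
both factors are real (a.e.), so the conjugate and the real part change nothing. -/
def halfLaplacianForm {d : ℕ} (u v : E d → ℝ) : ℝ :=
  ∫ x, (quarterLaplacian u x * (starRingEnd ℂ) (quarterLaplacian v x)).re

/-- `u ∈ H^{1/2}(ℝᵈ)` is a weak solution of `min {(-Δ)^{1/2} u, u - ψ} = 0` in `ℝᵈ`. -/
structure IsHalfLaplacianObstacleSolution {d : ℕ} (ψ u : E d → ℝ) : Prop where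
  mem : MemHHalf u
  ge_obstacle : ∀ᵐ x, ψ x ≤ u x
  variational : ∀ ζ : E d → ℝ, MemHHalf ζ → (∀ᵐ x, ψ x ≤ ζ x) →
    0 ≤ halfLaplacianForm u (fun x => ζ x - u x)

/-! ### Domains in `ℝⁿ`, `n = d + 1`, and Sobolev functions on them -/

/-- `ℝⁿ₊ = {x : xₙ > 0}`. -/
def halfSpace (d : ℕ) : Set (E (d + 1)) := {x | 0 < x (Fin.last d)}

/-- `B₁⁺ = {x : |x| < 1, xₙ > 0}`. -/
def halfBall (d : ℕ) : Set (E (d + 1)) := Metric.ball 0 1 ∩ halfSpace d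

/-- The point `(x', t)` of `ℝⁿ = ℝⁿ⁻¹ × ℝ`. -/
def consPoint {d : ℕ} (x' : E d) (t : ℝ) : E (d + 1) :=
  WithLp.toLp 2 (Fin.snoc (α := fun _ => ℝ) (fun i => x' i) t)

/-- The classical partial derivative `∂ᵢ f`. -/
def pderiv {m : ℕ} (i : Fin m) (f : E m → ℝ) (x : E m) : ℝ :=
  fderiv ℝ f x (EuclideanSpace.single i 1)

/-- `η ∈ C_c^∞(U)`. -/
def IsTestFunction {m : ℕ} (U : Set (E m)) (η : E m → ℝ) : Prop :=
  ContDiff ℝ ∞ η ∧ HasCompactSupport η ∧ tsupport η ⊆ U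

/-- `g = ∂ᵢ f` weakly in the open set `Ω`. -/
def IsWeakPartial {m : ℕ} (Ω : Set (E m)) (i : Fin m) (f g : E m → ℝ) : Prop :=
  LocallyIntegrableOn f Ω ∧ LocallyIntegrableOn g Ω ∧
    ∀ η, IsTestFunction Ω η → ∫ x in Ω, f x * pderiv i η x = -∫ x in Ω, g x * η x

open Classical in
/-- The weak derivative `∂ᵢ f` in `Ω` (a representative of it; `0` if there is none). -/
def weakPartial {m : ℕ} (Ω : Set (E m)) (i : Fin m) (f : E m → ℝ) : E m → ℝ :=
  if h : ∃ g, IsWeakPartial Ω i f g then h.choose else 0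

/-- `f ∈ Ḣ¹(Ω)`: `f` is locally integrable in `Ω` and all its weak partial derivatives exist and
are in `L²(Ω)`. -/
def MemHDotOne {m : ℕ} (Ω : Set (E m)) (f : E m → ℝ) : Prop :=
  ∀ i, ∃ g, IsWeakPartial Ω i f g ∧ MemLp g 2 (volume.restrict Ω)

/-- `f ∈ H¹(Ω)`. -/
def MemHOne {m : ℕ} (Ω : Set (E m)) (f : E m → ℝ) : Prop :=
  MemLp f 2 (volume.restrict Ω) ∧ MemHDotOne Ω f

/-- Let `U ⊆ ℝⁿ` be open and `f ∈ H¹(U ∩ ℝⁿ₊)`.  The function `g ∈ L²` is the trace of `f` on the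
flat part `U ∩ {xₙ = 0}` of the boundary, in the sense of the Gauss-Green formula
`∫_{U ∩ ℝⁿ₊} ∂ₙ(f η) dx = - ∫_{U ∩ {xₙ = 0}} g η dx'` for all `η ∈ C_c^∞(U)`. -/
def HasFlatTrace {d : ℕ} (U : Set (E (d + 1))) (f : E (d + 1) → ℝ) (g : E d → ℝ) : Prop :=
  MemLp g 2 (volume.restrict {x' : E d | consPoint x' 0 ∈ U}) ∧
    ∀ η, IsTestFunction U η →
      ∫ x in U ∩ halfSpace d,
          (f x * pderiv (Fin.last d) η x +
            weakPartial (U ∩ halfSpace d) (Fin.last d) f x * η x) =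
        -∫ x' in {x' : E d | consPoint x' 0 ∈ U}, g x' * η (consPoint x' 0)

/-- `f ∈ H¹(B₁⁺)` has zero trace on the spherical part `∂B₁ ∩ {xₙ > 0}` of the boundary, in the
sense of the Gauss-Green formula: for `η ∈ C_c^∞(ℝⁿ₊)`, the integral
`∫_{B₁⁺} ∂ᵢ(f η) dx = ∫_{∂B₁ ∩ {xₙ > 0}} f η νᵢ` vanishes for every `i`. -/
def VanishesOnCap {d : ℕ} (f : E (d + 1) → ℝ) : Prop :=
  ∀ i η, IsTestFunction (halfSpace d) η →
    ∫ x in halfBall d, (f x * pderiv i η x + weakPartial (halfBall d) i f x * η x) = 0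

/-! ### The Lamé system -/

/-- The symmetric gradient `e(u) = (∇u + (∇u)ᵀ) / 2` in `Ω`. -/
def strain {m : ℕ} (Ω : Set (E m)) (u : E m → E m) (i j : Fin m) (x : E m) : ℝ :=
  (weakPartial Ω i (fun y => u y j) x + weakPartial Ω j (fun y => u y i) x) / 2

/-- The weak divergence of `u` in `Ω`. -/
def weakDiv {m : ℕ} (Ω : Set (E m)) (u : E m → E m) (x : E m) : ℝ :=
  ∑ i, weakPartial Ω i (fun y => u y i) x

/-- The form `∫_Ω 2μ e(u) : e(v) + λ div u div v dx` of the Lamé system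
`μ Δu + (λ + μ) ∇ div u = 0`. -/
def lameForm {m : ℕ} (lam mu : ℝ) (Ω : Set (E m)) (u v : E m → E m) : ℝ :=
  ∫ x in Ω, (2 * mu * ∑ i, ∑ j, strain Ω u i j x * strain Ω v i j x +
    lam * (weakDiv Ω u x * weakDiv Ω v x))

/-- `w` solves `μ Δwʲ + (λ + μ) ∂ⱼ div w = 0` pointwise in `ℝⁿ₊` for all `j`. -/
def SolvesLameInHalfSpace {d : ℕ} (lam mu : ℝ) (w : E (d + 1) → E (d + 1)) : Prop :=
  ∀ x ∈ halfSpace d, ∀ j,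
    mu * ∑ i, pderiv i (pderiv i (fun y => w y j)) x +
      (lam + mu) * pderiv j (fun z => ∑ i, pderiv i (fun y => w y i) z) x = 0

/-- `w` is the Lamé extension of `φ ∈ H^{1/2}(ℝⁿ⁻¹)` to `ℝⁿ₊`, that is, the solution of
`μ Δwʲ + (λ + μ) ∂ⱼ div w = 0` in `ℝⁿ₊`, `∂ₙwʲ + ∂ⱼwⁿ = 0` for `j < n` and `wⁿ = φ` on
`ℝⁿ⁻¹ × {0}`, with decay at infinity. Only the values of `w` in `ℝⁿ₊` matter. -/
structure IsLameExtension {d : ℕ} (lam mu : ℝ) (φ : E d → ℝ) (w : E (d + 1) → E (d + 1)) :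
    Prop where
  smooth : ContDiffOn ℝ ∞ w (halfSpace d)
  energy : ∀ j, MemHDotOne (halfSpace d) (fun x => w x j)
  slice : ∀ t : ℝ, 0 < t → ∀ j, MemHHalf (fun x' => w (consPoint x' t) j)
  pde : SolvesLameInHalfSpace lam mu w
  /-- The natural boundary condition `∂ₙwʲ + ∂ⱼwⁿ = 0`, `j < n`, in its weak form. -/
  shear_free : ∀ ζ : E (d + 1) → E (d + 1), (∀ j, MemHOne (halfSpace d) (fun x => ζ x j)) →
    HasFlatTrace Set.univ (fun x => ζ x (Fin.last d)) 0 →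
    lameForm lam mu (halfSpace d) w ζ = 0
  /-- `wⁿ(·, t) → φ` in `H^{1/2}(ℝⁿ⁻¹)` as `t → 0+`, first the `L²` part of the norm. -/
  trace_L2 : Tendsto
    (fun t : ℝ => eLpNorm (fun x' => w (consPoint x' t) (Fin.last d) - φ x') 2 volume)
    (𝓝[>] 0) (𝓝 0)
  /-- The homogeneous part of the `H^{1/2}` norm. -/
  trace_HHalf : Tendsto
    (fun t : ℝ => eLpNorm
      (quarterLaplacian (fun x' => w (consPoint x' t) (Fin.last d) - φ x')) 2 volume)
    (𝓝[>] 0) (𝓝 0)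
  /-- `w(x) → 0` as `|x| → ∞`, away from the boundary (up to which `w` need not be bounded). -/
  decay : ∀ δ : ℝ, 0 < δ →
    Tendsto w (Bornology.cobounded (E (d + 1)) ⊓ 𝓟 {x | δ ≤ x (Fin.last d)}) (𝓝 0)

/-- The convex set of `ζ ∈ H¹(B₁⁺; ℝⁿ)` with `ζⁿ ≥ ψ` on `B₁'` in the sense of traces. -/
def Admissible {d : ℕ} (ψ : E d → ℝ) (ζ : E (d + 1) → E (d + 1)) : Prop :=
  (∀ j, MemHOne (halfBall d) (fun x => ζ x j)) ∧
    ∃ g : E d → ℝ, HasFlatTrace (Metric.ball 0 1) (fun x => ζ x (Fin.last d)) g ∧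
      ∀ᵐ x' ∂(volume.restrict (Metric.ball (0 : E d) 1)), ψ x' ≤ g x'

/-- `w` is a weak solution (in the sense of the variational inequality) of the thin obstacle
problem for the Lamé system in `B₁⁺` with obstacle `ψ` and zero inhomogeneity. -/
structure IsLameThinObstacleSolution {d : ℕ} (lam mu : ℝ) (ψ : E d → ℝ)
    (w : E (d + 1) → E (d + 1)) : Prop where
  admissible : Admissible ψ w
  variational : ∀ ζ : E (d + 1) → E (d + 1), Admissible ψ ζ →
    (∀ j, VanishesOnCap (fun x => ζ x j - w x j)) →
    0 ≤ lameForm lam mu (halfBall d) w (fun x => ζ x - w x)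

end

end LameObstacle

namespace LameObstacle

noncomputable section

/-! ### Coordinates on the half space -/

/-! Let `ζ` be a competitor in the half ball. The difference `ζ - w` vanishes on the spherical cap,
so its extension `v` by zero is an `H¹` field on the half space, and the Lamé form of `w` and `ζ -
w` over the half ball equals that of `w` and `v` over the half space. Everything then rests on one
identity, `lameForm_eq_halfLaplacianForm`: if `w` is weakly shear free with normal trace `u`, and
`v` is in `H¹` with normal trace `φ`, then `a(w, v) = c ∫ (-Δ)^{1/4}u (-Δ)^{1/4}φ` with `c = 2μ(λ +
μ)/(λ + 2μ) > 0`. In other words, the Dirichlet-to-Neumann map of the Lamé system under the shear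
free condition is `c (-Δ)^{1/2}`. Here `φ` is `g - u` on `B₁'` and `0` elsewhere, where `g ≥ ψ` is
the normal trace of `ζ`. Hence `u + φ` lies above `ψ`, and the variational inequality for the
half-Laplacian gives the sign.

The identity holds for the following reason. The shear free condition says that `a(w, ·)`
annihilates `H¹` fields with zero normal trace, so `a(w, v)` depends on `φ` alone
(`integral_lameDens_eq_normalGrad`) and `v` may be replaced by a convenient field. If `φ̂` lives in
an annulus, put `g = φ̂/(2π|ξ|)`, let `H` be the harmonic function with density `g`, and take `-a∇H
- (1-a)∂ₙH eₙ + (1+a)xₙ∇∂ₙH` with `a = -μ/(λ+2μ)`. The bulk equation forces this value of `a`, the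
factor `1 + a` makes the boundary shear vanish, the normal trace is `φ`, and the normal stress on
the boundary is `-c (-Δ)^{1/2}φ`. The form is symmetric, so one may integrate by parts with all
derivatives on the smooth explicit stress. Only the boundary pairing of the normal stress with `u`
survives (`integral_lameDens_lameGrad`), and Parseval turns it into the frequency integral. General
`φ` follows by exhausting the frequency space by annuli; `exists_extension` supplies the convergence
in `H¹`. The explicit fields serve as test fields only, and `w` itself is never identified with a
formula.

Two analytic points remain. First, `w` has finite energy but need not be square integrable. Its
slices grow at most linearly in the square of the `L²` norm, so `e^{-c xₙ} w` is in `L²` for all `c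
> 0` (`SubexpL2`), whereas band limited explicit fields decay exponentially (`ExpDecayL2`), and the
products are integrable. Second, the trace `φ` must be shown to lie in `H^{1/2}` before it can be
used as a variation. This is `memHHalf_of_hasFlatTrace`, which tests the nonnegativity of the energy
of `v - s·(explicit field)` in `s`. -/

/-- The coordinates `x'` of a point `(x', t)`. -/
def horiz {d : ℕ} (z : E (d + 1)) : E d := WithLp.toLp 2 (fun i => z (Fin.castSucc i))

@[simp] lemma consPoint_castSucc {d : ℕ} (x : E d) (t : ℝ) (i : Fin d) :
    consPoint x t (Fin.castSucc i) = x i := by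
  simp [consPoint]

@[simp] lemma consPoint_last {d : ℕ} (x : E d) (t : ℝ) : consPoint x t (Fin.last d) = t := by
  simp [consPoint]

@[simp] lemma horiz_consPoint {d : ℕ} (x : E d) (t : ℝ) : horiz (consPoint x t) = x := by
  ext i; simp [horiz]

@[simp] lemma consPoint_horiz {d : ℕ} (z : E (d + 1)) : consPoint (horiz z) (z (Fin.last d)) = z := by
  ext i
  refine Fin.lastCases ?_ (fun i => ?_) i
  · simp
  · simp [horiz]

lemma continuous_horiz {d : ℕ} : Continuous (horiz (d := d)) := by
  unfold horiz; fun_prop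

lemma continuous_consPoint {d : ℕ} :
    Continuous (fun p : E d × ℝ => consPoint p.1 p.2) := by
  unfold consPoint
  refine (PiLp.continuous_toLp 2 _).comp (continuous_pi fun i => ?_)
  refine Fin.lastCases ?_ (fun i => ?_) i
  · simpa using continuous_snd
  · simp only [Fin.snoc_castSucc]; fun_prop

lemma continuous_consPoint_left {d : ℕ} (t : ℝ) : Continuous (fun x : E d => consPoint x t) :=
  continuous_consPoint.comp (by fun_prop : Continuous fun x : E d => (x, t))

lemma continuous_consPoint_right {d : ℕ} (x : E d) : Continuous (fun t : ℝ => consPoint x t) :=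
  continuous_consPoint.comp (by fun_prop : Continuous fun t : ℝ => (x, t))

/-- The homeomorphism `ℝᵈ × ℝ ≃ ℝᵈ⁺¹`. -/
def consHomeo (d : ℕ) : E d × ℝ ≃ₜ E (d + 1) where
  toFun p := consPoint p.1 p.2
  invFun z := (horiz z, z (Fin.last d))
  left_inv p := by simp
  right_inv z := by simp
  continuous_toFun := continuous_consPoint
  continuous_invFun := by
    have := continuous_horiz (d := d)
    fun_prop

lemma consPoint_eq {d : ℕ} (x : E d) (t : ℝ) :
    consPoint x t = consPoint x 0 + t • EuclideanSpace.single (Fin.last d) (1 : ℝ) := by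
  ext i
  refine Fin.lastCases ?_ (fun i => ?_) i
  · simp
  · simp

lemma norm_consPoint_sq {d : ℕ} (x : E d) (t : ℝ) : ‖consPoint x t‖ ^ 2 = ‖x‖ ^ 2 + t ^ 2 := by
  simp [EuclideanSpace.norm_sq_eq, Fin.sum_univ_castSucc]

lemma measurePreserving_consPoint (d : ℕ) :
    MeasurePreserving (fun p : E d × ℝ => consPoint p.1 p.2)
      ((volume : Measure (E d)).prod (volume : Measure ℝ)) volume := by
  have h1 : MeasurePreserving (fun p : E d × ℝ => (p.2, WithLp.ofLp p.1))
      ((volume : Measure (E d)).prod (volume : Measure ℝ))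
      ((volume : Measure ℝ).prod (volume : Measure (Fin d → ℝ))) := by
    have ha : MeasurePreserving (Prod.swap : E d × ℝ → ℝ × E d)
        ((volume : Measure (E d)).prod (volume : Measure ℝ)) (volume.prod volume) :=
      Measure.measurePreserving_swap
    have hb : MeasurePreserving (Prod.map id (WithLp.ofLp : E d → (Fin d → ℝ)))
        ((volume : Measure ℝ).prod (volume : Measure (E d))) (volume.prod volume) :=
      (MeasurePreserving.id volume).prod (PiLp.volume_preserving_ofLp (Fin d))
    exact hb.comp ha
  have h2 := (volume_preserving_piFinSuccAbove (fun _ : Fin (d + 1) => ℝ) (Fin.last d)).symm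
  have h3 := (PiLp.volume_preserving_ofLp (Fin (d + 1))).symm (MeasurableEquiv.toLp 2 _).symm
  have h4 := h3.comp (h2.comp h1)
  refine (congrArg (fun f => MeasurePreserving f _ _) ?_).mpr h4
  funext p
  ext i
  simp only [Function.comp, MeasurableEquiv.piFinSuccAbove]
  refine Fin.lastCases ?_ (fun i => ?_) i
  · simp [consPoint, Fin.insertNthEquiv]
  · simp [consPoint, Fin.insertNthEquiv]

lemma measurableEmbedding_consPoint (d : ℕ) :
    MeasurableEmbedding (fun p : E d × ℝ => consPoint p.1 p.2) :=
  (consHomeo d).measurableEmbedding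

lemma isOpen_halfSpace (d : ℕ) : IsOpen (halfSpace d) :=
  isOpen_lt continuous_const (by fun_prop)

lemma measurableSet_halfSpace (d : ℕ) : MeasurableSet (halfSpace d) :=
  (isOpen_halfSpace d).measurableSet

lemma mem_halfSpace {d : ℕ} {z : E (d + 1)} : z ∈ halfSpace d ↔ 0 < z (Fin.last d) := Iff.rfl

@[simp] lemma consPoint_mem_halfSpace {d : ℕ} {x : E d} {t : ℝ} :
    consPoint x t ∈ halfSpace d ↔ 0 < t := by
  simp [mem_halfSpace]

/-- `{z : zₙ ∈ s}` corresponds to `ℝᵈ × s`. -/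
lemma measurePreserving_consPoint_slab (d : ℕ) {s : Set ℝ} (hs : MeasurableSet s) :
    MeasurePreserving (fun p : E d × ℝ => consPoint p.1 p.2)
      ((volume : Measure (E d)).prod (volume.restrict s))
      (volume.restrict {z : E (d + 1) | z (Fin.last d) ∈ s}) := by
  have hm : MeasurableSet {z : E (d + 1) | z (Fin.last d) ∈ s} :=
    (by fun_prop : Measurable fun z : E (d + 1) => z (Fin.last d)) hs
  have h := (measurePreserving_consPoint d).restrict_preimage hm
  convert h using 1
  have : (fun p : E d × ℝ => consPoint p.1 p.2) ⁻¹' {z : E (d + 1) | z (Fin.last d) ∈ s}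
      = Set.univ ×ˢ s := by
    ext p; simp
  rw [this, ← Measure.prod_restrict, Measure.restrict_univ]

lemma lintegral_slab {d : ℕ} {s : Set ℝ} (hs : MeasurableSet s) {f : E (d + 1) → ℝ≥0∞}
    (hf : AEMeasurable f (volume.restrict {z : E (d + 1) | z (Fin.last d) ∈ s})) :
    ∫⁻ z in {z : E (d + 1) | z (Fin.last d) ∈ s}, f z = ∫⁻ t in s, ∫⁻ x : E d, f (consPoint x t) := by
  have hp := measurePreserving_consPoint_slab d hs
  rw [← hp.lintegral_comp_emb (measurableEmbedding_consPoint d)]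
  rw [lintegral_prod_symm]
  exact hf.comp_quasiMeasurePreserving hp.quasiMeasurePreserving

lemma lintegral_slab' {d : ℕ} {s : Set ℝ} (hs : MeasurableSet s) {f : E (d + 1) → ℝ≥0∞}
    (hf : AEMeasurable f (volume.restrict {z : E (d + 1) | z (Fin.last d) ∈ s})) :
    ∫⁻ z in {z : E (d + 1) | z (Fin.last d) ∈ s}, f z = ∫⁻ x : E d, ∫⁻ t in s, f (consPoint x t) := by
  have hp := measurePreserving_consPoint_slab d hs
  rw [← hp.lintegral_comp_emb (measurableEmbedding_consPoint d)]
  rw [lintegral_prod]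
  exact hf.comp_quasiMeasurePreserving hp.quasiMeasurePreserving

lemma integral_slab {d : ℕ} {s : Set ℝ} (hs : MeasurableSet s) {f : E (d + 1) → ℝ}
    (hf : IntegrableOn f {z : E (d + 1) | z (Fin.last d) ∈ s}) :
    ∫ z in {z : E (d + 1) | z (Fin.last d) ∈ s}, f z = ∫ x : E d, ∫ t in s, f (consPoint x t) := by
  have hp := measurePreserving_consPoint_slab d hs
  rw [← hp.integral_comp (measurableEmbedding_consPoint d)]
  rw [integral_prod]
  exact (hp.integrable_comp_emb (measurableEmbedding_consPoint d)).2 hf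

lemma halfSpace_eq_slab (d : ℕ) : halfSpace d = {z : E (d + 1) | z (Fin.last d) ∈ Set.Ioi 0} := rfl

lemma hasDerivAt_consPoint {d : ℕ} (x : E d) (t : ℝ) :
    HasDerivAt (fun t : ℝ => consPoint x t) (EuclideanSpace.single (Fin.last d) (1 : ℝ)) t := by
  have : (fun t : ℝ => consPoint x t)
      = fun t => consPoint x 0 + t • EuclideanSpace.single (Fin.last d) (1 : ℝ) :=
    funext (consPoint_eq x)
  rw [this]
  simpa using ((hasDerivAt_id t).smul_const (EuclideanSpace.single (Fin.last d) (1 : ℝ))).const_add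
    (consPoint x 0)

lemma hasDerivAt_comp_consPoint {d : ℕ} {f : E (d + 1) → ℝ} {x : E d} {t : ℝ}
    (hf : DifferentiableAt ℝ f (consPoint x t)) :
    HasDerivAt (fun t : ℝ => f (consPoint x t)) (pderiv (Fin.last d) f (consPoint x t)) t :=
  hf.hasFDerivAt.comp_hasDerivAt t (hasDerivAt_consPoint x t)

/-! ### Partial derivatives -/

section pderiv

variable {m : ℕ} {i : Fin m} {f g : E m → ℝ} {x : E m}

lemma pderiv_mul (hf : DifferentiableAt ℝ f x) (hg : DifferentiableAt ℝ g x) :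
    pderiv i (fun y => f y * g y) x = f x * pderiv i g x + pderiv i f x * g x := by
  simp only [pderiv]
  rw [fderiv_fun_mul hf hg]
  simp; ring

lemma pderiv_add (hf : DifferentiableAt ℝ f x) (hg : DifferentiableAt ℝ g x) :
    pderiv i (fun y => f y + g y) x = pderiv i f x + pderiv i g x := by
  simp only [pderiv]
  rw [fderiv_fun_add hf hg]; simp

lemma pderiv_sub (hf : DifferentiableAt ℝ f x) (hg : DifferentiableAt ℝ g x) :
    pderiv i (fun y => f y - g y) x = pderiv i f x - pderiv i g x := by
  simp only [pderiv]
  rw [fderiv_fun_sub hf hg]; simp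

lemma pderiv_congr (h : f =ᶠ[𝓝 x] g) : pderiv i f x = pderiv i g x := by
  simp only [pderiv, h.fderiv_eq]

lemma _root_.ContDiff.pderiv (hf : ContDiff ℝ ∞ f) (i : Fin m) : ContDiff ℝ ∞ (pderiv i f) :=
  (hf.fderiv_right (m := ∞) (by simp)).clm_apply contDiff_const

lemma _root_.ContDiffOn.continuousOn_pderiv {U : Set (E m)} (hU : IsOpen U)
    (hf : ContDiffOn ℝ ∞ f U) (i : Fin m) : ContinuousOn (LameObstacle.pderiv i f) U :=
  (hf.continuousOn_fderiv_of_isOpen hU (by simp)).clm_apply continuousOn_const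

lemma pderiv_eq_zero_of_notMem_tsupport (h : x ∉ tsupport f) : pderiv i f x = 0 := by
  have : f =ᶠ[𝓝 x] fun _ => 0 := notMem_tsupport_iff_eventuallyEq.1 h
  rw [pderiv_congr this]; simp [pderiv]

lemma tsupport_pderiv_subset : tsupport (pderiv i f) ⊆ tsupport f := by
  refine closure_minimal (fun x hx => ?_) (isClosed_tsupport f)
  by_contra h
  exact hx (pderiv_eq_zero_of_notMem_tsupport h)

lemma hasCompactSupport_pderiv (hf : HasCompactSupport f) : HasCompactSupport (pderiv i f) :=
  hf.mono' (subset_closure.trans tsupport_pderiv_subset)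

/-- Integration by parts against the constant function `1`. -/
lemma integral_pderiv_eq_zero (hf : ContDiff ℝ 1 f) (hc : HasCompactSupport f) (i : Fin m) :
    ∫ x, pderiv i f x = 0 := by
  have hfd : Continuous (pderiv i f) := (hf.continuous_fderiv (by simp)).clm_apply continuous_const
  have h1 : Integrable (pderiv i f) := hfd.integrable_of_hasCompactSupport (hasCompactSupport_pderiv hc)
  have h2 : Integrable f := hf.continuous.integrable_of_hasCompactSupport hc
  have h := integral_mul_fderiv_eq_neg_fderiv_mul_of_integrable (𝕜 := ℝ) (μ := (volume : Measure (E m)))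
    (f := fun _ : E m => (1 : ℝ)) (g := f) (v := EuclideanSpace.single i 1)
    (by simp) (by simp only [one_mul]; exact h1) (by simp only [one_mul]; exact h2)
    (fun _ _ => by fun_prop) (fun x _ => hf.differentiable (by simp) x)
  simpa [pderiv] using h

end pderiv

/-! ### Weak derivatives -/

section weak

variable {m : ℕ} {Ω Ω' : Set (E m)} {i : Fin m} {f f' g g' η : E m → ℝ}

lemma IsTestFunction.mono {U V : Set (E m)} (h : U ⊆ V) (hη : IsTestFunction U η) :
    IsTestFunction V η := ⟨hη.1, hη.2.1, hη.2.2.trans h⟩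

lemma IsTestFunction.pderiv {U : Set (E m)} (hη : IsTestFunction U η) (i : Fin m) :
    IsTestFunction U (pderiv i η) :=
  ⟨hη.1.pderiv i, hasCompactSupport_pderiv hη.2.1, tsupport_pderiv_subset.trans hη.2.2⟩

lemma IsTestFunction.eq_zero {U : Set (E m)} (hη : IsTestFunction U η) {x : E m} (hx : x ∉ U) :
    η x = 0 := image_eq_zero_of_notMem_tsupport fun h => hx (hη.2.2 h)

lemma IsTestFunction.integrableOn_mul (hη : IsTestFunction Ω η)
    (hf : LocallyIntegrableOn f Ω) (hΩ : MeasurableSet Ω) :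
    IntegrableOn (fun x => f x * η x) Ω := by
  have h1 : IntegrableOn f (tsupport η) := hf.integrableOn_compact_subset hη.2.2 hη.2.1
  have h2 : IntegrableOn (fun x => f x * η x) (tsupport η) :=
    h1.mul_continuousOn hη.1.continuous.continuousOn hη.2.1
  exact h2.of_forall_sdiff_eq_zero hΩ fun x hx => by
    rw [image_eq_zero_of_notMem_tsupport hx.2, mul_zero]

/-- This is the fundamental lemma of the calculus of variations, applied to `g - g'`. -/
lemma IsWeakPartial.ae_eq (hΩ : IsOpen Ω) (h : IsWeakPartial Ω i f g)
    (h' : IsWeakPartial Ω i f g') : g =ᵐ[volume.restrict Ω] g' := by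
  have key := hΩ.ae_eq_zero_of_integral_contDiff_smul_eq_zero (f := fun x => g x - g' x)
    (μ := (volume : Measure (E m))) (h.2.1.sub h'.2.1) (fun η h1 h2 h3 => by
      have hη : IsTestFunction Ω η := ⟨h1, h2, h3⟩
      have e1 := h.2.2 η hη
      have e2 := h'.2.2 η hη
      have e3 : ∫ x in Ω, η x • (g x - g' x) = ∫ x, η x • (g x - g' x) :=
        setIntegral_eq_integral_of_forall_compl_eq_zero fun x hx => by simp [hη.eq_zero hx]
      rw [← e3]
      have i1 := hη.integrableOn_mul h.2.1 hΩ.measurableSet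
      have i2 := hη.integrableOn_mul h'.2.1 hΩ.measurableSet
      calc ∫ x in Ω, η x • (g x - g' x) = ∫ x in Ω, (g x * η x - g' x * η x) := by
            congr 1; ext x; simp only [smul_eq_mul]; ring
        _ = 0 := by rw [integral_sub i1 i2]; linarith)
  rw [EventuallyEq, ae_restrict_iff' hΩ.measurableSet]
  filter_upwards [key] with x hx hxΩ
  linarith [hx hxΩ]

lemma IsWeakPartial.weakPartial_isWeakPartial (h : IsWeakPartial Ω i f g) :
    IsWeakPartial Ω i f (weakPartial Ω i f) := by
  have : ∃ g, IsWeakPartial Ω i f g := ⟨g, h⟩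
  rw [weakPartial, dif_pos this]
  exact this.choose_spec

/-- The function `weakPartial` is an arbitrary choice of weak derivative; uniqueness allows it to be
traded for any weak derivative at hand. -/
lemma IsWeakPartial.weakPartial_ae_eq (hΩ : IsOpen Ω) (h : IsWeakPartial Ω i f g) :
    weakPartial Ω i f =ᵐ[volume.restrict Ω] g :=
  h.weakPartial_isWeakPartial.ae_eq hΩ h

lemma IsWeakPartial.add (hΩ : IsOpen Ω) (h : IsWeakPartial Ω i f g)
    (h' : IsWeakPartial Ω i f' g') :
    IsWeakPartial Ω i (fun x => f x + f' x) (fun x => g x + g' x) := by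
  refine ⟨h.1.add h'.1, h.2.1.add h'.2.1, fun η hη => ?_⟩
  have i1 := hη.integrableOn_mul h.2.1 hΩ.measurableSet
  have i2 := hη.integrableOn_mul h'.2.1 hΩ.measurableSet
  have i3 := (hη.pderiv i).integrableOn_mul h.1 hΩ.measurableSet
  have i4 := (hη.pderiv i).integrableOn_mul h'.1 hΩ.measurableSet
  simp only [add_mul]
  rw [integral_add i1 i2, integral_add i3 i4, h.2.2 η hη, h'.2.2 η hη]; ring

lemma IsWeakPartial.const_mul (c : ℝ) (h : IsWeakPartial Ω i f g) :
    IsWeakPartial Ω i (fun x => c * f x) (fun x => c * g x) := by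
  refine ⟨h.1.smul c, h.2.1.smul c, fun η hη => ?_⟩
  simp only [mul_assoc]
  rw [integral_const_mul, integral_const_mul, h.2.2 η hη]; ring

lemma IsWeakPartial.sub (hΩ : IsOpen Ω) (h : IsWeakPartial Ω i f g)
    (h' : IsWeakPartial Ω i f' g') :
    IsWeakPartial Ω i (fun x => f x - f' x) (fun x => g x - g' x) := by
  have := h.add hΩ (h'.const_mul (-1))
  simpa [sub_eq_add_neg] using this

lemma IsWeakPartial.mono (hΩ : IsOpen Ω) (hs : Ω' ⊆ Ω)
    (h : IsWeakPartial Ω i f g) : IsWeakPartial Ω' i f g := by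
  refine ⟨h.1.mono_set hs, h.2.1.mono_set hs, fun η hη => ?_⟩
  have e := h.2.2 η (hη.mono hs)
  rw [setIntegral_eq_of_subset_of_forall_sdiff_eq_zero hΩ.measurableSet hs,
    setIntegral_eq_of_subset_of_forall_sdiff_eq_zero hΩ.measurableSet hs] at e
  · exact e
  · intro x hx; rw [hη.eq_zero hx.2, mul_zero]
  · intro x hx; rw [(hη.pderiv i).eq_zero hx.2, mul_zero]

lemma isWeakPartial_zero (Ω : Set (E m)) (i : Fin m) :
    IsWeakPartial Ω i (fun _ => 0) (fun _ => 0) :=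
  ⟨locallyIntegrableOn_zero, locallyIntegrableOn_zero, by simp⟩

lemma isWeakPartial_of_contDiffOn (hΩ : IsOpen Ω) (hf : ContDiffOn ℝ ∞ f Ω) (i : Fin m) :
    IsWeakPartial Ω i f (pderiv i f) := by
  have hc := hf.continuousOn
  have hc' := hf.continuousOn_pderiv hΩ i
  have l1 : LocallyIntegrableOn f Ω := hc.locallyIntegrableOn hΩ.measurableSet
  have l2 : LocallyIntegrableOn (pderiv i f) Ω := hc'.locallyIntegrableOn hΩ.measurableSet
  refine ⟨l1, l2, fun η hη => ?_⟩
  -- Nothing is known about `f` outside `Ω`, but `η` vanishes near every point outside its support,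
  -- so the product is smooth on the whole space.
  have hsm : ContDiff ℝ ∞ (fun x => f x * η x) := by
    rw [contDiff_iff_contDiffAt]
    intro x
    by_cases hx : x ∈ tsupport η
    · exact (hf.contDiffAt (hΩ.mem_nhds (hη.2.2 hx))).mul hη.1.contDiffAt
    · have : (fun x => f x * η x) =ᶠ[𝓝 x] fun _ => 0 := by
        filter_upwards [notMem_tsupport_iff_eventuallyEq.1 hx] with y hy
        simp [hy]
      exact contDiffAt_const.congr_of_eventuallyEq this
  have hcs : HasCompactSupport (fun x => f x * η x) := hη.2.1.mul_left
  have h0 := integral_pderiv_eq_zero (hsm.of_le (by simp)) hcs i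
  have i1 := (hη.pderiv i).integrableOn_mul l1 hΩ.measurableSet
  have i2 := hη.integrableOn_mul l2 hΩ.measurableSet
  have e : ∫ x in Ω, (f x * pderiv i η x + pderiv i f x * η x) = 0 := by
    have e0 : ∫ x in Ω, pderiv i (fun x => f x * η x) x = 0 := by
      rw [setIntegral_eq_integral_of_forall_compl_eq_zero, h0]
      intro x hx
      refine pderiv_eq_zero_of_notMem_tsupport fun h => hx (hη.2.2 ?_)
      exact tsupport_mul_subset_right h
    rw [← e0]
    · refine setIntegral_congr_fun hΩ.measurableSet fun x hx => ?_
      exact (pderiv_mul ((hf.contDiffAt (hΩ.mem_nhds hx)).differentiableAt (by simp))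
        (hη.1.differentiable (by simp) x)).symm
  rw [integral_add i1 i2] at e
  linarith

/-- Cauchy–Schwarz: the products converge in `L¹`. -/
lemma tendsto_integral_mul_of_tendsto_eLpNorm {α : Type*} [MeasurableSpace α] {μ : Measure α}
    {F : ℕ → α → ℝ} {f η : α → ℝ} (hF : ∀ n, MemLp (F n) 2 μ) (hf : MemLp f 2 μ)
    (hη : MemLp η 2 μ) (h : Tendsto (fun n => eLpNorm (fun x => F n x - f x) 2 μ) atTop (𝓝 0)) :
    Tendsto (fun n => ∫ x, F n x * η x ∂μ) atTop (𝓝 (∫ x, f x * η x ∂μ)) := by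
  refine tendsto_integral_of_L1' _ (hf.integrable_mul hη).1
    (Eventually.of_forall fun n => (hF n).integrable_mul hη) ?_
  have hb : ∀ n, eLpNorm ((fun x => F n x * η x) - fun x => f x * η x) 1 μ ≤
      eLpNorm (fun x => F n x - f x) 2 μ * eLpNorm η 2 μ := by
    intro n
    have := eLpNorm_smul_le_mul_eLpNorm (p := 2) (q := 2) (r := 1) (μ := μ)
      (f := η) (φ := fun x => F n x - f x) hη.1 ((hF n).sub hf).1
    convert this using 2
    ext x; simp [sub_mul]
  refine tendsto_of_tendsto_of_tendsto_of_le_of_le tendsto_const_nhds ?_ (fun n => zero_le) hb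
  have := ENNReal.Tendsto.mul_const (b := eLpNorm η 2 μ) h (Or.inr hη.2.ne)
  simpa using this

/-- Weak derivatives pass to the limit in `L²`. -/
lemma isWeakPartial_of_tendsto {F G : ℕ → E m → ℝ}
    (hF : ∀ n, IsWeakPartial Ω i (F n) (G n)) (hFm : ∀ n, MemLp (F n) 2 (volume.restrict Ω))
    (hGm : ∀ n, MemLp (G n) 2 (volume.restrict Ω)) (hf : MemLp f 2 (volume.restrict Ω))
    (hg : MemLp g 2 (volume.restrict Ω))
    (h1 : Tendsto (fun n => eLpNorm (fun x => F n x - f x) 2 (volume.restrict Ω)) atTop (𝓝 0))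
    (h2 : Tendsto (fun n => eLpNorm (fun x => G n x - g x) 2 (volume.restrict Ω)) atTop (𝓝 0)) :
    IsWeakPartial Ω i f g := by
  have li : ∀ {f : E m → ℝ}, MemLp f 2 (volume.restrict Ω) → LocallyIntegrableOn f Ω :=
    fun hf => (locallyIntegrableOn_of_locallyIntegrable_restrict
      (hf.locallyIntegrable (by norm_num)))
  refine ⟨li hf, li hg, fun η hη => ?_⟩
  have lim : ∀ {F : ℕ → E m → ℝ} {f η : E m → ℝ}, (∀ n, MemLp (F n) 2 (volume.restrict Ω)) →
      MemLp f 2 (volume.restrict Ω) → IsTestFunction Ω η →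
      Tendsto (fun n => eLpNorm (fun x => F n x - f x) 2 (volume.restrict Ω)) atTop (𝓝 0) →
      Tendsto (fun n => ∫ x in Ω, F n x * η x) atTop (𝓝 (∫ x in Ω, f x * η x)) :=
    fun hF hf hη h => tendsto_integral_mul_of_tendsto_eLpNorm hF hf
      ((hη.1.continuous.memLp_of_hasCompactSupport hη.2.1).restrict Ω) h
  have a1 := lim hFm hf (hη.pderiv i) h1
  have a2 := (lim hGm hg hη h2).neg
  refine tendsto_nhds_unique a1 (a2.congr fun n => ?_)
  exact ((hF n).2.2 η hη).symm

end weak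

/-! ### Integration by parts up to the flat boundary -/

/-- `f` is integrable on bounded subsets of the half space. -/
def IntegrableUpToBoundary {d : ℕ} (f : E (d + 1) → ℝ) : Prop :=
  ∀ R : ℝ, IntegrableOn f (halfSpace d ∩ Metric.closedBall 0 R)

lemma integrableUpToBoundary_of_memLp {d : ℕ} {f : E (d + 1) → ℝ}
    (hf : MemLp f 2 (volume.restrict (halfSpace d))) : IntegrableUpToBoundary f := by
  intro R
  have h1 : MemLp f 2 (volume.restrict (halfSpace d ∩ Metric.closedBall 0 R)) :=
    hf.mono_measure (Measure.restrict_mono Set.inter_subset_left le_rfl)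
  have : IsFiniteMeasure (volume.restrict (halfSpace d ∩ Metric.closedBall (0 : E (d + 1)) R)) :=
    ⟨by
      rw [Measure.restrict_apply_univ]
      exact (measure_mono Set.inter_subset_right).trans_lt
        (isCompact_closedBall _ _).measure_lt_top⟩
  exact h1.integrable (by norm_num)

section boundary

variable {d : ℕ} {f g σ η : E (d + 1) → ℝ} {i : Fin (d + 1)}

lemma IntegrableUpToBoundary.integrableOn_of_compact (hf : IntegrableUpToBoundary f)
    {K : Set (E (d + 1))} (hK : IsCompact K) : IntegrableOn f (halfSpace d ∩ K) := by
  obtain ⟨R, hR⟩ := hK.isBounded.subset_closedBall 0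
  exact (hf R).mono_set (Set.inter_subset_inter_right _ hR)

lemma IntegrableUpToBoundary.integrableOn_mul (hf : IntegrableUpToBoundary f)
    (hη : Continuous η) (hc : HasCompactSupport η) :
    IntegrableOn (fun z => f z * η z) (halfSpace d) := by
  have h1 := hf.integrableOn_of_compact hc
  have h2 : IntegrableOn (fun x => f x * η x) (halfSpace d ∩ tsupport η) := by
    obtain ⟨C, hC⟩ := hη.bounded_above_of_compact_support hc
    exact Integrable.mul_bdd (c := C) h1 hη.aestronglyMeasurable (Eventually.of_forall hC)
  exact h2.of_forall_sdiff_eq_zero (measurableSet_halfSpace d) fun x hx => by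
    rw [image_eq_zero_of_notMem_tsupport fun h => hx.2 ⟨hx.1, h⟩, mul_zero]

/-- Cut-off functions vanishing for `zₙ ≤ 1 / (n + 1)`. -/
def bdryCutoff (d n : ℕ) (z : E (d + 1)) : ℝ :=
  Real.smoothTransition ((n + 1) * z (Fin.last d) - 1)

lemma contDiff_bdryCutoff (d n : ℕ) : ContDiff ℝ ∞ (bdryCutoff d n) :=
  Real.smoothTransition.contDiff.comp (by fun_prop)

lemma deriv_smoothTransition_eq_zero {s : ℝ} (hs : s < 0 ∨ 1 < s) :
    deriv Real.smoothTransition s = 0 := by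
  rcases hs with hs | hs
  · have : Real.smoothTransition =ᶠ[𝓝 s] fun _ => 0 := by
      filter_upwards [Iio_mem_nhds hs] with y hy
      exact Real.smoothTransition.zero_of_nonpos (le_of_lt hy)
    rw [this.deriv_eq]; simp
  · have : Real.smoothTransition =ᶠ[𝓝 s] fun _ => 1 := by
      filter_upwards [Ioi_mem_nhds hs] with y hy
      exact Real.smoothTransition.one_of_one_le (le_of_lt hy)
    rw [this.deriv_eq]; simp

lemma exists_bound_deriv_smoothTransition :
    ∃ M : ℝ, 0 ≤ M ∧ ∀ s, |deriv Real.smoothTransition s| ≤ M := by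
  have hc : Continuous (deriv Real.smoothTransition) :=
    (Real.smoothTransition.contDiff (n := 1)).continuous_deriv (by simp)
  have hs : HasCompactSupport (deriv Real.smoothTransition) :=
    HasCompactSupport.intro (isCompact_Icc (a := (0 : ℝ)) (b := 1)) fun s hs => by
      refine deriv_smoothTransition_eq_zero ?_
      by_contra! h
      exact hs ⟨h.1, h.2⟩
  obtain ⟨C, hC⟩ := hc.bounded_above_of_compact_support hs
  exact ⟨C, (norm_nonneg _).trans (hC 0), hC⟩

lemma pderiv_comp_coord {φ : ℝ → ℝ} {a b : ℝ} {z : E (d + 1)} {j : Fin (d + 1)}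
    (hφ : DifferentiableAt ℝ φ (a * z j - b)) :
    pderiv i (fun y : E (d + 1) => φ (a * y j - b)) z =
      if i = j then a * deriv φ (a * z j - b) else 0 := by
  have h2 : HasFDerivAt (fun y : E (d + 1) => a * y j - b)
      (a • (EuclideanSpace.proj j : E (d + 1) →L[ℝ] ℝ)) z := by
    have := ((EuclideanSpace.proj j : E (d + 1) →L[ℝ] ℝ).hasFDerivAt (x := z)).const_mul a
    exact this.sub_const b
  have h1 := hφ.hasDerivAt.comp_hasFDerivAt z h2
  have h3 : HasFDerivAt (fun y : E (d + 1) => φ (a * y j - b)) _ z := h1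
  rw [pderiv, h3.fderiv]
  by_cases hij : i = j
  · subst hij; simp; ring
  · simp [hij, Ne.symm hij]

lemma pderiv_bdryCutoff (n : ℕ) (z : E (d + 1)) :
    pderiv i (bdryCutoff d n) z = if i = Fin.last d then
      ((n : ℝ) + 1) * deriv Real.smoothTransition ((n + 1) * z (Fin.last d) - 1) else 0 :=
  pderiv_comp_coord ((Real.smoothTransition.contDiff (n := 1)).differentiable (by simp) _)

/-- A smooth compactly supported function is Lipschitz; compare `z` with its foot point `(z', 0)`.
-/
lemma abs_le_mul_last (hη : ContDiff ℝ ∞ η) (hc : HasCompactSupport η)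
    (h0 : ∀ x, η (consPoint x 0) = 0) :
    ∃ L : ℝ, 0 ≤ L ∧ ∀ z, |η z| ≤ L * |z (Fin.last d)| := by
  obtain ⟨L, hL⟩ := ContDiff.lipschitzWith_of_hasCompactSupport hc (hη.of_le (by simp) : ContDiff ℝ 1 η)
    (by simp)
  refine ⟨L, L.2, fun z => ?_⟩
  have h1 := hL.dist_le_mul z (consPoint (horiz z) 0)
  rw [h0, dist_zero_right] at h1
  have h2 : dist z (consPoint (horiz z) 0) = |z (Fin.last d)| := by
    conv_lhs => rw [← consPoint_horiz z, horiz_consPoint, consPoint_eq]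
    simp [dist_eq_norm, norm_smul]
  rwa [h2] at h1

/-- No boundary term appears if the derivative is tangential, or if the test function vanishes on
the boundary. -/
lemma IsWeakPartial.integral_eq_zero_of_bdry (hfg : IsWeakPartial (halfSpace d) i f g)
    (hf : IntegrableUpToBoundary f) (hg : IntegrableUpToBoundary g)
    (hη : ContDiff ℝ ∞ η) (hc : HasCompactSupport η)
    (h0 : i ≠ Fin.last d ∨ ∀ x, η (consPoint x 0) = 0) :
    ∫ z in halfSpace d, (f z * pderiv i η z + g z * η z) = 0 := by
  set κ := bdryCutoff d with hκ
  have hκ1 : ∀ n z, |κ n z| ≤ 1 := fun n z => by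
    rw [hκ, bdryCutoff, abs_of_nonneg (Real.smoothTransition.nonneg _)]; exact Real.smoothTransition.le_one _
  have htest : ∀ n, IsTestFunction (halfSpace d) (fun z => κ n z * η z) := by
    intro n
    refine ⟨(contDiff_bdryCutoff d n).mul hη, hc.mul_left, ?_⟩
    have hcl : IsClosed {z : E (d + 1) | 1 / ((n : ℝ) + 1) ≤ z (Fin.last d)} :=
      isClosed_le continuous_const (by fun_prop)
    refine (closure_minimal (fun z hz => ?_) hcl).trans fun z hz => ?_
    · by_contra hlt
      refine hz ?_
      have : κ n z = 0 := by
        refine Real.smoothTransition.zero_of_nonpos ?_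
        have h1 : z (Fin.last d) < 1 / ((n : ℝ) + 1) := not_le.1 hlt
        rw [lt_div_iff₀ (by positivity)] at h1
        linarith
      simp [this]
    · exact lt_of_lt_of_le (by positivity : (0 : ℝ) < 1 / ((n : ℝ) + 1)) hz
  -- The only dangerous term contains the derivative of the cut-off, which is of size `n`. It is
  -- absent in tangential directions. In the normal direction it lives where `(n + 1) zₙ ≤ 2`, and
  -- there `|η| ≤ L zₙ` compensates the factor `n + 1`; this gives the constant `2ML`.
  obtain ⟨D, hD0, hD⟩ : ∃ D : ℝ, 0 ≤ D ∧ ∀ n, ∀ z ∈ halfSpace d, |pderiv i (κ n) z * η z| ≤ D := by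
    rcases h0 with h0 | h0
    · exact ⟨0, le_rfl, fun n z _ => by simp [hκ, pderiv_bdryCutoff, h0]⟩
    · obtain ⟨L, hL0, hL⟩ := abs_le_mul_last hη hc h0
      obtain ⟨M, hM0, hM⟩ := exists_bound_deriv_smoothTransition
      refine ⟨2 * M * L, by positivity, fun n z hz => ?_⟩
      rw [hκ, pderiv_bdryCutoff]
      split_ifs with hi
      · have hz' : 0 < z (Fin.last d) := hz
        by_cases hs : 1 < ((n : ℝ) + 1) * z (Fin.last d) - 1
        · rw [deriv_smoothTransition_eq_zero (Or.inr hs)]; simp; positivity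
        · have h1 := hL z
          rw [abs_of_pos hz'] at h1
          rw [abs_mul, abs_mul, abs_of_nonneg (by positivity : (0 : ℝ) ≤ (n : ℝ) + 1)]
          calc ((n : ℝ) + 1) * |deriv Real.smoothTransition ((n + 1) * z (Fin.last d) - 1)| * |η z|
              ≤ ((n : ℝ) + 1) * M * (L * z (Fin.last d)) := by
                gcongr; exact hM _
            _ = M * L * (((n : ℝ) + 1) * z (Fin.last d)) := by ring
            _ ≤ M * L * 2 := by gcongr; linarith
            _ = 2 * M * L := by ring
      · simp; positivity
  have hlim : ∀ z ∈ halfSpace d, ∀ᶠ n : ℕ in atTop, κ n z = 1 ∧ pderiv i (κ n) z = 0 := by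
    intro z hz
    have hz' : 0 < z (Fin.last d) := hz
    have : Tendsto (fun n : ℕ => ((n : ℝ) + 1) * z (Fin.last d) - 1) atTop atTop := by
      refine tendsto_atTop_add_const_right _ _ (Tendsto.atTop_mul_const hz' ?_)
      exact tendsto_atTop_add_const_right _ _ tendsto_natCast_atTop_atTop
    filter_upwards [this.eventually_gt_atTop 1] with n hn
    refine ⟨Real.smoothTransition.one_of_one_le hn.le, ?_⟩
    rw [hκ, pderiv_bdryCutoff, deriv_smoothTransition_eq_zero (Or.inr hn)]; simp
  have hηi := hη.pderiv i
  have i1 := hf.integrableOn_mul hηi.continuous (hasCompactSupport_pderiv hc)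
  have i2 := hg.integrableOn_mul hη.continuous hc
  have i3 : IntegrableOn (fun z => (tsupport η).indicator (fun z => D * ‖f z‖) z) (halfSpace d) := by
    rw [IntegrableOn, integrable_indicator_iff (isClosed_tsupport η).measurableSet, IntegrableOn,
      Measure.restrict_restrict (isClosed_tsupport η).measurableSet, Set.inter_comm]
    exact (hf.integrableOn_of_compact hc).norm.const_mul D
  have hpd : ∀ n z, pderiv i (fun z => κ n z * η z) z = κ n z * pderiv i η z +
      pderiv i (κ n) z * η z := fun n z =>
    pderiv_mul ((contDiff_bdryCutoff d n).differentiable (by simp) z)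
      (hη.differentiable (by simp) z)
  have hI : ∀ n, ∫ z in halfSpace d, (f z * (κ n z * pderiv i η z + pderiv i (κ n) z * η z) +
      g z * (κ n z * η z)) = 0 := by
    intro n
    have e := hfg.2.2 _ (htest n)
    have j1 := ((htest n).pderiv i).integrableOn_mul hfg.1 (measurableSet_halfSpace d)
    have j2 := (htest n).integrableOn_mul hfg.2.1 (measurableSet_halfSpace d)
    simp only [hpd] at e j1
    rw [integral_add j1 j2, e]; ring
  have key : Tendsto (fun n => ∫ z in halfSpace d, (f z * (κ n z * pderiv i η z +
      pderiv i (κ n) z * η z) + g z * (κ n z * η z))) atTop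
      (𝓝 (∫ z in halfSpace d, (f z * pderiv i η z + g z * η z))) := by
    refine tendsto_integral_of_dominated_convergence
      (fun z => ‖f z * pderiv i η z‖ + ‖g z * η z‖ +
        (tsupport η).indicator (fun z => D * ‖f z‖) z) (fun n => ?_) ((i1.norm.add i2.norm).add i3) (fun n => ?_) ?_
    · have j1 := ((htest n).pderiv i).integrableOn_mul hfg.1 (measurableSet_halfSpace d)
      have j2 := (htest n).integrableOn_mul hfg.2.1 (measurableSet_halfSpace d)
      simp only [hpd] at j1
      exact (j1.add j2).1
    · rw [ae_restrict_iff' (measurableSet_halfSpace d)]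
      refine Eventually.of_forall fun z hz => ?_
      have b1 : ‖f z * (κ n z * pderiv i η z)‖ ≤ ‖f z * pderiv i η z‖ := by
        rw [norm_mul, norm_mul, norm_mul]
        have := hκ1 n z
        rw [← Real.norm_eq_abs] at this
        have h3 := mul_le_of_le_one_left (norm_nonneg (pderiv i η z)) this
        gcongr
      have b2 : ‖g z * (κ n z * η z)‖ ≤ ‖g z * η z‖ := by
        rw [norm_mul, norm_mul, norm_mul]
        have := hκ1 n z
        rw [← Real.norm_eq_abs] at this
        have h3 := mul_le_of_le_one_left (norm_nonneg (η z)) this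
        gcongr
      have b3 : ‖f z * (pderiv i (κ n) z * η z)‖ ≤
          (tsupport η).indicator (fun z => D * ‖f z‖) z := by
        by_cases hzs : z ∈ tsupport η
        · rw [Set.indicator_of_mem hzs, norm_mul, mul_comm]
          gcongr
          exact hD n z hz
        · rw [image_eq_zero_of_notMem_tsupport hzs]; simp [hzs]
      rw [mul_add]
      calc _ ≤ ‖f z * (κ n z * pderiv i η z)‖ + ‖f z * (pderiv i (κ n) z * η z)‖ +
            ‖g z * (κ n z * η z)‖ := norm_add₃_le
        _ ≤ _ := by linarith
    · rw [ae_restrict_iff' (measurableSet_halfSpace d)]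
      refine Eventually.of_forall fun z hz => ?_
      refine tendsto_const_nhds.congr' ?_
      filter_upwards [hlim z hz] with n hn
      rw [hn.1, hn.2]; ring
  simp only [hI] at key
  exact (tendsto_nhds_unique key tendsto_const_nhds)

/-- Spatial cut-off functions. -/
lemma exists_cutoff (m : ℕ) : ∃ χ : ℕ → E m → ℝ, (∀ n, ContDiff ℝ ∞ (χ n)) ∧
    (∀ n, HasCompactSupport (χ n)) ∧ (∀ n z, |χ n z| ≤ 1) ∧
    (∃ C : ℝ, ∀ n i z, |pderiv i (χ n) z| ≤ C) ∧
    ∀ z, ∀ᶠ n in atTop, χ n =ᶠ[𝓝 z] fun _ => 1 := by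
  let φ : ContDiffBump (0 : E m) := ⟨1, 2, by norm_num, by norm_num⟩
  let χ : ℕ → E m → ℝ := fun n z => φ (((n : ℝ) + 1)⁻¹ • z)
  have hsm : ∀ n, ContDiff ℝ ∞ (χ n) := fun n => φ.contDiff.comp (contDiff_const_smul _)
  have hpd : ∀ n i z, pderiv i (χ n) z = ((n : ℝ) + 1)⁻¹ * pderiv i φ (((n : ℝ) + 1)⁻¹ • z) := by
    intro n i z
    have h1 : HasFDerivAt (fun z : E m => ((n : ℝ) + 1)⁻¹ • z)
        (((n : ℝ) + 1)⁻¹ • ContinuousLinearMap.id ℝ (E m)) z :=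
      (((n : ℝ) + 1)⁻¹ • ContinuousLinearMap.id ℝ (E m)).hasFDerivAt
    have h2 := ((φ.contDiff (n := 1)).differentiable (by simp)
      (((n : ℝ) + 1)⁻¹ • z)).hasFDerivAt.comp z h1
    have h3 : HasFDerivAt (χ n) _ z := h2
    rw [pderiv, h3.fderiv]
    simp [pderiv]
  refine ⟨χ, hsm, fun n => ?_, fun n z => ?_, ?_, fun z => ?_⟩
  · exact φ.hasCompactSupport.comp_smul (by positivity)
  · rw [abs_of_nonneg φ.nonneg]; exact φ.le_one
  · have hb : ∀ i : Fin m, ∃ C : ℝ, ∀ z, ‖pderiv i φ z‖ ≤ C := fun i =>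
      ((φ.contDiff (n := ⊤)).pderiv i).continuous.bounded_above_of_compact_support
        (hasCompactSupport_pderiv φ.hasCompactSupport)
    choose C hC using hb
    refine ⟨∑ i, |C i|, fun n i z => ?_⟩
    rw [hpd, abs_mul]
    have h1 : |((n : ℝ) + 1)⁻¹| ≤ 1 := by
      rw [abs_of_nonneg (by positivity)]
      exact inv_le_one_of_one_le₀ (by linarith [(Nat.cast_nonneg n : (0 : ℝ) ≤ n)])
    have h2 := (hC i (((n : ℝ) + 1)⁻¹ • z)).trans (le_abs_self _)
    have h3 : |C i| ≤ ∑ i, |C i| :=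
      Finset.single_le_sum (f := fun i => |C i|) (fun i _ => abs_nonneg _) (Finset.mem_univ i)
    rw [Real.norm_eq_abs] at h2
    calc _ ≤ 1 * |pderiv i φ (((n : ℝ) + 1)⁻¹ • z)| := by gcongr
      _ ≤ _ := by linarith
  · have h1 : Tendsto (fun n : ℕ => ‖((n : ℝ) + 1)⁻¹ • z‖) atTop (𝓝 0) := by
      have : Tendsto (fun n : ℕ => ((n : ℝ) + 1)⁻¹) atTop (𝓝 0) := by
        simpa using tendsto_one_div_add_atTop_nhds_zero_nat (𝕜 := ℝ)
      simpa using (this.smul_const z).norm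
    filter_upwards [h1.eventually_lt_const (zero_lt_one)] with n hn
    have hcont : Continuous fun y : E m => ‖((n : ℝ) + 1)⁻¹ • y‖ := by fun_prop
    filter_upwards [(isOpen_lt hcont continuous_const).mem_nhds hn] with y hy
    refine φ.one_of_mem_closedBall ?_
    simpa [mem_closedBall_zero_iff, φ] using le_of_lt hy

/-- Cut-off argument for integration by parts against functions without compact support. -/
lemma tendsto_integral_cutoff (hσ : ContDiff ℝ ∞ σ) {χ : ℕ → E (d + 1) → ℝ}
    (h1 : ∀ n, ContDiff ℝ ∞ (χ n)) (h3 : ∀ n z, |χ n z| ≤ 1)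
    {C : ℝ} (h4 : ∀ n i z, |pderiv i (χ n) z| ≤ C)
    (h5 : ∀ z, ∀ᶠ n in atTop, χ n =ᶠ[𝓝 z] fun _ => 1) (i : Fin (d + 1))
    (i0 : IntegrableOn (fun z => f z * σ z) (halfSpace d))
    (i1 : IntegrableOn (fun z => f z * pderiv i σ z) (halfSpace d))
    (i2 : IntegrableOn (fun z => g z * σ z) (halfSpace d)) :
    Tendsto (fun n => ∫ z in halfSpace d, (f z * pderiv i (fun z => χ n z * σ z) z +
      g z * (χ n z * σ z))) atTop
      (𝓝 (∫ z in halfSpace d, (f z * pderiv i σ z + g z * σ z))) := by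
  have hpd : ∀ n z, pderiv i (fun z => χ n z * σ z) z = χ n z * pderiv i σ z +
      pderiv i (χ n) z * σ z := fun n z =>
    pderiv_mul ((h1 n).differentiable (by simp) z) (hσ.differentiable (by simp) z)
  have hre : ∀ n z, f z * pderiv i (fun z => χ n z * σ z) z + g z * (χ n z * σ z) =
      χ n z * (f z * pderiv i σ z) + pderiv i (χ n) z * (f z * σ z) + χ n z * (g z * σ z) := by
    intro n z; rw [hpd]; ring
  simp only [hre]
  refine tendsto_integral_of_dominated_convergence
    (fun z => ‖f z * pderiv i σ z‖ + C * ‖f z * σ z‖ + ‖g z * σ z‖) (fun n => ?_)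
    ((i1.norm.add (i0.norm.const_mul C)).add i2.norm) (fun n => Eventually.of_forall fun z => ?_)
    (Eventually.of_forall fun z => ?_)
  · exact (((h1 n).continuous.aestronglyMeasurable.mul i1.1).add
      (((h1 n).pderiv i).continuous.aestronglyMeasurable.mul i0.1)).add
      ((h1 n).continuous.aestronglyMeasurable.mul i2.1)
  · refine norm_add₃_le.trans ?_
    rw [norm_mul (χ n z), norm_mul (pderiv i (χ n) z), norm_mul (χ n z)]
    have a := h3 n z
    have b := h4 n i z
    rw [← Real.norm_eq_abs] at a b
    have c1 := mul_le_of_le_one_left (norm_nonneg (f z * pderiv i σ z)) a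
    have c2 := mul_le_of_le_one_left (norm_nonneg (g z * σ z)) a
    have c3 := mul_le_mul_of_nonneg_right b (norm_nonneg (f z * σ z))
    linarith
  · refine tendsto_const_nhds.congr' ?_
    filter_upwards [h5 z] with n hn
    have e1 : χ n z = 1 := hn.eq_of_nhds
    have e2 : pderiv i (χ n) z = 0 := by rw [pderiv_congr hn]; simp [pderiv]
    rw [e1, e2]; ring

/-- The stress of the explicit solution decays but is not compactly supported, so the formula for
compactly supported test functions is transferred to it by spatial cut-offs. -/
lemma IsWeakPartial.integral_eq_zero_of_integrable (hfg : IsWeakPartial (halfSpace d) i f g)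
    (hf : IntegrableUpToBoundary f) (hg : IntegrableUpToBoundary g) (hσ : ContDiff ℝ ∞ σ)
    (h0 : i ≠ Fin.last d ∨ ∀ x, σ (consPoint x 0) = 0)
    (i0 : IntegrableOn (fun z => f z * σ z) (halfSpace d))
    (i1 : IntegrableOn (fun z => f z * pderiv i σ z) (halfSpace d))
    (i2 : IntegrableOn (fun z => g z * σ z) (halfSpace d)) :
    ∫ z in halfSpace d, (f z * pderiv i σ z + g z * σ z) = 0 := by
  obtain ⟨χ, h1, h2, h3, ⟨C, h4⟩, h5⟩ := exists_cutoff (d + 1)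
  refine tendsto_nhds_unique (tendsto_integral_cutoff hσ h1 h3 h4 h5 i i0 i1 i2)
    (tendsto_const_nhds.congr fun n => ?_)
  refine (hfg.integral_eq_zero_of_bdry hf hg ((h1 n).mul hσ) (h2 n).mul_right ?_).symm
  exact h0.imp_right fun h x => by simp [h x]

/-- Over the whole space the restricted measures disappear, and the chosen `weakPartial` is replaced
by the given weak derivative. -/
lemma hasFlatTrace_univ_iff {t : E d → ℝ} (hfg : IsWeakPartial (halfSpace d) (Fin.last d) f g) :
    HasFlatTrace Set.univ f t ↔ MemLp t 2 ∧ ∀ η, IsTestFunction Set.univ η →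
      ∫ z in halfSpace d, (f z * pderiv (Fin.last d) η z + g z * η z) =
        -∫ x, t x * η (consPoint x 0) := by
  have h := hfg.weakPartial_ae_eq (isOpen_halfSpace d)
  have e : ∀ η : E (d + 1) → ℝ, ∫ z in halfSpace d, (f z * pderiv (Fin.last d) η z +
      weakPartial (halfSpace d) (Fin.last d) f z * η z) =
      ∫ z in halfSpace d, (f z * pderiv (Fin.last d) η z + g z * η z) := fun η =>
    integral_congr_ae (by filter_upwards [h] with z hz; rw [hz])
  unfold HasFlatTrace
  simp only [Set.mem_univ, Set.ofPred_true, Measure.restrict_univ, Set.univ_inter, e]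

/-- The defining Green formula of the trace extends by spatial cut-offs to smooth functions without
compact support, as soon as all terms are integrable. -/
lemma HasFlatTrace.integral_eq_of_integrable {t : E d → ℝ}
    (hfg : IsWeakPartial (halfSpace d) (Fin.last d) f g) (ht : HasFlatTrace Set.univ f t)
    (hσ : ContDiff ℝ ∞ σ)
    (i0 : IntegrableOn (fun z => f z * σ z) (halfSpace d))
    (i1 : IntegrableOn (fun z => f z * pderiv (Fin.last d) σ z) (halfSpace d))
    (i2 : IntegrableOn (fun z => g z * σ z) (halfSpace d))
    (i3 : Integrable (fun x => t x * σ (consPoint x 0))) :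
    ∫ z in halfSpace d, (f z * pderiv (Fin.last d) σ z + g z * σ z) =
      -∫ x, t x * σ (consPoint x 0) := by
  obtain ⟨χ, h1, h2, h3, ⟨C, h4⟩, h5⟩ := exists_cutoff (d + 1)
  have ht' := ((hasFlatTrace_univ_iff hfg).1 ht).2
  refine tendsto_nhds_unique (tendsto_integral_cutoff hσ h1 h3 h4 h5 _ i0 i1 i2)
    (Tendsto.congr (fun n => (ht' _ ⟨(h1 n).mul hσ, (h2 n).mul_right, Set.subset_univ _⟩).symm) ?_)
  refine Tendsto.neg (tendsto_integral_of_dominated_convergence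
    (fun x => ‖t x * σ (consPoint x 0)‖) (fun n => ?_) i3.norm
    (fun n => Eventually.of_forall fun x => ?_) (Eventually.of_forall fun x => ?_))
  · have : (fun x => t x * (χ n (consPoint x 0) * σ (consPoint x 0))) =
        fun x => χ n (consPoint x 0) * (t x * σ (consPoint x 0)) := by ext; ring
    rw [this]
    exact ((h1 n).continuous.comp (continuous_consPoint_left 0)).aestronglyMeasurable.mul i3.1
  · have : t x * (χ n (consPoint x 0) * σ (consPoint x 0)) =
        χ n (consPoint x 0) * (t x * σ (consPoint x 0)) := by ring
    rw [this, norm_mul]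
    exact mul_le_of_le_one_left (norm_nonneg _) (h3 n _)
  · refine tendsto_const_nhds.congr' ?_
    filter_upwards [h5 (consPoint x 0)] with n hn
    rw [hn.eq_of_nhds, one_mul]

end boundary

/-! ### Traces on the flat boundary -/

lemma eLpNorm_two_sq {α F : Type*} [MeasurableSpace α] [NormedAddCommGroup F] (f : α → F)
    (μ : Measure α) : eLpNorm f 2 μ ^ 2 = ∫⁻ x, ‖f x‖ₑ ^ 2 ∂μ := by
  have := eLpNorm_nnreal_pow_eq_lintegral (f := f) (μ := μ) (p := 2) (by norm_num)
  simpa using this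

lemma memLp_two_of_lintegral {α F : Type*} [MeasurableSpace α] [NormedAddCommGroup F] {f : α → F}
    {μ : Measure α} (hf : AEStronglyMeasurable f μ) (h : ∫⁻ x, ‖f x‖ₑ ^ 2 ∂μ < (⊤ : ℝ≥0∞)) :
    MemLp f 2 μ := by
  refine ⟨hf, ?_⟩
  rw [← eLpNorm_two_sq] at h
  by_contra hc
  rw [not_lt, top_le_iff] at hc
  simp [hc] at h

lemma lintegral_sq_lt_top {α F : Type*} [MeasurableSpace α] [NormedAddCommGroup F] {f : α → F}
    {μ : Measure α} (hf : MemLp f 2 μ) : ∫⁻ x, ‖f x‖ₑ ^ 2 ∂μ < (⊤ : ℝ≥0∞) := by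
  rw [← eLpNorm_two_sq]
  exact ENNReal.pow_lt_top hf.2

/-- Cauchy–Schwarz against the constant `1`. -/
lemma sq_lintegral_le {α : Type*} [MeasurableSpace α] {μ : Measure α} {f : α → ℝ≥0∞}
    (hf : AEMeasurable f μ) : (∫⁻ x, f x ∂μ) ^ 2 ≤ μ Set.univ * ∫⁻ x, f x ^ 2 ∂μ := by
  have h := ENNReal.lintegral_mul_le_Lp_mul_Lq μ (Real.HolderConjugate.two_two)
    (f := fun _ => 1) (g := f) aemeasurable_const hf
  simp only [Pi.mul_apply, one_mul, ENNReal.one_rpow, lintegral_const, one_div] at h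
  calc (∫⁻ x, f x ∂μ) ^ 2 ≤ (μ Set.univ ^ (2 : ℝ)⁻¹ * (∫⁻ x, f x ^ (2 : ℝ) ∂μ) ^ (2 : ℝ)⁻¹) ^ 2 := by
        gcongr
    _ = _ := by
        rw [mul_pow, ← ENNReal.rpow_natCast, ← ENNReal.rpow_natCast, ← ENNReal.rpow_mul,
          ← ENNReal.rpow_mul]
        norm_num

lemma enorm_add_sq_le {F : Type*} [NormedAddCommGroup F] (a b : F) :
    ‖a + b‖ₑ ^ 2 ≤ 2 * ‖a‖ₑ ^ 2 + 2 * ‖b‖ₑ ^ 2 := by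
  have h : ‖a + b‖₊ ^ 2 ≤ 2 * ‖a‖₊ ^ 2 + 2 * ‖b‖₊ ^ 2 := by
    rw [← NNReal.coe_le_coe]
    push_cast
    nlinarith [norm_add_le a b, sq_nonneg (‖a‖ - ‖b‖), norm_nonneg (a + b)]
  simp only [enorm_eq_nnnorm]
  exact_mod_cast h

section trace

variable {d : ℕ} {f g η : E (d + 1) → ℝ}

/-- The fundamental theorem of calculus for `f η` on each vertical line, followed by Fubini. It is
used at positive heights, where `f` need not extend to the boundary, and at height `0` for globally
smooth `f`. -/
lemma integral_slab_of_contDiffOn {U : Set (E (d + 1))} {t : ℝ} (hU : IsOpen U)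
    (hf : ContDiffOn ℝ ∞ f U) (ht : ∀ z : E (d + 1), t ≤ z (Fin.last d) → z ∈ U)
    (hη : IsTestFunction Set.univ η) :
    ∫ z in {z : E (d + 1) | z (Fin.last d) ∈ Set.Ioi t},
        (f z * pderiv (Fin.last d) η z + pderiv (Fin.last d) f z * η z) =
      -∫ x, f (consPoint x t) * η (consPoint x t) := by
  have hη' := hη.pderiv (Fin.last d)
  set I : E (d + 1) → ℝ :=
    fun z => f z * pderiv (Fin.last d) η z + pderiv (Fin.last d) f z * η z with hI
  have hIc : ContinuousOn I U :=
    (hf.continuousOn.mul hη'.1.continuous.continuousOn).add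
      ((hf.continuousOn_pderiv hU _).mul hη.1.continuous.continuousOn)
  have hI0 : ∀ z, z ∉ tsupport η → I z = 0 := fun z hz => by
    simp only [hI]
    rw [image_eq_zero_of_notMem_tsupport hz, pderiv_eq_zero_of_notMem_tsupport hz]; simp
  have hcl : IsClosed {z : E (d + 1) | t ≤ z (Fin.last d)} :=
    isClosed_le continuous_const (by fun_prop)
  have hmeas : MeasurableSet {z : E (d + 1) | z (Fin.last d) ∈ Set.Ioi t} :=
    (by fun_prop : Measurable fun z : E (d + 1) => z (Fin.last d)) measurableSet_Ioi
  have hint : IntegrableOn I {z : E (d + 1) | z (Fin.last d) ∈ Set.Ioi t} := by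
    have hK : IsCompact (tsupport η ∩ {z : E (d + 1) | t ≤ z (Fin.last d)}) := hη.2.1.inter_right hcl
    refine ((hIc.mono fun z hz => ht z hz.2).integrableOn_compact hK).of_forall_sdiff_eq_zero hmeas
      fun z hz => hI0 z fun h => hz.2 ⟨h, ?_⟩
    exact le_of_lt (show t < z (Fin.last d) from hz.1)
  rw [integral_slab measurableSet_Ioi hint, ← integral_neg]
  congr 1
  funext x
  have hdf : ∀ s, t ≤ s → DifferentiableAt ℝ f (consPoint x s) := fun s hs =>
    (hf.contDiffAt (hU.mem_nhds (ht _ (by simpa using hs)))).differentiableAt (by simp)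
  have hder : ∀ s, t ≤ s → HasDerivAt (fun s => f (consPoint x s) * η (consPoint x s))
      (I (consPoint x s)) s := by
    intro s hs
    have h1 := hasDerivAt_comp_consPoint (hdf s hs)
    have h2 := hasDerivAt_comp_consPoint (hη.1.differentiable (by simp) (consPoint x s))
    refine (h1.mul h2).congr_deriv ?_
    rw [hI]; ring
  obtain ⟨R, hR⟩ := hη.2.1.isBounded.subset_closedBall 0
  have hz0 : ∀ s, R < s → consPoint x s ∉ tsupport η := by
    intro s hs hmem
    have h1 := hR hmem
    rw [mem_closedBall_zero_iff] at h1
    have h2 := norm_consPoint_sq x s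
    have h3 : |s| ≤ ‖consPoint x s‖ := abs_le_of_sq_le_sq (by nlinarith [sq_nonneg ‖x‖]) (norm_nonneg _)
    linarith [le_abs_self s]
  have hint' : IntegrableOn (fun s => I (consPoint x s)) (Set.Ioi t) := by
    have hc : ContinuousOn (fun s => I (consPoint x s)) (Set.Icc t (max t R)) :=
      hIc.comp (continuous_consPoint_right x).continuousOn fun s hs => ht _ (by simpa using hs.1)
    refine (hc.integrableOn_compact isCompact_Icc).of_forall_sdiff_eq_zero measurableSet_Ioi
      fun s hs => hI0 _ (hz0 s ?_)
    by_contra hle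
    exact hs.2 ⟨le_of_lt hs.1, (not_lt.1 hle).trans (le_max_right _ _)⟩
  have htend : Tendsto (fun s => f (consPoint x s) * η (consPoint x s)) atTop (𝓝 0) := by
    refine tendsto_const_nhds.congr' ?_
    filter_upwards [eventually_gt_atTop R] with s hs
    simp [image_eq_zero_of_notMem_tsupport (hz0 s hs)]
  have hfin := integral_Ioi_of_hasDerivAt_of_tendsto (hder t le_rfl).continuousAt.continuousWithinAt
    (fun s hs => hder s (le_of_lt hs)) hint' htend
  rw [hfin, zero_sub]

/-- A constant on the projection of the support of `η` dominates all slices at once, which gives an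
`L²` majorant uniform in the height. -/
lemma exists_slice_bound (hη : IsTestFunction Set.univ η) :
    ∃ ρ : E d → ℝ, MemLp ρ 2 ∧ ∀ x t, |η (consPoint x t)| ≤ ρ x := by
  obtain ⟨C, hC⟩ := hη.1.continuous.bounded_above_of_compact_support hη.2.1
  have hK : IsCompact (horiz '' tsupport η) := hη.2.1.isCompact.image continuous_horiz
  refine ⟨(horiz '' tsupport η).indicator fun _ => C, ?_, fun x t => ?_⟩
  · exact memLp_indicator_const 2 hK.measurableSet C (Or.inr hK.measure_lt_top.ne)
  · by_cases hx : x ∈ horiz '' tsupport η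
    · rw [Set.indicator_of_mem hx]; exact hC _
    · have h0 : η (consPoint x t) = 0 :=
        image_eq_zero_of_notMem_tsupport fun h => hx ⟨_, h, by simp⟩
      rw [Set.indicator_of_notMem hx, h0, abs_zero]

/-- Smooth functions in the half space whose slices converge have the limit as their trace. -/
lemma hasFlatTrace_of_tendsto_slice {u : E d → ℝ} (hf : ContDiffOn ℝ ∞ f (halfSpace d))
    (h1 : IntegrableUpToBoundary f) (h2 : IntegrableUpToBoundary (pderiv (Fin.last d) f))
    (hs : ∀ t : ℝ, 0 < t → MemLp (fun x => f (consPoint x t)) 2) (hu : MemLp u 2)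
    (hlim : Tendsto (fun t : ℝ => eLpNorm (fun x => f (consPoint x t) - u x) 2) (𝓝[>] 0) (𝓝 0)) :
    HasFlatTrace Set.univ f u := by
  rw [hasFlatTrace_univ_iff (isWeakPartial_of_contDiffOn (isOpen_halfSpace d) hf _)]
  refine ⟨hu, fun η hη => ?_⟩
  set τ : ℕ → ℝ := fun n => 1 / ((n : ℝ) + 1) with hτ
  have hτ0 : ∀ n, 0 < τ n := fun n => by positivity
  have hτlim : Tendsto τ atTop (𝓝 0) := tendsto_one_div_add_atTop_nhds_zero_nat
  have hτlim' : Tendsto τ atTop (𝓝[>] 0) :=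
    tendsto_nhdsWithin_iff.2 ⟨hτlim, Eventually.of_forall hτ0⟩
  have hη' := hη.pderiv (Fin.last d)
  have hint := (h1.integrableOn_mul hη'.1.continuous hη'.2.1).add
    (h2.integrableOn_mul hη.1.continuous hη.2.1)
  -- The Green formula is available above each height `τ n`, and these regions exhaust the half
  -- space.
  have e1 : Tendsto (fun n => ∫ z in {z : E (d + 1) | z (Fin.last d) ∈ Set.Ioi (τ n)},
      (f z * pderiv (Fin.last d) η z + pderiv (Fin.last d) f z * η z)) atTop
      (𝓝 (∫ z in halfSpace d, (f z * pderiv (Fin.last d) η z + pderiv (Fin.last d) f z * η z))) := by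
    have hU : halfSpace d = ⋃ n, {z : E (d + 1) | z (Fin.last d) ∈ Set.Ioi (τ n)} := by
      ext z
      simp only [mem_halfSpace, Set.mem_iUnion, Set.mem_ofPred_eq, Set.mem_Ioi]
      refine ⟨fun hz => ?_, fun ⟨n, hn⟩ => (hτ0 n).trans hn⟩
      exact (hτlim.eventually_lt_const hz).exists
    rw [hU]
    refine tendsto_setIntegral_of_monotone (fun n => ?_) ?_ ?_
    · exact (by fun_prop : Measurable fun z : E (d + 1) => z (Fin.last d)) measurableSet_Ioi
    · intro m n hmn z hz
      refine lt_of_le_of_lt ?_ (show τ m < z (Fin.last d) from hz)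
      exact one_div_le_one_div_of_le (by positivity) (by gcongr)
    · rw [← hU]; exact hint
  obtain ⟨ρ, hρ, hb⟩ := exists_slice_bound hη
  have hρ0 : ∀ x, 0 ≤ ρ x := fun x => (abs_nonneg _).trans (hb x 0)
  have hηc : ∀ t, AEStronglyMeasurable (fun x => η (consPoint x t)) volume := fun t =>
    (hη.1.continuous.comp (continuous_consPoint_left t)).aestronglyMeasurable
  have hηm : ∀ t, MemLp (fun x => η (consPoint x t)) 2 := fun t =>
    hρ.mono (hηc t) (Eventually.of_forall fun x => by
      rw [Real.norm_eq_abs, Real.norm_of_nonneg (hρ0 x)]; exact hb x t)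
  have e2 : Tendsto (fun n => ∫ x, u x * η (consPoint x (τ n))) atTop
      (𝓝 (∫ x, u x * η (consPoint x 0))) := by
    refine tendsto_integral_of_dominated_convergence (fun x => ‖u x * ρ x‖)
      (fun n => hu.1.mul (hηc _)) (hu.integrable_mul hρ).norm
      (fun n => Eventually.of_forall fun x => ?_) (Eventually.of_forall fun x => ?_)
    · rw [norm_mul, norm_mul, Real.norm_of_nonneg (hρ0 x)]
      gcongr; exact hb x _
    · exact ((hη.1.continuous.comp (continuous_consPoint_right x)).tendsto 0).comp hτlim
        |>.const_mul (u x)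
  have e3 : Tendsto (fun n => ∫ x, (f (consPoint x (τ n)) - u x) * η (consPoint x (τ n))) atTop
      (𝓝 0) := by
    rw [tendsto_zero_iff_norm_tendsto_zero]
    have hb' : ∀ n, ‖∫ x, (f (consPoint x (τ n)) - u x) * η (consPoint x (τ n))‖ₑ ≤
        eLpNorm (fun x => f (consPoint x (τ n)) - u x) 2 volume * eLpNorm ρ 2 volume := by
      intro n
      refine (enorm_integral_le_lintegral_enorm _).trans ?_
      have h := eLpNorm_smul_le_mul_eLpNorm (p := 2) (q := 2) (r := 1) (μ := (volume : Measure (E d)))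
        (f := ρ) (φ := fun x => f (consPoint x (τ n)) - u x) hρ.1 ((hs _ (hτ0 n)).sub hu).1
      refine le_trans ?_ h
      rw [eLpNorm_one_eq_lintegral_enorm]
      refine lintegral_mono fun x => ?_
      simp only [Pi.smul_apply', smul_eq_mul, enorm_mul]
      gcongr
      rw [enorm_le_iff_norm_le, Real.norm_of_nonneg (hρ0 x)]
      exact hb x _
    have h0 : Tendsto (fun n => eLpNorm (fun x => f (consPoint x (τ n)) - u x) 2 volume *
        eLpNorm ρ 2 volume) atTop (𝓝 0) := by
      have := ENNReal.Tendsto.mul_const (b := eLpNorm ρ 2 volume) (hlim.comp hτlim')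
        (Or.inr hρ.2.ne)
      simpa using this
    have h1 := tendsto_of_tendsto_of_tendsto_of_le_of_le tendsto_const_nhds h0
      (fun n => zero_le) hb'
    have h2 := (ENNReal.tendsto_toReal (a := 0) (by simp)).comp h1
    simpa [Function.comp_def, toReal_enorm] using h2
  -- Split the boundary slice as `f = (f - u) + u`: the first part tends to zero by `L²` convergence
  -- of the slices (`e3`), the second converges because `η` is continuous (`e2`).
  have e4 : ∀ n, ∫ z in {z : E (d + 1) | z (Fin.last d) ∈ Set.Ioi (τ n)},
      (f z * pderiv (Fin.last d) η z + pderiv (Fin.last d) f z * η z) =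
      -((∫ x, (f (consPoint x (τ n)) - u x) * η (consPoint x (τ n))) +
        ∫ x, u x * η (consPoint x (τ n))) := by
    intro n
    rw [integral_slab_of_contDiffOn (isOpen_halfSpace d) hf
      (fun z hz => lt_of_lt_of_le (hτ0 n) hz) hη, ← integral_add]
    · congr 2; ext x; ring
    · exact ((hs _ (hτ0 n)).sub hu).integrable_mul (hηm _)
    · exact hu.integrable_mul (hηm _)
  have e5 := (e3.add e2).neg
  rw [zero_add] at e5
  exact tendsto_nhds_unique e1 (e5.congr fun n => (e4 n).symm)

lemma hasFlatTrace_of_contDiff (hf : ContDiff ℝ ∞ f) (h0 : MemLp (fun x => f (consPoint x 0)) 2) :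
    HasFlatTrace Set.univ f (fun x => f (consPoint x 0)) := by
  rw [hasFlatTrace_univ_iff (isWeakPartial_of_contDiffOn (isOpen_halfSpace d) hf.contDiffOn _)]
  exact ⟨h0, fun η hη => integral_slab_of_contDiffOn isOpen_univ hf.contDiffOn
    (fun _ _ => Set.mem_univ _) hη⟩

/-- A cut-off function of the last variable. -/
def vertBump : ContDiffBump (0 : ℝ) := ⟨1, 2, by norm_num, by norm_num⟩

/-- The cut-off function `vertBump` as a function on `ℝᵈ⁺¹`. -/
def vertCut (d : ℕ) (z : E (d + 1)) : ℝ := vertBump (1 * z (Fin.last d) - 0)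

lemma vertCut_consPoint (x : E d) (t : ℝ) : vertCut d (consPoint x t) = vertBump t := by
  simp [vertCut]

lemma contDiff_vertCut (d : ℕ) : ContDiff ℝ ∞ (vertCut d) :=
  (vertBump.contDiff (n := ⊤)).comp (by fun_prop)

lemma vertBump_zero : vertBump 0 = 1 :=
  vertBump.one_of_mem_closedBall (by simp [vertBump])

lemma vertBump_eq_zero {t : ℝ} (ht : 2 ≤ t) : vertBump t = 0 :=
  vertBump.zero_of_le_dist (by simpa [vertBump] using ht.trans (le_abs_self t))

lemma deriv_vertBump_eq_zero {t : ℝ} (ht : 2 < t) : deriv vertBump t = 0 := by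
  have : vertBump =ᶠ[𝓝 t] fun _ => 0 := by
    filter_upwards [Ioi_mem_nhds ht] with y hy
    exact vertBump_eq_zero (le_of_lt hy)
  rw [this.deriv_eq]; simp

lemma pderiv_vertCut (i : Fin (d + 1)) (z : E (d + 1)) :
    pderiv i (vertCut d) z = if i = Fin.last d then deriv vertBump (z (Fin.last d)) else 0 := by
  have := pderiv_comp_coord (φ := vertBump) (a := 1) (b := 0) (z := z) (j := Fin.last d) (i := i)
    ((vertBump.contDiff (n := 1)).differentiable (by simp) _)
  have e : vertCut d = fun y : E (d + 1) => vertBump (1 * y (Fin.last d) - 0) := rfl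
  rw [e, this]
  simp

lemma abs_vertCut_le (z : E (d + 1)) : |vertCut d z| ≤ 1 := by
  rw [vertCut, abs_of_nonneg vertBump.nonneg]; exact vertBump.le_one

lemma exists_bound_deriv_vertBump : ∃ M : ℝ, 0 ≤ M ∧ ∀ t, |deriv vertBump t| ≤ M := by
  have hc : Continuous (deriv vertBump) :=
    (vertBump.contDiff (n := 1)).continuous_deriv (by simp)
  obtain ⟨C, hC⟩ := hc.bounded_above_of_compact_support vertBump.hasCompactSupport.deriv
  exact ⟨C, (norm_nonneg _).trans (hC 0), hC⟩

lemma contDiff_horiz (d : ℕ) : ContDiff ℝ ∞ (horiz (d := d)) := by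
  rw [contDiff_euclidean]
  intro i
  simp only [horiz]
  fun_prop

lemma pderiv_last_comp_horiz {θ : E d → ℝ} (hθ : Differentiable ℝ θ) (z : E (d + 1)) :
    pderiv (Fin.last d) (fun z => θ (horiz z)) z = 0 := by
  have hd : DifferentiableAt ℝ (fun z => θ (horiz z)) (consPoint (horiz z) (z (Fin.last d))) :=
    (hθ.comp ((contDiff_horiz d).differentiable (by simp))) _
  have h1 := hasDerivAt_comp_consPoint hd
  simp only [horiz_consPoint, consPoint_horiz] at h1
  exact h1.unique (hasDerivAt_const _ _)

/-- Extension of a test function on the boundary to the whole space. -/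
lemma isTestFunction_extend {θ : E d → ℝ} (h1 : ContDiff ℝ ∞ θ) (h2 : HasCompactSupport θ) :
    IsTestFunction Set.univ (fun z => θ (horiz z) * vertCut d z) := by
  refine ⟨(h1.comp (contDiff_horiz d)).mul (contDiff_vertCut d), ?_, Set.subset_univ _⟩
  have hK : IsCompact ((fun p : E d × ℝ => consPoint p.1 p.2) ''
      (tsupport θ ×ˢ tsupport vertBump)) :=
    (h2.isCompact.prod vertBump.hasCompactSupport).image continuous_consPoint
  refine HasCompactSupport.intro hK fun z hz => ?_
  by_contra hne
  refine hz ⟨(horiz z, z (Fin.last d)), ⟨subset_closure ?_, subset_closure ?_⟩, by simp⟩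
  · exact left_ne_zero_of_mul hne
  · have := right_ne_zero_of_mul hne
    simpa [vertCut] using this

/-- Every function in `H¹(ℝⁿ₊)` has a trace in `L²`. -/
lemma exists_hasFlatTrace (hfg : IsWeakPartial (halfSpace d) (Fin.last d) f g)
    (hf : MemLp f 2 (volume.restrict (halfSpace d)))
    (hg : MemLp g 2 (volume.restrict (halfSpace d))) :
    ∃ t : E d → ℝ, HasFlatTrace Set.univ f t := by
  obtain ⟨M, hM0, hM⟩ := exists_bound_deriv_vertBump
  -- This is the weak normal derivative of `f` times the vertical cut-off. The trace is read off
  -- from the fundamental theorem of calculus as minus its integral over the vertical line; since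
  -- `q` vanishes above height `2`, Cauchy–Schwarz puts the trace in `L²`.
  set q : E (d + 1) → ℝ := fun z => f z * pderiv (Fin.last d) (vertCut d) z + g z * vertCut d z
    with hq
  have hq2 : MemLp q 2 (volume.restrict (halfSpace d)) := by
    refine MemLp.add ?_ ?_
    · refine hf.of_le_mul (c := M)
        (hf.1.mul ((contDiff_vertCut d).pderiv _).continuous.aestronglyMeasurable)
        (Eventually.of_forall fun z => ?_)
      rw [norm_mul, mul_comm, pderiv_vertCut, if_pos rfl]
      gcongr; exact hM _
    · refine hg.of_le_mul (c := 1)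
        (hg.1.mul (contDiff_vertCut d).continuous.aestronglyMeasurable)
        (Eventually.of_forall fun z => ?_)
      rw [norm_mul, mul_comm]
      gcongr; exact abs_vertCut_le _
  have hq0 : ∀ x t, 2 < t → q (consPoint x t) = 0 := fun x t ht => by
    simp [hq, pderiv_vertCut, vertCut_consPoint, vertBump_eq_zero ht.le, deriv_vertBump_eq_zero ht]
  have hp := measurePreserving_consPoint_slab d (measurableSet_Ioi (a := (0 : ℝ)))
  have hqm : AEStronglyMeasurable (fun p : E d × ℝ => q (consPoint p.1 p.2))
      ((volume : Measure (E d)).prod (volume.restrict (Set.Ioi 0))) :=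
    hq2.1.comp_quasiMeasurePreserving hp.quasiMeasurePreserving
  set t : E d → ℝ := fun x => -∫ s in Set.Ioi (0 : ℝ), q (consPoint x s) with ht
  have htm : AEStronglyMeasurable t volume := hqm.integral_prod_right'.neg
  have ht2 : MemLp t 2 := by
    refine memLp_two_of_lintegral htm ?_
    have hsl : ∀ᵐ x : E d, AEStronglyMeasurable (fun s => q (consPoint x s))
      (volume.restrict (Set.Ioi (0 : ℝ))) := hqm.prodMk_left
    calc ∫⁻ x, ‖t x‖ₑ ^ 2 ≤ ∫⁻ x : E d, 2 * ∫⁻ s in Set.Ioi (0 : ℝ), ‖q (consPoint x s)‖ₑ ^ 2 := by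
          refine lintegral_mono_ae ?_
          filter_upwards [hsl] with x hx
          have h1 : ‖t x‖ₑ ≤ ∫⁻ s in Set.Ioc (0 : ℝ) 2, ‖q (consPoint x s)‖ₑ := by
            rw [ht, enorm_neg]
            have h2 : ∫ s in Set.Ioi (0 : ℝ), q (consPoint x s) =
                ∫ s in Set.Ioc (0 : ℝ) 2, q (consPoint x s) := by
              refine setIntegral_eq_of_subset_of_forall_sdiff_eq_zero measurableSet_Ioi
                Set.Ioc_subset_Ioi_self fun s hs => hq0 x s ?_
              by_contra hle
              exact hs.2 ⟨hs.1, not_lt.1 hle⟩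
            rw [h2]
            exact enorm_integral_le_lintegral_enorm _
          have h3 : AEStronglyMeasurable (fun s => q (consPoint x s))
              (volume.restrict (Set.Ioc (0 : ℝ) 2)) :=
            hx.mono_measure (Measure.restrict_mono Set.Ioc_subset_Ioi_self le_rfl)
          calc ‖t x‖ₑ ^ 2 ≤ (∫⁻ s in Set.Ioc (0 : ℝ) 2, ‖q (consPoint x s)‖ₑ) ^ 2 := by gcongr
            _ ≤ _ := sq_lintegral_le h3.enorm
            _ ≤ _ := by
              rw [Measure.restrict_apply_univ, Real.volume_Ioc]
              norm_num
              gcongr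
              exact Set.Ioc_subset_Ioi_self
      _ = 2 * ∫⁻ z in halfSpace d, ‖q z‖ₑ ^ 2 := by
          rw [lintegral_const_mul' _ _ (by norm_num), halfSpace_eq_slab,
            lintegral_slab' measurableSet_Ioi]
          exact hq2.1.enorm.pow_const 2
      _ < (⊤ : ℝ≥0∞) := ENNReal.mul_lt_top (by norm_num) (lintegral_sq_lt_top hq2)
  refine ⟨t, (hasFlatTrace_univ_iff hfg).2 ⟨ht2, fun η hη => ?_⟩⟩
  set θ : E d → ℝ := fun x => η (consPoint x 0) with hθ
  have hcons : ContDiff ℝ ∞ (fun x : E d => consPoint x 0) := by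
    rw [contDiff_euclidean]
    intro i
    refine Fin.lastCases ?_ (fun i => ?_) i
    · simp only [consPoint_last]; fun_prop
    · simp only [consPoint_castSucc]; fun_prop
  have hθs : ContDiff ℝ ∞ θ := hη.1.comp hcons
  have hθc : HasCompactSupport θ := by
    refine HasCompactSupport.intro (hη.2.1.isCompact.image continuous_horiz) fun x hx => ?_
    by_contra hne
    exact hx ⟨consPoint x 0, subset_closure hne, by simp⟩
  have hext := isTestFunction_extend hθs hθc
  have hfb := integrableUpToBoundary_of_memLp hf
  have hgb := integrableUpToBoundary_of_memLp hg
  -- A test function and the vertical extension of its boundary values differ by a function that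
  -- vanishes on the boundary. Hence only test functions of product form have to be checked, and for
  -- these the formula is Fubini.
  have hz := hfg.integral_eq_zero_of_bdry hfb hgb (η := fun z => η z - θ (horiz z) * vertCut d z)
    (hη.1.sub hext.1) (hη.2.1.sub hext.2.1) (Or.inr fun x => by
      simp [hθ, vertCut_consPoint, vertBump_zero])
  have i1 := hfb.integrableOn_mul (hη.pderiv (Fin.last d)).1.continuous (hη.pderiv (Fin.last d)).2.1
  have i2 := hgb.integrableOn_mul hη.1.continuous hη.2.1
  have i3 := hfb.integrableOn_mul (hext.pderiv (Fin.last d)).1.continuous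
    (hext.pderiv (Fin.last d)).2.1
  have i4 := hgb.integrableOn_mul hext.1.continuous hext.2.1
  have e1 : ∀ z, f z * pderiv (Fin.last d) (fun z => η z - θ (horiz z) * vertCut d z) z +
      g z * (η z - θ (horiz z) * vertCut d z) =
      (f z * pderiv (Fin.last d) η z + g z * η z) -
      (f z * pderiv (Fin.last d) (fun z => θ (horiz z) * vertCut d z) z +
        g z * (θ (horiz z) * vertCut d z)) := by
    intro z
    rw [pderiv_sub (hη.1.differentiable (by simp) z) (hext.1.differentiable (by simp) z)]
    ring
  simp only [e1] at hz
  have hz' := integral_sub (i1.add i2) (i3.add i4)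
  simp only [Pi.add_apply] at hz'
  rw [hz', sub_eq_zero] at hz
  rw [hz]
  have e2 : ∀ z, f z * pderiv (Fin.last d) (fun z => θ (horiz z) * vertCut d z) z +
      g z * (θ (horiz z) * vertCut d z) = θ (horiz z) * q z := by
    intro z
    have hdz : DifferentiableAt ℝ (fun z => θ (horiz z)) z :=
      (hθs.comp (contDiff_horiz d)).differentiable (by simp) z
    rw [pderiv_mul hdz ((contDiff_vertCut d).differentiable (by simp) z),
      pderiv_last_comp_horiz (hθs.differentiable (by simp))]
    simp only [hq]; ring
  have i5 : IntegrableOn (fun z => θ (horiz z) * q z) (halfSpace d) := by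
    have := i3.add i4
    refine this.congr_fun (fun z _ => e2 z) (measurableSet_halfSpace d)
  simp only [e2]
  rw [halfSpace_eq_slab] at i5 ⊢
  rw [integral_slab measurableSet_Ioi i5, ← integral_neg]
  congr 1; ext x
  simp only [horiz_consPoint]
  rw [integral_const_mul]
  simp only [ht, hθ]; ring

end trace

/-! ### The Fourier transform on `L²` -/

section fourier

variable {d : ℕ}

/-- Smooth compactly supported functions are Schwartz functions, so identities between tempered
distributions given by locally integrable functions become identities almost everywhere. -/
lemma ae_eq_of_integral_schwartz {f g : E d → ℂ} (hf : LocallyIntegrable f) (hg : LocallyIntegrable g)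
    (h : ∀ θ : SchwartzMap (E d) ℂ, ∫ x, θ x • f x = ∫ x, θ x • g x) : f =ᵐ[volume] g := by
  refine ae_eq_of_integral_contDiff_smul_eq hf hg fun η h1 h2 => ?_
  have h1' : ContDiff ℝ ∞ (fun x => (η x : ℂ)) := Complex.ofRealCLM.contDiff.comp h1
  have h2' : HasCompactSupport (fun x => (η x : ℂ)) := h2.comp_left (g := fun t : ℝ => (t : ℂ)) (by simp)
  have := h (h2'.toSchwartzMap h1')
  simpa using this

lemma locallyIntegrable_of_memLp_two {f : E d → ℂ} (hf : MemLp f 2) : LocallyIntegrable f :=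
  hf.locallyIntegrable (by norm_num)

lemma continuous_fourierInv {m : E d → ℂ} (hm : Integrable m) :
    Continuous (FourierTransformInv.fourierInv m : E d → ℂ) :=
  VectorFourier.fourierIntegral_continuous (L := -innerₗ (E d)) Real.continuous_fourierChar
    (by simp only [LinearMap.neg_apply, innerₗ_apply_apply]; fun_prop) hm

/-- On `L¹ ∩ L²` the inverse Fourier transform is given by the usual integral. -/
lemma fourierInv_toLp_ae_eq {m : E d → ℂ} (hm2 : MemLp m 2) (hm1 : Integrable m) :
    ((𝓕⁻ (hm2.toLp m) : Lp (α := E d) ℂ 2 volume) : E d → ℂ) =ᵐ[volume]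
      (FourierTransformInv.fourierInv m : E d → ℂ) := by
  refine ae_eq_of_integral_schwartz (locallyIntegrable_of_memLp_two (Lp.memLp _))
    (continuous_fourierInv hm1).locallyIntegrable fun θ => ?_
  have h1 := congrArg (fun T => T θ) (Lp.fourierInv_toTemperedDistribution_eq (hm2.toLp m))
  simp only [TemperedDistribution.fourierInv_apply] at h1
  rw [Lp.toTemperedDistribution_apply, Lp.toTemperedDistribution_apply] at h1
  rw [← h1]
  have h2 : ∫ x, (𝓕⁻ θ) x • (hm2.toLp m) x = ∫ x, (𝓕⁻ θ) x • m x := by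
    refine integral_congr_ae ?_
    filter_upwards [hm2.coeFn_toLp] with x hx
    rw [hx]
  rw [h2, SchwartzMap.fourierInv_coe]
  -- The multiplication formula moves the inverse transform from the Schwartz function to `m`; its
  -- kernel is symmetric, so the flipped transform is the same one.
  have h3 := VectorFourier.integral_fourierIntegral_smul_eq_flip (𝕜 := ℝ) (V := E d) (W := E d)
    (e := Real.fourierChar) (μ := volume) (ν := volume) (L := -innerₗ (E d)) (f := ⇑θ) (g := m)
    Real.continuous_fourierChar
    (by simp only [LinearMap.neg_apply, innerₗ_apply_apply]; fun_prop) θ.integrable hm1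
  have hfl : (-innerₗ (E d)).flip = -innerₗ (E d) := by
    ext x y; simp [real_inner_comm]
  rw [hfl] at h3
  exact h3

lemma lintegral_fourierInv_sq {m : E d → ℂ} (hm2 : MemLp m 2) (hm1 : Integrable m) :
    ∫⁻ x, ‖(FourierTransformInv.fourierInv m : E d → ℂ) x‖ₑ ^ 2 = ∫⁻ ξ, ‖m ξ‖ₑ ^ 2 := by
  rw [← eLpNorm_two_sq, ← eLpNorm_two_sq, ← eLpNorm_congr_ae (fourierInv_toLp_ae_eq hm2 hm1),
    ← eLpNorm_congr_ae hm2.coeFn_toLp, ← Lp.enorm_def, ← Lp.enorm_def]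
  congr 1
  rw [enorm_eq_iff_norm_eq]
  exact (Lp.fourierTransformₗᵢ (E d) ℂ).symm.norm_map _

lemma memLp_toC {u : E d → ℝ} (hu : MemLp u 2) : MemLp (toC u) 2 := hu.ofReal

lemma memLp_of_toC {u : E d → ℝ} (hu : MemLp (toC u) 2) : MemLp u 2 := by
  simpa [toC] using hu.re

lemma l2Fourier_eq {u : E d → ℝ} (hu : MemLp (toC u) 2) :
    l2Fourier u = ((𝓕 (hu.toLp (toC u)) : Lp (α := E d) ℂ 2 volume) : E d → ℂ) := by
  rw [l2Fourier, dif_pos hu]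

lemma memLp_l2Fourier {u : E d → ℝ} (hu : MemLp (toC u) 2) : MemLp (l2Fourier u) 2 := by
  rw [l2Fourier_eq hu]; exact Lp.memLp _

/-- Plancherel's theorem. -/
lemma integral_re_mul_conj_fourierInv (f g : Lp (α := E d) ℂ 2 volume) :
    ∫ x, ((𝓕⁻ f : Lp (α := E d) ℂ 2 volume) x *
        (starRingEnd ℂ) ((𝓕⁻ g : Lp (α := E d) ℂ 2 volume) x)).re =
      ∫ ξ, (f ξ * (starRingEnd ℂ) (g ξ)).re := by
  have key : ∀ f g : Lp (α := E d) ℂ 2 volume,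
      ∫ x, (f x * (starRingEnd ℂ) (g x)).re = (inner ℂ g f).re := by
    intro f g
    rw [L2.inner_def]
    have hi := L2.integrable_inner (𝕜 := ℂ) g f
    have := integral_re (𝕜 := ℂ) hi
    simpa using this
  rw [key, key]
  congr 1
  exact (Lp.fourierTransformₗᵢ (E d) ℂ).symm.inner_map_map g f

/-- Parseval's identity with one factor given on the Fourier side and the other in space. It turns
the boundary pairing of the normal stress with a trace into a frequency integral. -/
lemma integral_re_fourierInv_mul {m : E d → ℂ} (hm2 : MemLp m 2) (hm1 : Integrable m)
    {g : E d → ℝ} (hg : MemLp (toC g) 2) :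
    ∫ x, ((FourierTransformInv.fourierInv m : E d → ℂ) x).re * g x =
      ∫ ξ, (m ξ * (starRingEnd ℂ) (l2Fourier g ξ)).re := by
  have h := integral_re_mul_conj_fourierInv (hm2.toLp m) (𝓕 (hg.toLp (toC g)))
  rw [FourierTransform.fourierInv_fourier_eq] at h
  rw [l2Fourier_eq hg]
  calc _ = ∫ x, ((𝓕⁻ (hm2.toLp m) : Lp (α := E d) ℂ 2 volume) x *
        (starRingEnd ℂ) ((hg.toLp (toC g)) x)).re := by
        refine integral_congr_ae ?_
        filter_upwards [fourierInv_toLp_ae_eq hm2 hm1, hg.coeFn_toLp] with x h1 h2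
        rw [h1, h2]; simp [toC]
    _ = _ := h
    _ = _ := by
        refine integral_congr_ae ?_
        filter_upwards [hm2.coeFn_toLp] with x h1
        rw [h1]

/-- The distance of a real function to the real part of a function given on the Fourier side. -/
lemma lintegral_re_fourierInv_sub {m : E d → ℂ} (hm2 : MemLp m 2) (hm1 : Integrable m)
    {g : E d → ℝ} (hg : MemLp (toC g) 2) :
    ∫⁻ x, ‖((FourierTransformInv.fourierInv m : E d → ℂ) x).re - g x‖ₑ ^ 2 ≤
      ∫⁻ ξ, ‖m ξ - l2Fourier g ξ‖ₑ ^ 2 := by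
  rw [l2Fourier_eq hg]
  set G := hg.toLp (toC g) with hG
  have e1 : ∫⁻ ξ, ‖m ξ - (𝓕 G : Lp (α := E d) ℂ 2 volume) ξ‖ₑ ^ 2 =
      ‖hm2.toLp m - 𝓕 G‖ₑ ^ 2 := by
    rw [Lp.enorm_def, eLpNorm_two_sq]
    refine lintegral_congr_ae ?_
    filter_upwards [hm2.coeFn_toLp, Lp.coeFn_sub (hm2.toLp m) (𝓕 G)] with x h1 h2
    rw [h2, Pi.sub_apply, h1]
  have e2 : ‖hm2.toLp m - 𝓕 G‖ₑ = ‖𝓕⁻ (hm2.toLp m) - G‖ₑ := by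
    rw [enorm_eq_iff_norm_eq]
    have := (Lp.fourierTransformₗᵢ (E d) ℂ).norm_map (𝓕⁻ (hm2.toLp m) - G)
    rw [← this, map_sub]
    congr 2
    exact ((Lp.fourierTransformₗᵢ (E d) ℂ).apply_symm_apply _).symm
  rw [e1, e2, Lp.enorm_def, eLpNorm_two_sq]
  refine lintegral_mono_ae ?_
  filter_upwards [fourierInv_toLp_ae_eq hm2 hm1, hg.coeFn_toLp,
    Lp.coeFn_sub (𝓕⁻ (hm2.toLp m)) G] with x h1 h2 h3
  rw [h3, Pi.sub_apply, h1, h2]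
  gcongr
  rw [enorm_le_iff_norm_le, Real.norm_eq_abs]
  have := Complex.abs_re_le_norm ((FourierTransformInv.fourierInv m : E d → ℂ) x - toC g x)
  simpa [toC] using this

/-! ### The space `H^{1/2}` on the Fourier side -/

lemma quarterSymbolMul_norm_sq (u : E d → ℝ) (ξ : E d) :
    ‖quarterSymbolMul u ξ‖ ^ 2 = 2 * Real.pi * ‖ξ‖ * ‖l2Fourier u ξ‖ ^ 2 := by
  rw [quarterSymbolMul, norm_mul, mul_pow, Complex.norm_real, Real.norm_of_nonneg (by positivity),
    ← Real.rpow_natCast, ← Real.rpow_mul (by positivity)]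
  norm_num

lemma besselSymbol_norm_sq (c : ℂ) (ξ : E d) :
    ‖(((1 + ‖ξ‖ ^ 2) ^ ((1 / 2 : ℝ) / 2) : ℝ) : ℂ) * c‖ ^ 2 = Real.sqrt (1 + ‖ξ‖ ^ 2) * ‖c‖ ^ 2 := by
  rw [norm_mul, mul_pow, Complex.norm_real, Real.norm_of_nonneg (by positivity),
    ← Real.rpow_natCast, ← Real.rpow_mul (by positivity), Real.sqrt_eq_rpow]
  norm_num

lemma continuous_besselSymbol :
    Continuous (fun ξ : E d => ((((1 + ‖ξ‖ ^ 2) ^ ((1 / 2 : ℝ) / 2) : ℝ)) : ℂ)) := by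
  refine Complex.continuous_ofReal.comp ?_
  refine Continuous.rpow_const (by fun_prop) fun ξ => Or.inr (by norm_num)

lemma continuous_quarterSymbol :
    Continuous (fun ξ : E d => (((2 * Real.pi * ‖ξ‖) ^ (1 / 2 : ℝ) : ℝ) : ℂ)) := by
  refine Complex.continuous_ofReal.comp ?_
  refine Continuous.rpow_const (by fun_prop) fun ξ => Or.inr (by norm_num)

/-- The Bessel weight and the homogeneous weight are compared through `|ξ| ≤ √(1 + |ξ|²) ≤ 1 +
2π|ξ|`, so that afterwards only `û` and `(2π|ξ|)^{1/2} û` occur. -/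
lemma memHHalf_iff {u : E d → ℝ} :
    MemHHalf u ↔ MemLp (toC u) 2 ∧ MemLp (quarterSymbolMul u) 2 := by
  have hmeasB : ∀ {u : E d → ℝ}, MemLp (toC u) 2 → AEStronglyMeasurable (fun ξ : E d =>
      ((((1 + ‖ξ‖ ^ 2) ^ ((1 / 2 : ℝ) / 2) : ℝ)) : ℂ) * l2Fourier u ξ) volume := fun hu =>
    continuous_besselSymbol.aestronglyMeasurable.mul (memLp_l2Fourier hu).1
  have hmeasQ : ∀ {u : E d → ℝ}, MemLp (toC u) 2 → AEStronglyMeasurable (quarterSymbolMul u) volume :=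
    fun hu => continuous_quarterSymbol.aestronglyMeasurable.mul (memLp_l2Fourier hu).1
  have htg : Function.HasTemperateGrowth (fun ξ : E d =>
      ((((1 + ‖ξ‖ ^ 2) ^ ((1 / 2 : ℝ) / 2) : ℝ)) : ℂ)) := by fun_prop
  constructor
  · rintro ⟨hu, hs⟩
    refine ⟨hu, ?_⟩
    rw [TemperedDistribution.memSobolev_iff_exists_smulLeftCLM_fourier] at hs
    obtain ⟨f', hf'⟩ := hs
    rw [Lp.fourier_toTemperedDistribution_eq] at hf'
    have hae : (fun ξ : E d => ((((1 + ‖ξ‖ ^ 2) ^ ((1 / 2 : ℝ) / 2) : ℝ)) : ℂ) * l2Fourier u ξ)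
        =ᵐ[volume] f' := by
      refine ae_eq_of_integral_schwartz ?_ (locallyIntegrable_of_memLp_two (Lp.memLp _)) fun θ => ?_
      · have := (locallyIntegrable_of_memLp_two (memLp_l2Fourier hu)).locallyIntegrableOn Set.univ
        rw [← locallyIntegrableOn_univ]
        exact this.continuousOn_mul continuous_besselSymbol.continuousOn isOpen_univ.isLocallyClosed
      · have h1 := congrArg (fun T => T θ) hf'
        simp only [TemperedDistribution.smulLeftCLM_apply_apply] at h1
        rw [Lp.toTemperedDistribution_apply, Lp.toTemperedDistribution_apply] at h1
        rw [← h1, l2Fourier_eq hu]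
        congr 1; ext ξ
        rw [SchwartzMap.smulLeftCLM_apply_apply htg]
        simp only [smul_eq_mul]; ring
    have hB : MemLp (fun ξ : E d => ((((1 + ‖ξ‖ ^ 2) ^ ((1 / 2 : ℝ) / 2) : ℝ)) : ℂ) * l2Fourier u ξ) 2 :=
      (memLp_congr_ae hae).2 (Lp.memLp f')
    refine hB.of_le_mul (c := Real.sqrt (2 * Real.pi)) (hmeasQ hu) (Eventually.of_forall fun ξ => ?_)
    refine le_of_sq_le_sq ?_ (by positivity)
    rw [mul_pow, quarterSymbolMul_norm_sq, besselSymbol_norm_sq, Real.sq_sqrt (by positivity)]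
    have : ‖ξ‖ ≤ Real.sqrt (1 + ‖ξ‖ ^ 2) := Real.le_sqrt_of_sq_le (by linarith)
    calc 2 * Real.pi * ‖ξ‖ * ‖l2Fourier u ξ‖ ^ 2
        ≤ 2 * Real.pi * Real.sqrt (1 + ‖ξ‖ ^ 2) * ‖l2Fourier u ξ‖ ^ 2 := by gcongr
      _ = _ := by ring
  · rintro ⟨hu, hq⟩
    refine ⟨hu, ?_⟩
    have hB : MemLp (fun ξ : E d => ((((1 + ‖ξ‖ ^ 2) ^ ((1 / 2 : ℝ) / 2) : ℝ)) : ℂ) * l2Fourier u ξ) 2 := by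
      refine MemLp.of_le (g := fun ξ => ‖l2Fourier u ξ‖ + ‖quarterSymbolMul u ξ‖)
        ((memLp_l2Fourier hu).norm.add hq.norm) (hmeasB hu) (Eventually.of_forall fun ξ => ?_)
      rw [Real.norm_of_nonneg (by positivity)]
      refine le_of_sq_le_sq ?_ (by positivity)
      rw [besselSymbol_norm_sq]
      have h1 : Real.sqrt (1 + ‖ξ‖ ^ 2) ≤ 1 + 2 * Real.pi * ‖ξ‖ := by
        rw [Real.sqrt_le_left (by positivity)]
        have : ‖ξ‖ ≤ 2 * Real.pi * ‖ξ‖ := by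
          nlinarith [Real.pi_gt_three, norm_nonneg ξ]
        nlinarith [norm_nonneg ξ]
      have h2 := quarterSymbolMul_norm_sq u ξ
      have h3 : Real.sqrt (1 + ‖ξ‖ ^ 2) * ‖l2Fourier u ξ‖ ^ 2 ≤
          (1 + 2 * Real.pi * ‖ξ‖) * ‖l2Fourier u ξ‖ ^ 2 := by gcongr
      nlinarith [mul_nonneg (norm_nonneg (l2Fourier u ξ)) (norm_nonneg (quarterSymbolMul u ξ))]
    rw [TemperedDistribution.memSobolev_iff_exists_smulLeftCLM_fourier]
    refine ⟨hB.toLp _, ?_⟩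
    rw [Lp.fourier_toTemperedDistribution_eq]
    ext θ
    rw [TemperedDistribution.smulLeftCLM_apply_apply, Lp.toTemperedDistribution_apply,
      Lp.toTemperedDistribution_apply]
    refine integral_congr_ae ?_
    filter_upwards [hB.coeFn_toLp] with ξ hξ
    rw [hξ, SchwartzMap.smulLeftCLM_apply_apply htg, l2Fourier_eq hu]
    simp only [smul_eq_mul]; ring

lemma MemHHalf.memLp {u : E d → ℝ} (hu : MemHHalf u) : MemLp u 2 := memLp_of_toC hu.choose

lemma MemHHalf.add {u v : E d → ℝ} (hu : MemHHalf u) (hv : MemHHalf v) :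
    MemHHalf (fun x => u x + v x) := by
  obtain ⟨h1, h1'⟩ := hu
  obtain ⟨h2, h2'⟩ := hv
  have e : toC (fun x => u x + v x) = toC u + toC v := by ext x; simp [toC]
  have h3 : MemLp (toC (fun x => u x + v x)) 2 := by rw [e]; exact h1.add h2
  refine ⟨h3, ?_⟩
  have := h1'.add h2'
  rw [← Lp.toTemperedDistributionCLM_apply, ← Lp.toTemperedDistributionCLM_apply, ← map_add,
    ← MemLp.toLp_add] at this
  convert this using 1
  rw [Lp.toTemperedDistributionCLM_apply]
  exact congrArg _ (MemLp.toLp_congr _ _ (Eventually.of_forall fun x => congrFun e x))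

/-- The form of the half-Laplacian on the Fourier side. -/
lemma halfLaplacianForm_eq {u v : E d → ℝ} (hu : MemHHalf u) (hv : MemHHalf v) :
    halfLaplacianForm u v =
      ∫ ξ, 2 * Real.pi * ‖ξ‖ * (l2Fourier u ξ * (starRingEnd ℂ) (l2Fourier v ξ)).re := by
  have h1 := (memHHalf_iff.1 hu).2
  have h2 := (memHHalf_iff.1 hv).2
  rw [halfLaplacianForm, quarterLaplacian, dif_pos h1, quarterLaplacian, dif_pos h2,
    integral_re_mul_conj_fourierInv]
  refine integral_congr_ae ?_
  filter_upwards [h1.coeFn_toLp, h2.coeFn_toLp] with ξ e1 e2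
  rw [e1, e2, quarterSymbolMul, quarterSymbolMul, map_mul, Complex.conj_ofReal]
  have h3 : (2 * Real.pi * ‖ξ‖) ^ (1 / 2 : ℝ) * (2 * Real.pi * ‖ξ‖) ^ (1 / 2 : ℝ) =
      2 * Real.pi * ‖ξ‖ := by
    rw [← Real.rpow_add_of_nonneg (by positivity) (by norm_num) (by norm_num)]; norm_num
  set r := (2 * Real.pi * ‖ξ‖) ^ (1 / 2 : ℝ) with hr
  rw [← h3]
  have : (r : ℂ) * l2Fourier u ξ * (r * (starRingEnd ℂ) (l2Fourier v ξ)) =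
      ((r * r : ℝ) : ℂ) * (l2Fourier u ξ * (starRingEnd ℂ) (l2Fourier v ξ)) := by
    push_cast; ring
  rw [this, Complex.re_ofReal_mul]

end fourier

/-! ### Band limited harmonic functions -/

section harmonic

variable {d : ℕ} {m m' m0 m1 : E d → ℂ}

/-- Square integrable functions supported in an annulus. -/
structure BandLimited (m : E d → ℂ) : Prop where
  memLp : MemLp m 2
  band : ∃ δ R : ℝ, 0 < δ ∧ ∀ ξ, m ξ ≠ 0 → δ ≤ ‖ξ‖ ∧ ‖ξ‖ ≤ R

/-- The support is bounded, and `L²` embeds into `L¹` on sets of finite measure. -/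
lemma BandLimited.integrable (hm : BandLimited m) : Integrable m := by
  obtain ⟨δ, R, hδ, hb⟩ := hm.band
  have h1 : MemLp m 2 (volume.restrict (Metric.closedBall 0 R)) := hm.memLp.restrict _
  have : IsFiniteMeasure (volume.restrict (Metric.closedBall (0 : E d) R)) :=
    ⟨by
      rw [Measure.restrict_apply_univ]
      exact (isCompact_closedBall _ _).measure_lt_top⟩
  have h2 : IntegrableOn m (Metric.closedBall 0 R) := h1.integrable (by norm_num)
  refine (integrableOn_iff_integrable_of_support_subset fun ξ hξ => ?_).1 h2
  simpa using (hb ξ hξ).2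

/-- A continuous multiplier is bounded on the bounded support, so symbols of any growth may be
applied. -/
lemma BandLimited.mul (hm : BandLimited m) {p : E d → ℂ} (hp : Continuous p) :
    BandLimited (fun ξ => p ξ * m ξ) := by
  obtain ⟨δ, R, hδ, hb⟩ := hm.band
  refine ⟨?_, δ, R, hδ, fun ξ hξ => hb ξ (right_ne_zero_of_mul hξ)⟩
  obtain ⟨C, hC⟩ := (isCompact_closedBall (0 : E d) R).exists_bound_of_continuousOn hp.continuousOn
  refine hm.memLp.of_le_mul (c := C) (hp.aestronglyMeasurable.mul hm.memLp.1)
    (Eventually.of_forall fun ξ => ?_)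
  by_cases h : m ξ = 0
  · simp [h]
  · rw [norm_mul]
    gcongr
    exact hC ξ (by simpa using (hb ξ h).2)

lemma BandLimited.add (hm : BandLimited m) (hm' : BandLimited m') :
    BandLimited (fun ξ => m ξ + m' ξ) := by
  obtain ⟨δ, R, hδ, hb⟩ := hm.band
  obtain ⟨δ', R', hδ', hb'⟩ := hm'.band
  refine ⟨hm.memLp.add hm'.memLp, min δ δ', max R R', lt_min hδ hδ', fun ξ hξ => ?_⟩
  by_cases h : m ξ = 0
  · have h' : m' ξ ≠ 0 := fun h' => hξ (by simp [h, h'])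
    exact ⟨(min_le_right _ _).trans (hb' ξ h').1, (hb' ξ h').2.trans (le_max_right _ _)⟩
  · exact ⟨(min_le_left _ _).trans (hb ξ h).1, (hb ξ h).2.trans (le_max_left _ _)⟩

/-- The symbols of the partial derivatives acting on harmonic functions. -/
def sym (i : Fin (d + 1)) (ξ : E d) : ℂ :=
  Fin.lastCases (motive := fun _ => ℂ) (-((2 * Real.pi * ‖ξ‖ : ℝ) : ℂ))
    (fun j => ((2 * Real.pi * ξ j : ℝ) : ℂ) * Complex.I) i

@[simp] lemma sym_last (ξ : E d) : sym (Fin.last d) ξ = -((2 * Real.pi * ‖ξ‖ : ℝ) : ℂ) := by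
  simp [sym]

@[simp] lemma sym_castSucc (j : Fin d) (ξ : E d) :
    sym (Fin.castSucc j) ξ = ((2 * Real.pi * ξ j : ℝ) : ℂ) * Complex.I := by
  simp [sym]

lemma continuous_sym (i : Fin (d + 1)) : Continuous (sym (d := d) i) := by
  refine Fin.lastCases ?_ (fun j => ?_) i
  · simp only [funext fun ξ : E d => sym_last ξ]; fun_prop
  · simp only [funext fun ξ : E d => sym_castSucc j ξ]; fun_prop

lemma norm_sym_le (i : Fin (d + 1)) (ξ : E d) : ‖sym i ξ‖ ≤ 2 * Real.pi * ‖ξ‖ := by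
  refine Fin.lastCases ?_ (fun j => ?_) i
  · rw [sym_last, norm_neg, Complex.norm_real, Real.norm_of_nonneg (by positivity)]
  · rw [sym_castSucc, norm_mul, Complex.norm_I, mul_one, Complex.norm_real, norm_mul,
      Real.norm_of_nonneg (by positivity)]
    gcongr
    exact PiLp.norm_apply_le ξ j

/-- The phase `2πi⟨x', ξ⟩ - 2π|ξ|xₙ`. -/
def phase (ξ : E d) : E (d + 1) →L[ℝ] ℂ :=
  ∑ i, sym i ξ • (Complex.ofRealCLM.comp (EuclideanSpace.proj i : E (d + 1) →L[ℝ] ℝ))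

lemma phase_apply (ξ : E d) (z : E (d + 1)) : phase ξ z = ∑ i, sym i ξ * (z i : ℂ) := by
  simp [phase]

lemma phase_single (ξ : E d) (i : Fin (d + 1)) :
    phase ξ (EuclideanSpace.single i (1 : ℝ)) = sym i ξ := by
  rw [phase_apply, Finset.sum_eq_single i]
  · simp
  · intro j _ hj; simp [hj]
  · simp

lemma norm_phase_le (ξ : E d) : ‖phase ξ‖ ≤ (d + 1) * (2 * Real.pi * ‖ξ‖) := by
  refine ContinuousLinearMap.opNorm_le_bound _ (by positivity) fun z => ?_
  rw [phase_apply]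
  calc ‖∑ i, sym i ξ * (z i : ℂ)‖ ≤ ∑ i : Fin (d + 1), 2 * Real.pi * ‖ξ‖ * ‖z‖ := by
        refine norm_sum_le_of_le _ fun i _ => ?_
        rw [norm_mul, Complex.norm_real]
        gcongr
        · exact norm_sym_le i ξ
        · exact PiLp.norm_apply_le z i
    _ = _ := by simp; ring

lemma continuous_phase : Continuous (phase (d := d)) := by
  unfold phase
  refine continuous_finsetSum _ fun i _ => ?_
  have := continuous_sym (d := d) i
  fun_prop

lemma phase_consPoint (ξ x : E d) (t : ℝ) :
    phase ξ (consPoint x t) =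
      ((2 * Real.pi * inner ℝ ξ x : ℝ) : ℂ) * Complex.I - ((2 * Real.pi * ‖ξ‖ * t : ℝ) : ℂ) := by
  rw [phase_apply, Fin.sum_univ_castSucc]
  simp only [sym_castSucc, consPoint_castSucc, sym_last, consPoint_last]
  have : (inner ℝ ξ x : ℝ) = ∑ i, ξ i * x i := by
    simp [PiLp.inner_apply, mul_comm]
  rw [this, Finset.mul_sum]
  push_cast
  rw [Finset.sum_mul]
  have : ∀ i, 2 * (Real.pi : ℂ) * (ξ i : ℂ) * Complex.I * (x i : ℂ) =
    2 * (Real.pi : ℂ) * ((ξ i : ℂ) * (x i : ℂ)) * Complex.I := fun i => by ring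
  simp only [this]
  ring

/-- The complex harmonic function `∫ e^{2πi⟨x', ξ⟩ - 2π|ξ|xₙ} m(ξ) dξ`. -/
def charm (m : E d → ℂ) (z : E (d + 1)) : ℂ := ∫ ξ, Complex.exp (phase ξ z) * m ξ

/-- The real harmonic function `Re ∫ e^{2πi⟨x', ξ⟩ - 2π|ξ|xₙ} m(ξ) dξ`. -/
def harm (m : E d → ℂ) (z : E (d + 1)) : ℝ := (charm m z).re

/-- The functions are used on the whole space, also where `xₙ < 0` and the exponentials grow. The
bounded frequency support makes this crude bound locally uniform in `z`, which is what
differentiation under the integral needs. -/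
lemma norm_exp_phase_mul_le {R : ℝ} (hb : ∀ ξ, m ξ ≠ 0 → ‖ξ‖ ≤ R) (ξ : E d) (z : E (d + 1)) {r : ℝ}
    (hz : ‖z‖ ≤ r) :
    ‖Complex.exp (phase ξ z) * m ξ‖ ≤ Real.exp ((d + 1) * (2 * Real.pi * R) * r) * ‖m ξ‖ := by
  by_cases h : m ξ = 0
  · simp [h]
  · have hξ := hb ξ h
    rw [norm_mul]
    gcongr
    rw [Complex.norm_exp]
    refine Real.exp_le_exp.2 ((le_abs_self _).trans ((Complex.abs_re_le_norm _).trans ?_))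
    have hR : 0 ≤ R := (norm_nonneg ξ).trans hξ
    calc ‖phase ξ z‖ ≤ ‖phase ξ‖ * ‖z‖ := (phase ξ).le_opNorm z
      _ ≤ ((d + 1) * (2 * Real.pi * ‖ξ‖)) * ‖z‖ := by gcongr; exact norm_phase_le ξ
      _ ≤ ((d + 1) * (2 * Real.pi * R)) * r := by gcongr

lemma BandLimited.aestronglyMeasurable_exp (hm : BandLimited m) (z : E (d + 1)) :
    AEStronglyMeasurable (fun ξ => Complex.exp (phase ξ z) * m ξ) volume := by
  have : Continuous fun ξ : E d => Complex.exp (phase ξ z) := by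
    have := continuous_phase (d := d)
    fun_prop
  exact this.aestronglyMeasurable.mul hm.memLp.1

lemma BandLimited.integrable_exp (hm : BandLimited m) (z : E (d + 1)) :
    Integrable (fun ξ => Complex.exp (phase ξ z) * m ξ) := by
  obtain ⟨δ, R, hδ, hb⟩ := hm.band
  exact (hm.integrable.norm.const_mul _).mono' (hm.aestronglyMeasurable_exp z)
    (Eventually.of_forall fun ξ => norm_exp_phase_mul_le (fun ξ h => (hb ξ h).2) ξ z le_rfl)

lemma BandLimited.hasFDerivAt_charm (hm : BandLimited m) (z : E (d + 1)) :
    HasFDerivAt (charm m) (∫ ξ, (Complex.exp (phase ξ z) * m ξ) • phase ξ) z := by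
  obtain ⟨δ, R, hδ, hb⟩ := hm.band
  have hb' : ∀ ξ, m ξ ≠ 0 → ‖ξ‖ ≤ R := fun ξ h => (hb ξ h).2
  refine hasFDerivAt_integral_of_dominated_of_fderiv_le (s := Metric.ball z 1)
    (F := fun z ξ => Complex.exp (phase ξ z) * m ξ)
    (F' := fun z ξ => (Complex.exp (phase ξ z) * m ξ) • phase ξ)
    (bound := fun ξ => (Real.exp ((d + 1) * (2 * Real.pi * R) * (‖z‖ + 1)) * ‖m ξ‖) *
      ((d + 1) * (2 * Real.pi * R)))
    (Metric.ball_mem_nhds z one_pos) (Eventually.of_forall fun y => hm.aestronglyMeasurable_exp y)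
    (hm.integrable_exp z) ?_ ?_ ?_ ?_
  · exact (hm.aestronglyMeasurable_exp z).smul continuous_phase.aestronglyMeasurable
  · refine Eventually.of_forall fun ξ y hy => ?_
    have hy' : ‖y‖ ≤ ‖z‖ + 1 := by
      have h1 := norm_le_norm_add_norm_sub' y z
      have h2 := mem_ball_iff_norm.1 hy
      linarith
    rw [norm_smul]
    by_cases h : m ξ = 0
    · simp [h]
    · gcongr
      · exact norm_exp_phase_mul_le hb' ξ y hy'
      · refine (norm_phase_le ξ).trans ?_
        have := hb' ξ h
        gcongr
  · exact (hm.integrable.norm.const_mul _).mul_const _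
  · refine Eventually.of_forall fun ξ y _ => ?_
    have h1 := ((phase ξ).hasFDerivAt (x := y)).cexp.mul_const (m ξ)
    refine h1.congr_fderiv ?_
    ext v
    simp
    ring

lemma BandLimited.fderiv_charm_single (hm : BandLimited m) (z : E (d + 1)) (i : Fin (d + 1)) :
    fderiv ℝ (charm m) z (EuclideanSpace.single i 1) = charm (fun ξ => sym i ξ * m ξ) z := by
  obtain ⟨δ, R, hδ, hb⟩ := hm.band
  rw [(hm.hasFDerivAt_charm z).fderiv, ContinuousLinearMap.integral_apply, charm]
  · congr 1; ext ξ
    simp only [smul_apply, smul_eq_mul, phase_single]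
    ring
  · refine ((hm.integrable_exp z).norm.mul_const ((d + 1) * (2 * Real.pi * R))).mono'
      ((hm.aestronglyMeasurable_exp z).smul continuous_phase.aestronglyMeasurable)
      (Eventually.of_forall fun ξ => ?_)
    rw [norm_smul]
    by_cases h : m ξ = 0
    · simp [h]
    · gcongr
      refine (norm_phase_le ξ).trans ?_
      have := (hb ξ h).2
      gcongr

/-- Each directional derivative is a finite combination of functions of the same form, with the band
limited densities `sym i * m`; smoothness follows by induction on the order. -/
lemma BandLimited.contDiff_charm (hm : BandLimited m) : ContDiff ℝ ∞ (charm m) := by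
  rw [contDiff_infty]
  intro n
  induction n generalizing m with
  | zero =>
    rw [Nat.cast_zero, contDiff_zero, continuous_iff_continuousAt]
    exact fun z => (hm.hasFDerivAt_charm z).continuousAt
  | succ n ih =>
    have : ((n + 1 : ℕ) : WithTop ℕ∞) = (n : WithTop ℕ∞) + 1 := by push_cast; rfl
    rw [this, contDiff_succ_iff_fderiv_apply]
    refine ⟨fun z => (hm.hasFDerivAt_charm z).differentiableAt, by simp, fun y => ?_⟩
    have e : (fun z => fderiv ℝ (charm m) z y) =
        fun z => ∑ i, (y i : ℝ) • charm (fun ξ => sym i ξ * m ξ) z := by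
      funext z
      have hy : y = ∑ i, (y i : ℝ) • EuclideanSpace.single i (1 : ℝ) := by
        ext j
        simp [Finset.sum_apply, Pi.single_apply]
      conv_lhs => rw [hy]
      rw [map_sum]
      refine Finset.sum_congr rfl fun i _ => ?_
      rw [map_smul, hm.fderiv_charm_single]
    rw [e]
    refine ContDiff.sum fun i _ => ?_
    have hi := ih (hm.mul (continuous_sym i))
    fun_prop

lemma BandLimited.contDiff_harm (hm : BandLimited m) : ContDiff ℝ ∞ (harm m) :=
  Complex.reCLM.contDiff.comp hm.contDiff_charm

lemma BandLimited.pderiv_harm (hm : BandLimited m) (i : Fin (d + 1)) :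
    pderiv i (harm m) = harm (fun ξ => sym i ξ * m ξ) := by
  funext z
  have h1 : HasFDerivAt (harm m) _ z :=
    Complex.reCLM.hasFDerivAt.comp z (hm.contDiff_charm.differentiable (by simp) z).hasFDerivAt
  rw [pderiv, h1.fderiv]
  simp [hm.fderiv_charm_single, harm]

lemma harm_add (hm : BandLimited m) (hm' : BandLimited m') (z : E (d + 1)) :
    harm (fun ξ => m ξ + m' ξ) z = harm m z + harm m' z := by
  simp only [harm, charm, mul_add]
  rw [integral_add (hm.integrable_exp z) (hm'.integrable_exp z), Complex.add_re]

lemma harm_const_mul (c : ℝ) (m : E d → ℂ) (z : E (d + 1)) :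
    harm (fun ξ => (c : ℂ) * m ξ) z = c * harm m z := by
  simp only [harm, charm]
  have : ∀ ξ, Complex.exp (phase ξ z) * ((c : ℂ) * m ξ) = (c : ℂ) * (Complex.exp (phase ξ z) * m ξ) :=
    fun ξ => by ring
  simp only [this]
  rw [integral_const_mul, Complex.re_ofReal_mul]

/-- This makes Plancherel's theorem available on every horizontal slice. -/
lemma harm_consPoint (m : E d → ℂ) (x : E d) (t : ℝ) :
    harm m (consPoint x t) = ((FourierTransformInv.fourierInv
      (fun ξ => (Real.exp (-(2 * Real.pi * ‖ξ‖ * t)) : ℂ) * m ξ) : E d → ℂ) x).re := by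
  rw [harm, charm, Real.fourierInv_eq']
  congr 2
  ext ξ
  rw [phase_consPoint, sub_eq_add_neg, Complex.exp_add]
  push_cast
  simp only [smul_eq_mul]
  ring

lemma BandLimited.exp_mul (hm : BandLimited m) (t : ℝ) :
    BandLimited (fun ξ => (Real.exp (-(2 * Real.pi * ‖ξ‖ * t)) : ℂ) * m ξ) :=
  hm.mul (by fun_prop)

lemma lintegral_harm_slice_le (hm : BandLimited m) (t : ℝ) :
    ∫⁻ x, ‖harm m (consPoint x t)‖ₑ ^ 2 ≤
      ∫⁻ ξ, ENNReal.ofReal (Real.exp (-(2 * (2 * Real.pi * ‖ξ‖) * t)) * ‖m ξ‖ ^ 2) := by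
  have h := hm.exp_mul t
  calc ∫⁻ x, ‖harm m (consPoint x t)‖ₑ ^ 2 ≤ ∫⁻ x, ‖(FourierTransformInv.fourierInv
      (fun ξ => (Real.exp (-(2 * Real.pi * ‖ξ‖ * t)) : ℂ) * m ξ) : E d → ℂ) x‖ₑ ^ 2 := by
        refine lintegral_mono fun x => ?_
        rw [harm_consPoint]
        gcongr
        rw [enorm_le_iff_norm_le, Real.norm_eq_abs]
        exact Complex.abs_re_le_norm _
    _ = ∫⁻ ξ, ‖(Real.exp (-(2 * Real.pi * ‖ξ‖ * t)) : ℂ) * m ξ‖ₑ ^ 2 :=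
        lintegral_fourierInv_sq h.memLp h.integrable
    _ = _ := by
        refine lintegral_congr fun ξ => ?_
        rw [← ofReal_norm, ← ENNReal.ofReal_pow (norm_nonneg _), norm_mul, mul_pow,
          Complex.norm_real, Real.norm_of_nonneg (by positivity), ← Real.exp_nat_mul]
        congr 3
        push_cast; ring

/-! ### Functions of the form `harm m₀ + xₙ harm m₁` -/

/-- The function `harm m₀ + xₙ harm m₁`. -/
def biharm (m0 m1 : E d → ℂ) (z : E (d + 1)) : ℝ := harm m0 z + z (Fin.last d) * harm m1 z

lemma contDiff_biharm (h0 : BandLimited m0) (h1 : BandLimited m1) : ContDiff ℝ ∞ (biharm m0 m1) := by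
  have hl : ContDiff ℝ ∞ (fun z : E (d + 1) => z (Fin.last d)) := by fun_prop
  exact h0.contDiff_harm.add (hl.mul h1.contDiff_harm)

lemma pderiv_coord (i j : Fin (d + 1)) (z : E (d + 1)) :
    pderiv i (fun y : E (d + 1) => y j) z = if i = j then 1 else 0 := by
  have := pderiv_comp_coord (φ := id) (a := 1) (b := 0) (z := z) (j := j) (i := i)
    differentiableAt_id
  simpa using this

/-- The class is closed under differentiation; the extra term in the first density comes from `∂ₙ xₙ
= 1`. -/
lemma pderiv_biharm (h0 : BandLimited m0) (h1 : BandLimited m1) (i : Fin (d + 1)) :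
    pderiv i (biharm m0 m1) =
      biharm (fun ξ => sym i ξ * m0 ξ + (if i = Fin.last d then 1 else 0) * m1 ξ)
        (fun ξ => sym i ξ * m1 ξ) := by
  funext z
  have hl : ContDiff ℝ ∞ (fun z : E (d + 1) => z (Fin.last d)) := by fun_prop
  have d0 := h0.contDiff_harm.differentiable (by simp) z
  have d1 := h1.contDiff_harm.differentiable (by simp) z
  have dl := hl.differentiable (by simp) z
  have e : biharm m0 m1 = fun z => harm m0 z + z (Fin.last d) * harm m1 z := rfl
  have d2 : DifferentiableAt ℝ (fun z : E (d + 1) => z (Fin.last d) * harm m1 z) z := dl.mul d1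
  rw [e, pderiv_add d0 d2, pderiv_mul dl d1, pderiv_coord, h0.pderiv_harm, h1.pderiv_harm,
    biharm]
  split_ifs with hi
  · have hb := harm_add (h0.mul (continuous_sym i)) (h1.mul (continuous_const (y := (1 : ℂ)))) z
    rw [hb]
    simp only [one_mul]; ring
  · simp

lemma biharm_consPoint_zero (x : E d) : biharm m0 m1 (consPoint x 0) = harm m0 (consPoint x 0) := by
  simp [biharm]

lemma two_mul_ofReal (a : ℝ) : 2 * ENNReal.ofReal a = ENNReal.ofReal (2 * a) := by
  rw [ENNReal.ofReal_mul (by norm_num), ENNReal.ofReal_ofNat]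

/-- The basic decay estimate. -/
lemma lintegral_biharm_slice_le (h0 : BandLimited m0) (h1 : BandLimited m1) {n : E d → ℝ}
    (hn0 : ∀ ξ, ‖m0 ξ‖ ^ 2 ≤ 2 * Real.pi * ‖ξ‖ * n ξ)
    (hn1 : ∀ ξ, ‖m1 ξ‖ ^ 2 ≤ (2 * Real.pi * ‖ξ‖) ^ 3 * n ξ) {t : ℝ} (ht : 0 ≤ t) :
    ∫⁻ x, ‖biharm m0 m1 (consPoint x t)‖ₑ ^ 2 ≤
      ∫⁻ ξ, ENNReal.ofReal
        (6 * (Real.exp (-(2 * Real.pi * ‖ξ‖ * t)) * (2 * Real.pi * ‖ξ‖ * n ξ))) := by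
  have hc1 := (h1.contDiff_harm.continuous.comp (continuous_consPoint_left t))
  have hc0 := (h0.contDiff_harm.continuous.comp (continuous_consPoint_left t))
  have hmeas : ∀ {m : E d → ℂ}, BandLimited m → AEMeasurable (fun ξ => ENNReal.ofReal
      (Real.exp (-(2 * (2 * Real.pi * ‖ξ‖) * t)) * ‖m ξ‖ ^ 2)) volume := by
    intro m hm
    have h2 : Continuous fun ξ : E d => Real.exp (-(2 * (2 * Real.pi * ‖ξ‖) * t)) := by fun_prop
    exact (h2.aemeasurable.mul (hm.memLp.1.norm.aemeasurable.pow_const 2)).ennreal_ofReal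
  calc ∫⁻ x, ‖biharm m0 m1 (consPoint x t)‖ₑ ^ 2
      ≤ ∫⁻ x, (2 * ‖harm m0 (consPoint x t)‖ₑ ^ 2 +
          2 * (‖t‖ₑ ^ 2 * ‖harm m1 (consPoint x t)‖ₑ ^ 2)) := by
        refine lintegral_mono fun x => ?_
        rw [biharm, consPoint_last]
        refine (enorm_add_sq_le _ _).trans ?_
        rw [enorm_mul, mul_pow]
    _ = 2 * (∫⁻ x, ‖harm m0 (consPoint x t)‖ₑ ^ 2) +
          2 * (‖t‖ₑ ^ 2 * ∫⁻ x, ‖harm m1 (consPoint x t)‖ₑ ^ 2) := by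
        rw [lintegral_add_left', lintegral_const_mul', lintegral_const_mul', lintegral_const_mul']
        · simp
        · norm_num
        · norm_num
        · exact (hc0.aestronglyMeasurable.enorm.pow_const 2).const_mul 2
    _ ≤ 2 * (∫⁻ ξ, ENNReal.ofReal (Real.exp (-(2 * (2 * Real.pi * ‖ξ‖) * t)) * ‖m0 ξ‖ ^ 2)) +
          2 * (‖t‖ₑ ^ 2 *
            ∫⁻ ξ, ENNReal.ofReal (Real.exp (-(2 * (2 * Real.pi * ‖ξ‖) * t)) * ‖m1 ξ‖ ^ 2)) := by
        have a0 := lintegral_harm_slice_le h0 t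
        have a1 := lintegral_harm_slice_le h1 t
        exact add_le_add (mul_le_mul_right a0 2) (mul_le_mul_right (mul_le_mul_right a1 _) 2)
    _ = ∫⁻ ξ, (2 * ENNReal.ofReal (Real.exp (-(2 * (2 * Real.pi * ‖ξ‖) * t)) * ‖m0 ξ‖ ^ 2) +
          2 * (‖t‖ₑ ^ 2 *
            ENNReal.ofReal (Real.exp (-(2 * (2 * Real.pi * ‖ξ‖) * t)) * ‖m1 ξ‖ ^ 2))) := by
        rw [lintegral_add_left', lintegral_const_mul', lintegral_const_mul', lintegral_const_mul']
        · simp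
        · norm_num
        · norm_num
        · exact (hmeas h0).const_mul 2
    _ ≤ _ := by
        refine lintegral_mono fun ξ => ?_
        rw [← ofReal_norm t, ← ENNReal.ofReal_pow (norm_nonneg _),
          ← ENNReal.ofReal_mul (by positivity), two_mul_ofReal, two_mul_ofReal,
          ← ENNReal.ofReal_add (by positivity) (by positivity)]
        refine ENNReal.ofReal_le_ofReal ?_
        rw [Real.norm_of_nonneg ht]
        have a0 := hn0 ξ
        have a1 := hn1 ξ
        set k := 2 * Real.pi * ‖ξ‖ with hk
        have hk0 : 0 ≤ k := by positivity
        set e := Real.exp (-(k * t)) with he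
        -- One of the two factors `e^{-kt}` is kept for integrability in `t`; the other absorbs `t²`
        -- through `(kt)² e^{-kt} ≤ 2`. The contributions `2` and `4` of the two densities add up to
        -- `6`.
        have he2 : Real.exp (-(2 * k * t)) = e * e := by
          rw [he, ← Real.exp_add]; congr 1; ring
        have he0 : 0 < e := Real.exp_pos _
        have he1 : e ≤ 1 := Real.exp_le_one_iff.2 (by simp; positivity)
        have hq : (k * t) ^ 2 * e ≤ 2 := by
          have h3 := Real.quadratic_le_exp_of_nonneg (x := k * t) (by positivity)
          have h4 : Real.exp (k * t) * e = 1 := by rw [he, ← Real.exp_add]; simp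
          nlinarith [mul_nonneg hk0 ht]
        have hkn : 0 ≤ k * n ξ := (sq_nonneg _).trans a0
        rw [he2]
        have b0 : e * e * ‖m0 ξ‖ ^ 2 ≤ e * (k * n ξ) := by
          calc e * e * ‖m0 ξ‖ ^ 2 ≤ e * 1 * (k * n ξ) := by gcongr
            _ = _ := by ring
        have b1 : t ^ 2 * (e * e * ‖m1 ξ‖ ^ 2) ≤ 2 * (e * (k * n ξ)) := by
          calc t ^ 2 * (e * e * ‖m1 ξ‖ ^ 2) ≤ t ^ 2 * (e * e * (k ^ 3 * n ξ)) := by gcongr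
            _ = (k * t) ^ 2 * e * (e * (k * n ξ)) := by ring
            _ ≤ 2 * (e * (k * n ξ)) := by gcongr
        linarith

end harmonic

/-! ### Square integrability on the half space -/

section growth

variable {d : ℕ} {f g σ : E (d + 1) → ℝ} {m m0 m1 : E d → ℂ}

lemma lintegral_exp_neg_Ioi {b : ℝ} (hb : 0 < b) :
    ∫⁻ t in Set.Ioi (0 : ℝ), ENNReal.ofReal (Real.exp (-(b * t))) = ENNReal.ofReal (1 / b) := by
  have e : (fun t : ℝ => Real.exp (-(b * t))) = fun t => Real.exp (-b * t) := by ext t; ring_nf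
  rw [← ofReal_integral_eq_lintegral_ofReal]
  · rw [e, integral_exp_mul_Ioi (by linarith)]
    simp [neg_div_neg_eq]
  · rw [e]; exact integrableOn_exp_mul_Ioi (by linarith) 0
  · exact Eventually.of_forall fun t => (Real.exp_pos _).le

lemma memLp_halfSpace_of_slice (hf : AEStronglyMeasurable f (volume.restrict (halfSpace d)))
    {C : ℝ≥0∞} (hC : C ≠ ⊤) {b : ℝ} (hb : 0 < b)
    (h : ∀ t : ℝ, 0 < t →
      ∫⁻ x : E d, ‖f (consPoint x t)‖ₑ ^ 2 ≤ C * ENNReal.ofReal (Real.exp (-(b * t)))) :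
    MemLp f 2 (volume.restrict (halfSpace d)) := by
  refine memLp_two_of_lintegral hf ?_
  have hf2 : AEMeasurable (fun z => ‖f z‖ₑ ^ 2) (volume.restrict (halfSpace d)) := hf.enorm.pow_const 2
  rw [halfSpace_eq_slab] at hf2 ⊢
  rw [lintegral_slab measurableSet_Ioi hf2]
  calc _ ≤ ∫⁻ t in Set.Ioi (0 : ℝ), C * ENNReal.ofReal (Real.exp (-(b * t))) :=
        setLIntegral_mono' measurableSet_Ioi fun t ht => h t ht
    _ = C * ENNReal.ofReal (1 / b) := by
        rw [lintegral_const_mul' _ _ hC, lintegral_exp_neg_Ioi hb]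
    _ < ⊤ := ENNReal.mul_lt_top hC.lt_top ENNReal.ofReal_lt_top

/-- `e^{-c xₙ} f ∈ L²(ℝⁿ₊)` for every `c > 0`. -/
def SubexpL2 (f : E (d + 1) → ℝ) : Prop :=
  ∀ c : ℝ, 0 < c → MemLp (fun z => Real.exp (-(c * z (Fin.last d))) * f z) 2
    (volume.restrict (halfSpace d))

lemma subexpL2_of_memLp (hf : MemLp f 2 (volume.restrict (halfSpace d))) : SubexpL2 f := by
  intro c hc
  have hcont : Continuous fun z : E (d + 1) => Real.exp (-(c * z (Fin.last d))) := by fun_prop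
  refine hf.of_le (hcont.aestronglyMeasurable.mul hf.1) ?_
  rw [ae_restrict_iff' (measurableSet_halfSpace d)]
  refine Eventually.of_forall fun z hz => ?_
  rw [norm_mul, Real.norm_of_nonneg (Real.exp_pos _).le]
  refine mul_le_of_le_one_left (norm_nonneg _) (Real.exp_le_one_iff.2 ?_)
  have : 0 < z (Fin.last d) := hz
  simp only [Left.neg_nonpos_iff]; positivity

lemma SubexpL2.integrableUpToBoundary (hf : SubexpL2 f) : IntegrableUpToBoundary f := by
  intro R
  have h1 := integrableUpToBoundary_of_memLp (hf 1 one_pos) R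
  have hcont : Continuous fun z : E (d + 1) => Real.exp (z (Fin.last d)) := by fun_prop
  have h2 : IntegrableOn (fun z => Real.exp (z (Fin.last d)) *
      (Real.exp (-(1 * z (Fin.last d))) * f z)) (halfSpace d ∩ Metric.closedBall 0 R) := by
    obtain ⟨C, hC⟩ := (isCompact_closedBall (0 : E (d + 1)) R).exists_bound_of_continuousOn
      hcont.continuousOn
    refine Integrable.bdd_mul (c := C) h1 hcont.aestronglyMeasurable ?_
    rw [ae_restrict_iff' ((measurableSet_halfSpace d).inter measurableSet_closedBall)]
    exact Eventually.of_forall fun z hz => hC z hz.2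
  refine h2.congr_fun (fun z _ => ?_) ((measurableSet_halfSpace d).inter measurableSet_closedBall)
  beta_reduce
  rw [← mul_assoc, ← Real.exp_add]
  simp

/-- The exponential weight beats linear growth: `1 + t ≤ (1 + 1/c) e^{ct}`, and the squared weight
`e^{-2ct}` leaves an integrable factor `e^{-ct}`. -/
lemma subexpL2_of_growth (hf : AEStronglyMeasurable f (volume.restrict (halfSpace d)))
    {C : ℝ≥0∞} (hC : C ≠ ⊤) (h : ∀ t : ℝ, 0 < t →
      ∫⁻ x : E d, ‖f (consPoint x t)‖ₑ ^ 2 ≤ C * ENNReal.ofReal (1 + t)) : SubexpL2 f := by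
  intro c hc
  have hcont : Continuous fun z : E (d + 1) => Real.exp (-(c * z (Fin.last d))) := by fun_prop
  refine memLp_halfSpace_of_slice (hcont.aestronglyMeasurable.mul hf)
    (C := C * ENNReal.ofReal (1 + 1 / c)) (ENNReal.mul_ne_top hC ENNReal.ofReal_ne_top) hc
    fun t ht => ?_
  simp only [consPoint_last, enorm_mul, mul_pow]
  rw [lintegral_const_mul' _ _ (by simp)]
  calc _ ≤ ‖Real.exp (-(c * t))‖ₑ ^ 2 * (C * ENNReal.ofReal (1 + t)) := by
        gcongr; exact h t ht
    _ = C * (ENNReal.ofReal (Real.exp (-(c * t)) ^ 2 * (1 + t))) := by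
        rw [← ofReal_norm, Real.norm_of_nonneg (Real.exp_pos _).le,
          ← ENNReal.ofReal_pow (Real.exp_pos _).le, ENNReal.ofReal_mul (by positivity)]
        ring
    _ ≤ C * (ENNReal.ofReal ((1 + 1 / c) * Real.exp (-(c * t)))) := by
        refine mul_le_mul_right (ENNReal.ofReal_le_ofReal ?_) C
        have h1 := Real.add_one_le_exp (c * t)
        have h2 : Real.exp (c * t) * Real.exp (-(c * t)) = 1 := by rw [← Real.exp_add]; simp
        have h3 : 1 ≤ Real.exp (c * t) := Real.one_le_exp (by positivity)
        have h4 : 1 + t ≤ (1 + 1 / c) * Real.exp (c * t) := by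
          have : t ≤ 1 / c * Real.exp (c * t) := by
            rw [div_mul_eq_mul_div, one_mul, le_div_iff₀ hc]; linarith
          linarith
        have h5 := Real.exp_pos (-(c * t))
        calc Real.exp (-(c * t)) ^ 2 * (1 + t)
            ≤ Real.exp (-(c * t)) ^ 2 * ((1 + 1 / c) * Real.exp (c * t)) := by gcongr
          _ = (1 + 1 / c) * Real.exp (-(c * t)) * (Real.exp (c * t) * Real.exp (-(c * t))) := by ring
          _ = _ := by rw [h2]; ring
    _ = _ := by rw [ENNReal.ofReal_mul (by positivity), mul_assoc]

/-- `e^{c xₙ} σ ∈ L²(ℝⁿ₊)` for some `c > 0`. -/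
def ExpDecayL2 (σ : E (d + 1) → ℝ) : Prop :=
  ∃ c : ℝ, 0 < c ∧ MemLp (fun z => Real.exp (c * z (Fin.last d)) * σ z) 2
    (volume.restrict (halfSpace d))

/-- The weights `e^{-c xₙ}` and `e^{c xₙ}` cancel in the product. -/
lemma SubexpL2.integrableOn_mul (hf : SubexpL2 f) (hσ : ExpDecayL2 σ) :
    IntegrableOn (fun z => f z * σ z) (halfSpace d) := by
  obtain ⟨c, hc, h⟩ := hσ
  refine ((hf c hc).integrable_mul h).congr (Eventually.of_forall fun z => ?_)
  simp only [Pi.mul_apply]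
  have : Real.exp (-(c * z (Fin.last d))) * Real.exp (c * z (Fin.last d)) = 1 := by
    rw [← Real.exp_add]; simp
  linear_combination (f z * σ z) * this

lemma ExpDecayL2.memLp (hσ : ExpDecayL2 σ) : MemLp σ 2 (volume.restrict (halfSpace d)) := by
  obtain ⟨c, hc, h⟩ := hσ
  have h1 := subexpL2_of_memLp h c hc
  refine (memLp_congr_ae (Eventually.of_forall fun z => ?_)).1 h1
  simp only
  rw [← mul_assoc, ← Real.exp_add]
  simp

/-- The frequencies stay away from zero, so the squared `L²` norm of the slice at height `t` is at
most a constant times `e^{-δt}`, with `δ` a lower bound for the frequencies. -/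
lemma expDecayL2_biharm (h0 : BandLimited m0) (h1 : BandLimited m1) : ExpDecayL2 (biharm m0 m1) := by
  obtain ⟨δ0, R0, hδ0, hb0⟩ := h0.band
  obtain ⟨δ1, R1, hδ1, hb1⟩ := h1.band
  set δ := min δ0 δ1 with hδ
  have hδp : 0 < δ := lt_min hδ0 hδ1
  -- The weight `e^{δ xₙ/4}` contributes `e^{δt/2}` after squaring, and a decay of `e^{-δt/2}` is
  -- left over.
  refine ⟨δ / 4, by positivity, ?_⟩
  have hcont : Continuous fun z : E (d + 1) => Real.exp (δ / 4 * z (Fin.last d)) := by fun_prop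
  -- Each summand serves one of the two hypotheses of `lintegral_biharm_slice_le`. On the supports
  -- the denominators are positive.
  set n : E d → ℝ := fun ξ => ‖m0 ξ‖ ^ 2 / (2 * Real.pi * ‖ξ‖) + ‖m1 ξ‖ ^ 2 / (2 * Real.pi * ‖ξ‖) ^ 3
    with hn
  have hk : ∀ {ξ : E d} {δ' : ℝ}, 0 < δ' → δ' ≤ ‖ξ‖ → δ' ≤ 2 * Real.pi * ‖ξ‖ := by
    intro ξ δ' _ h
    nlinarith [Real.pi_gt_three, norm_nonneg ξ]
  have hnn : ∀ ξ, 0 ≤ n ξ := fun ξ => by positivity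
  have hn0 : ∀ ξ, ‖m0 ξ‖ ^ 2 ≤ 2 * Real.pi * ‖ξ‖ * n ξ := by
    intro ξ
    by_cases h : m0 ξ = 0
    · have : 0 ≤ 2 * Real.pi * ‖ξ‖ * n ξ := mul_nonneg (by positivity) (hnn ξ)
      simpa [h] using this
    · have hp : 0 < 2 * Real.pi * ‖ξ‖ := hδ0.trans_le (hk hδ0 (hb0 ξ h).1)
      rw [hn, mul_add, mul_div_cancel₀ _ hp.ne']
      have : 0 ≤ 2 * Real.pi * ‖ξ‖ * (‖m1 ξ‖ ^ 2 / (2 * Real.pi * ‖ξ‖) ^ 3) := by positivity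
      linarith
  have hn1 : ∀ ξ, ‖m1 ξ‖ ^ 2 ≤ (2 * Real.pi * ‖ξ‖) ^ 3 * n ξ := by
    intro ξ
    by_cases h : m1 ξ = 0
    · have : 0 ≤ (2 * Real.pi * ‖ξ‖) ^ 3 * n ξ := mul_nonneg (by positivity) (hnn ξ)
      simpa [h] using this
    · have hp : 0 < 2 * Real.pi * ‖ξ‖ := hδ1.trans_le (hk hδ1 (hb1 ξ h).1)
      rw [hn, mul_add, mul_div_cancel₀ _ (by positivity : (2 * Real.pi * ‖ξ‖) ^ 3 ≠ 0)]
      have : 0 ≤ (2 * Real.pi * ‖ξ‖) ^ 3 * (‖m0 ξ‖ ^ 2 / (2 * Real.pi * ‖ξ‖)) := by positivity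
      linarith
  set N : E d → ℝ := fun ξ => 6 * (‖m0 ξ‖ ^ 2 + δ⁻¹ ^ 2 * ‖m1 ξ‖ ^ 2) with hN
  have hNint : Integrable N := by
    have a0 := h0.memLp.integrable_norm_pow (by norm_num)
    have a1 := h1.memLp.integrable_norm_pow (by norm_num)
    exact (a0.add (a1.const_mul _)).const_mul 6
  have key : ∀ t : ℝ, 0 < t → ∀ ξ : E d,
      6 * (Real.exp (-(2 * Real.pi * ‖ξ‖ * t)) * (2 * Real.pi * ‖ξ‖ * n ξ)) ≤
      Real.exp (-(δ * t)) * N ξ := by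
    intro t ht ξ
    by_cases hz : m0 ξ = 0 ∧ m1 ξ = 0
    · have : n ξ = 0 := by simp [hn, hz.1, hz.2]
      have : N ξ = 0 := by simp [hN, hz.1, hz.2]
      simp [*]
    · have hδξ : δ ≤ ‖ξ‖ := by
        by_cases h : m0 ξ = 0
        · exact (min_le_right _ _).trans (hb1 ξ fun h' => hz ⟨h, h'⟩).1
        · exact (min_le_left _ _).trans (hb0 ξ h).1
      have hkδ : δ ≤ 2 * Real.pi * ‖ξ‖ := hk hδp hδξ
      set k := 2 * Real.pi * ‖ξ‖ with hkdef
      have hkp : 0 < k := hδp.trans_le hkδ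
      have e1 : k * n ξ = ‖m0 ξ‖ ^ 2 + k⁻¹ ^ 2 * ‖m1 ξ‖ ^ 2 := by
        have : n ξ = ‖m0 ξ‖ ^ 2 / k + ‖m1 ξ‖ ^ 2 / k ^ 3 := rfl
        rw [this]; field_simp
      have e2 : k⁻¹ ≤ δ⁻¹ := inv_anti₀ hδp hkδ
      rw [e1, hN]
      calc _ ≤ 6 * (Real.exp (-(δ * t)) * (‖m0 ξ‖ ^ 2 + δ⁻¹ ^ 2 * ‖m1 ξ‖ ^ 2)) := by gcongr
        _ = _ := by ring
  refine memLp_halfSpace_of_slice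
    (hcont.aestronglyMeasurable.mul (contDiff_biharm h0 h1).continuous.aestronglyMeasurable)
    (C := ∫⁻ ξ, ENNReal.ofReal (N ξ)) hNint.lintegral_lt_top.ne (b := δ / 2) (by positivity)
    fun t ht => ?_
  simp only [consPoint_last, enorm_mul, mul_pow]
  rw [lintegral_const_mul' _ _ (by simp)]
  calc _ ≤ ‖Real.exp (δ / 4 * t)‖ₑ ^ 2 *
        ∫⁻ ξ, ENNReal.ofReal (Real.exp (-(δ * t)) * N ξ) := by
        refine mul_le_mul_right ?_ _
        refine (lintegral_biharm_slice_le h0 h1 hn0 hn1 ht.le).trans ?_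
        exact lintegral_mono fun ξ => ENNReal.ofReal_le_ofReal (key t ht ξ)
    _ = ‖Real.exp (δ / 4 * t)‖ₑ ^ 2 * (ENNReal.ofReal (Real.exp (-(δ * t))) *
          ∫⁻ ξ, ENNReal.ofReal (N ξ)) := by
        congr 1
        rw [← lintegral_const_mul' _ _ ENNReal.ofReal_ne_top]
        exact lintegral_congr fun ξ => ENNReal.ofReal_mul (Real.exp_pos _).le
    _ = _ := by
        rw [← ofReal_norm, Real.norm_of_nonneg (Real.exp_pos _).le,
          ← ENNReal.ofReal_pow (Real.exp_pos _).le, ← mul_assoc,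
          ← ENNReal.ofReal_mul (by positivity), mul_comm]
        congr 2
        rw [← Real.exp_nat_mul, ← Real.exp_add]
        congr 1; push_cast; ring
    _ ≤ _ := le_rfl

/-- The energy estimate for functions `harm m₀ + xₙ harm m₁`. -/
lemma lintegral_biharm_halfSpace_le (h0 : BandLimited m0) (h1 : BandLimited m1) {n : E d → ℝ}
    (hn : AEMeasurable n) (hnn : ∀ ξ, 0 ≤ n ξ)
    (hn0 : ∀ ξ, ‖m0 ξ‖ ^ 2 ≤ 2 * Real.pi * ‖ξ‖ * n ξ)
    (hn1 : ∀ ξ, ‖m1 ξ‖ ^ 2 ≤ (2 * Real.pi * ‖ξ‖) ^ 3 * n ξ) :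
    ∫⁻ z in halfSpace d, ‖biharm m0 m1 z‖ₑ ^ 2 ≤ ∫⁻ ξ, ENNReal.ofReal (6 * n ξ) := by
  rw [halfSpace_eq_slab, lintegral_slab measurableSet_Ioi
    ((contDiff_biharm h0 h1).continuous.aestronglyMeasurable.enorm.pow_const 2)]
  calc _ ≤ ∫⁻ t in Set.Ioi (0 : ℝ), ∫⁻ ξ : E d, ENNReal.ofReal
        (6 * (Real.exp (-(2 * Real.pi * ‖ξ‖ * t)) * (2 * Real.pi * ‖ξ‖ * n ξ))) :=
        setLIntegral_mono' measurableSet_Ioi fun t ht =>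
          lintegral_biharm_slice_le h0 h1 hn0 hn1 (le_of_lt ht)
    -- After Tonelli the weight disappears, because `∫₀^∞ k e^{-kt} dt = 1` with `k = 2π|ξ|`.
    _ = ∫⁻ ξ : E d, ∫⁻ t in Set.Ioi (0 : ℝ), ENNReal.ofReal
        (6 * (Real.exp (-(2 * Real.pi * ‖ξ‖ * t)) * (2 * Real.pi * ‖ξ‖ * n ξ))) := by
        rw [lintegral_lintegral_swap]
        refine AEMeasurable.ennreal_ofReal ?_
        have hc : Continuous fun p : ℝ × E d => Real.exp (-(2 * Real.pi * ‖p.2‖ * p.1)) := by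
          fun_prop
        have hc' : Continuous fun p : ℝ × E d => 2 * Real.pi * ‖p.2‖ := by fun_prop
        exact (hc.aemeasurable.mul (hc'.aemeasurable.mul hn.comp_snd)).const_mul 6
    _ ≤ _ := by
        refine lintegral_mono fun ξ => ?_
        rcases (norm_nonneg ξ).eq_or_lt with h | h
        · simp [← h]
        · have hk : 0 < 2 * Real.pi * ‖ξ‖ := by positivity
          set k := 2 * Real.pi * ‖ξ‖ with hkd
          have e : ∀ t : ℝ, ENNReal.ofReal (6 * (Real.exp (-(k * t)) * (k * n ξ))) =
              ENNReal.ofReal (6 * (k * n ξ)) * ENNReal.ofReal (Real.exp (-(k * t))) := by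
            intro t
            rw [← ENNReal.ofReal_mul (by have := hnn ξ; positivity)]
            congr 1; ring
          simp only [e]
          rw [lintegral_const_mul' _ _ ENNReal.ofReal_ne_top, lintegral_exp_neg_Ioi hk,
            ← ENNReal.ofReal_mul (by have := hnn ξ; positivity)]
          refine ENNReal.ofReal_le_ofReal (le_of_eq ?_)
          field_simp

/-- Functions with square integrable slices and normal derivative in `L²` grow at most linearly. -/
lemma exists_slice_growth (hf : ContDiffOn ℝ ∞ f (halfSpace d))
    (hg : MemLp (pderiv (Fin.last d) f) 2 (volume.restrict (halfSpace d)))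
    (hs : MemLp (fun x => f (consPoint x 1)) 2) :
    ∃ C : ℝ≥0∞, C ≠ ⊤ ∧ ∀ t : ℝ, 0 < t →
      ∫⁻ x : E d, ‖f (consPoint x t)‖ₑ ^ 2 ≤ C * ENNReal.ofReal (1 + t) := by
  set g := pderiv (Fin.last d) f with hgd
  have hgc : ContinuousOn g (halfSpace d) := hf.continuousOn_pderiv (isOpen_halfSpace d) _
  have hD := lintegral_sq_lt_top hg
  have hA := lintegral_sq_lt_top hs
  refine ⟨2 * (∫⁻ x, ‖f (consPoint x 1)‖ₑ ^ 2) + 2 * ∫⁻ z in halfSpace d, ‖g z‖ₑ ^ 2, ?_,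
    fun t ht => ?_⟩
  · exact ENNReal.add_ne_top.2 ⟨ENNReal.mul_ne_top (by norm_num) hA.ne,
      ENNReal.mul_ne_top (by norm_num) hD.ne⟩
  have hsub : Set.uIcc 1 t ⊆ Set.Ioi (0 : ℝ) := fun s hs => by
    rw [Set.mem_uIcc] at hs
    rcases hs with hs | hs
    · exact lt_of_lt_of_le one_pos hs.1
    · exact lt_of_lt_of_le ht hs.1
  -- Integrate the normal derivative from the reference height `1` to `t`; Cauchy–Schwarz costs the
  -- length `|t - 1| ≤ 1 + t` of the interval.
  have hpt : ∀ x : E d, ‖f (consPoint x t)‖ₑ ^ 2 ≤ 2 * ‖f (consPoint x 1)‖ₑ ^ 2 +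
      2 * (ENNReal.ofReal (1 + t) * ∫⁻ s in Set.Ioi (0 : ℝ), ‖g (consPoint x s)‖ₑ ^ 2) := by
    intro x
    have hgx : ContinuousOn (fun s => g (consPoint x s)) (Set.Ioi 0) :=
      hgc.comp (continuous_consPoint_right x).continuousOn fun s hs => by simpa using hs
    have hI := intervalIntegral.integral_eq_sub_of_hasDerivAt (a := 1) (b := t)
      (f := fun s => f (consPoint x s)) (f' := fun s => g (consPoint x s))
      (fun s hs => hasDerivAt_comp_consPoint ((hf.contDiffAt ((isOpen_halfSpace d).mem_nhds
        (by simpa using hsub hs))).differentiableAt (by simp)))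
      ((hgx.mono hsub).intervalIntegrable)
    have e : f (consPoint x t) = f (consPoint x 1) + ∫ s in (1 : ℝ)..t, g (consPoint x s) := by
      rw [hI]; ring
    rw [e]
    refine (enorm_add_sq_le _ _).trans ?_
    gcongr
    have hU : Set.uIoc 1 t ⊆ Set.Ioi (0 : ℝ) := Set.uIoc_subset_uIcc.trans hsub
    have hle : ‖∫ s in (1 : ℝ)..t, g (consPoint x s)‖ₑ ≤
        ∫⁻ s in Set.uIoc 1 t, ‖g (consPoint x s)‖ₑ := by
      rw [← ofReal_norm, intervalIntegral.norm_intervalIntegral_eq, ofReal_norm]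
      exact enorm_integral_le_lintegral_enorm _
    have hvol : volume (Set.uIoc 1 t) ≤ ENNReal.ofReal (1 + t) := by
      rw [Set.uIoc, Real.volume_Ioc]
      refine ENNReal.ofReal_le_ofReal ?_
      rw [max_sub_min_eq_abs']
      rw [abs_le]; constructor <;> linarith
    calc _ ≤ (∫⁻ s in Set.uIoc 1 t, ‖g (consPoint x s)‖ₑ) ^ 2 := by gcongr
      _ ≤ _ := sq_lintegral_le ((hgx.mono hU).aestronglyMeasurable measurableSet_uIoc).enorm
      _ ≤ _ := by
        rw [Measure.restrict_apply_univ]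
        gcongr
  calc _ ≤ ∫⁻ x : E d, (2 * ‖f (consPoint x 1)‖ₑ ^ 2 +
      2 * (ENNReal.ofReal (1 + t) * ∫⁻ s in Set.Ioi (0 : ℝ), ‖g (consPoint x s)‖ₑ ^ 2)) :=
        lintegral_mono hpt
    _ = 2 * (∫⁻ x, ‖f (consPoint x 1)‖ₑ ^ 2) +
        2 * (ENNReal.ofReal (1 + t) * ∫⁻ z in halfSpace d, ‖g z‖ₑ ^ 2) := by
        have hf2 : AEMeasurable (fun z => ‖g z‖ₑ ^ 2) (volume.restrict (halfSpace d)) :=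
          hg.1.enorm.pow_const 2
        rw [halfSpace_eq_slab] at hf2 ⊢
        rw [lintegral_slab' measurableSet_Ioi hf2, lintegral_add_left', lintegral_const_mul',
          lintegral_const_mul', lintegral_const_mul']
        · exact ENNReal.ofReal_ne_top
        · norm_num
        · norm_num
        · exact (hs.1.enorm.pow_const 2).const_mul 2
    _ ≤ (2 * (∫⁻ x, ‖f (consPoint x 1)‖ₑ ^ 2)) * ENNReal.ofReal (1 + t) +
        2 * (ENNReal.ofReal (1 + t) * ∫⁻ z in halfSpace d, ‖g z‖ₑ ^ 2) := by
        refine add_le_add_left (le_mul_of_one_le_right (by simp) ?_) _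
        rw [ENNReal.one_le_ofReal]; linarith
    _ = _ := by ring

end growth

/-! ### The form of the Lamé system -/

section lame

/-- The bilinear form `2μ sym(A) : sym(B) + λ tr(A) tr(B)`. -/
def lameDens {m : ℕ} (lam mu : ℝ) (A B : Fin m → Fin m → ℝ) : ℝ :=
  2 * mu * ∑ i, ∑ j, ((A i j + A j i) / 2) * ((B i j + B j i) / 2) +
    lam * ((∑ i, A i i) * ∑ i, B i i)

/-- The stress of a displacement gradient. -/
def stress {m : ℕ} (lam mu : ℝ) (A : Fin m → Fin m → ℝ) (i j : Fin m) : ℝ :=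
  mu * (A i j + A j i) + if i = j then lam * ∑ l, A l l else 0

/-- The stress is symmetric, so pairing it with the symmetric part of `B` is the same as pairing it
with `B`. In this form each entry can be integrated by parts separately. -/
lemma lameDens_eq_sum_stress {m : ℕ} (lam mu : ℝ) (A B : Fin m → Fin m → ℝ) :
    lameDens lam mu A B = ∑ j, ∑ i, stress lam mu A i j * B i j := by
  have h1 : ∑ j, ∑ i, (A i j + A j i) * B i j = ∑ i, ∑ j, (A i j + A j i) * B i j := Finset.sum_comm
  have h2 : ∑ i, ∑ j, (A i j + A j i) * B j i = ∑ i, ∑ j, (A i j + A j i) * B i j := by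
    rw [Finset.sum_comm]
    refine Finset.sum_congr rfl fun i _ => Finset.sum_congr rfl fun j _ => ?_
    ring
  have h3 : ∑ i, ∑ j, ((A i j + A j i) / 2) * ((B i j + B j i) / 2) =
      (1 / 2) * ∑ i, ∑ j, (A i j + A j i) * B i j := by
    have : ∀ i j, ((A i j + A j i) / 2) * ((B i j + B j i) / 2) =
        (1 / 4) * ((A i j + A j i) * B i j) + (1 / 4) * ((A i j + A j i) * B j i) :=
      fun i j => by ring
    simp only [this, Finset.sum_add_distrib, ← Finset.mul_sum]
    rw [h2]; ring
  have h4 : ∑ j, ∑ i, stress lam mu A i j * B i j =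
      mu * (∑ j, ∑ i, (A i j + A j i) * B i j) + ∑ j, (lam * ∑ l, A l l) * B j j := by
    simp only [stress, add_mul, Finset.sum_add_distrib, ite_mul, zero_mul, Finset.sum_ite_eq',
      Finset.mem_univ, if_true, mul_assoc, Finset.mul_sum, mul_add]
  rw [h4, lameDens, h3, h1, ← Finset.mul_sum]
  ring

variable {m : ℕ} {Ω : Set (E m)} {lam mu : ℝ} {u v v' : E m → E m}
  {A B B' : Fin m → Fin m → E m → ℝ}

lemma lameForm_eq (hΩ : IsOpen Ω) (hu : ∀ i j, IsWeakPartial Ω i (fun x => u x j) (A i j))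
    (hv : ∀ i j, IsWeakPartial Ω i (fun x => v x j) (B i j)) :
    lameForm lam mu Ω u v =
      ∫ x in Ω, lameDens lam mu (fun i j => A i j x) (fun i j => B i j x) := by
  have h1 : ∀ᵐ x ∂(volume.restrict Ω), ∀ i j, weakPartial Ω i (fun x => u x j) x = A i j x :=
    ae_all_iff.2 fun i => ae_all_iff.2 fun j => (hu i j).weakPartial_ae_eq hΩ
  have h2 : ∀ᵐ x ∂(volume.restrict Ω), ∀ i j, weakPartial Ω i (fun x => v x j) x = B i j x :=
    ae_all_iff.2 fun i => ae_all_iff.2 fun j => (hv i j).weakPartial_ae_eq hΩ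
  refine integral_congr_ae ?_
  filter_upwards [h1, h2] with x h1 h2
  simp only [lameDens, strain, weakDiv, h1, h2]

lemma integrable_lameDens {μ : Measure (E m)} (hA : ∀ i j, MemLp (A i j) 2 μ)
    (hB : ∀ i j, MemLp (B i j) 2 μ) :
    Integrable (fun x => lameDens lam mu (fun i j => A i j x) (fun i j => B i j x)) μ := by
  simp only [lameDens_eq_sum_stress]
  refine integrable_finsetSum _ fun j _ => integrable_finsetSum _ fun i _ => ?_
  refine MemLp.integrable_mul (p := 2) (q := 2) ?_ (hB i j)
  simp only [stress]
  refine (((hA i j).add (hA j i)).const_mul mu).add ?_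
  split_ifs
  · exact (memLp_finsetSum _ fun l _ => hA l l).const_mul lam
  · simp

lemma lameDens_comm (A B : Fin m → Fin m → ℝ) : lameDens lam mu A B = lameDens lam mu B A := by
  simp only [lameDens, mul_comm]

lemma lameDens_sub_right (A B B' : Fin m → Fin m → ℝ) :
    lameDens lam mu A (fun i j => B i j - B' i j) = lameDens lam mu A B - lameDens lam mu A B' := by
  simp only [lameDens_eq_sum_stress, mul_sub, Finset.sum_sub_distrib]

lemma lameDens_self_nonneg (hlam : 0 < lam) (hmu : 0 < mu) (A : Fin m → Fin m → ℝ) :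
    0 ≤ lameDens lam mu A A := by
  refine add_nonneg (mul_nonneg (by positivity) ?_) (mul_nonneg hlam.le (mul_self_nonneg _))
  exact Finset.sum_nonneg fun i _ => Finset.sum_nonneg fun j _ => mul_self_nonneg _

/-- The symmetric part is no larger than the matrix, and Cauchy–Schwarz bounds the squared trace by
`m` times the sum of the squared entries. -/
lemma lameDens_self_le (hlam : 0 < lam) (hmu : 0 < mu) (A : Fin m → Fin m → ℝ) :
    lameDens lam mu A A ≤ (2 * mu + lam * m) * ∑ i, ∑ j, A i j ^ 2 := by
  have h1 : ∑ i, ∑ j, ((A i j + A j i) / 2) * ((A i j + A j i) / 2) ≤ ∑ i, ∑ j, A i j ^ 2 := by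
    have e : ∑ i, ∑ j, A j i ^ 2 = ∑ i, ∑ j, A i j ^ 2 := Finset.sum_comm
    calc _ ≤ ∑ i, ∑ j, ((1 / 2) * A i j ^ 2 + (1 / 2) * A j i ^ 2) := by
          refine Finset.sum_le_sum fun i _ => Finset.sum_le_sum fun j _ => ?_
          nlinarith [sq_nonneg (A i j - A j i)]
      _ = _ := by
          simp only [Finset.sum_add_distrib, ← Finset.mul_sum]
          rw [e]; ring
  have h2 : (∑ i, A i i) * ∑ i, A i i ≤ m * ∑ i, ∑ j, A i j ^ 2 := by
    have := sq_sum_le_card_mul_sum_sq (s := Finset.univ) (f := fun i => A i i)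
    rw [Finset.card_univ, Fintype.card_fin] at this
    rw [← sq]
    refine this.trans ?_
    gcongr with i
    exact Finset.single_le_sum (f := fun j => A i j ^ 2) (fun j _ => sq_nonneg _) (Finset.mem_univ i)
  rw [lameDens, add_mul, mul_assoc lam]
  gcongr

end lame

/-! ### An explicit solution of the Lamé system in the half space -/

section potential

variable {d : ℕ} {g m m' m0 m1 m0' m1' : E d → ℂ} {lam mu : ℝ}

lemma biharm_add (h0 : BandLimited m0) (h1 : BandLimited m1) (h0' : BandLimited m0')
    (h1' : BandLimited m1') (z : E (d + 1)) :
    biharm (fun ξ => m0 ξ + m0' ξ) (fun ξ => m1 ξ + m1' ξ) z = biharm m0 m1 z + biharm m0' m1' z := by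
  simp only [biharm]
  rw [harm_add h0 h0', harm_add h1 h1']; ring

lemma biharm_const_mul (c : ℝ) (m0 m1 : E d → ℂ) (z : E (d + 1)) :
    biharm (fun ξ => (c : ℂ) * m0 ξ) (fun ξ => (c : ℂ) * m1 ξ) z = c * biharm m0 m1 z := by
  simp only [biharm, harm_const_mul]; ring

lemma biharm_zero (z : E (d + 1)) : biharm (fun _ : E d => (0 : ℂ)) (fun _ => 0) z = 0 := by
  simp [biharm, harm, charm]

/-- `harm m₀ + xₙ harm m₁` for `mᵢ = pᵢ g`. -/
def pot (g : E d → ℂ) (p0 p1 : E d → ℂ) : E (d + 1) → ℝ :=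
  biharm (fun ξ => p0 ξ * g ξ) (fun ξ => p1 ξ * g ξ)

variable {p0 p1 q0 q1 : E d → ℂ}

lemma pot_add (hg : BandLimited g) (h0 : Continuous p0) (h1 : Continuous p1) (h0' : Continuous q0)
    (h1' : Continuous q1) (z : E (d + 1)) :
    pot g (fun ξ => p0 ξ + q0 ξ) (fun ξ => p1 ξ + q1 ξ) z = pot g p0 p1 z + pot g q0 q1 z := by
  simp only [pot, add_mul]
  exact biharm_add (hg.mul h0) (hg.mul h1) (hg.mul h0') (hg.mul h1') z

lemma pot_const_mul (c : ℝ) (z : E (d + 1)) :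
    pot g (fun ξ => (c : ℂ) * p0 ξ) (fun ξ => (c : ℂ) * p1 ξ) z = c * pot g p0 p1 z := by
  simp only [pot, mul_assoc]
  exact biharm_const_mul c _ _ z

lemma pot_zero (z : E (d + 1)) : pot g (fun _ => 0) (fun _ => 0) z = 0 := by
  simp only [pot, zero_mul, biharm_zero]

lemma pot_sum (hg : BandLimited g) {ι : Type*} (s : Finset ι) {P0 P1 : ι → E d → ℂ}
    (h0 : ∀ i, Continuous (P0 i)) (h1 : ∀ i, Continuous (P1 i)) (z : E (d + 1)) :
    pot g (fun ξ => ∑ i ∈ s, P0 i ξ) (fun ξ => ∑ i ∈ s, P1 i ξ) z = ∑ i ∈ s, pot g (P0 i) (P1 i) z := by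
  classical
  induction s using Finset.induction_on with
  | empty => simp only [Finset.sum_empty, pot_zero]
  | insert a s ha ih =>
    simp only [Finset.sum_insert ha]
    rw [pot_add hg (h0 a) (h1 a) (continuous_finsetSum _ fun i _ => h0 i)
      (continuous_finsetSum _ fun i _ => h1 i), ih]

lemma contDiff_pot (hg : BandLimited g) (h0 : Continuous p0) (h1 : Continuous p1) :
    ContDiff ℝ ∞ (pot g p0 p1) :=
  contDiff_biharm (hg.mul h0) (hg.mul h1)

lemma expDecayL2_pot (hg : BandLimited g) (h0 : Continuous p0) (h1 : Continuous p1) :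
    ExpDecayL2 (pot g p0 p1) :=
  expDecayL2_biharm (hg.mul h0) (hg.mul h1)

lemma pderiv_pot (hg : BandLimited g) (h0 : Continuous p0) (h1 : Continuous p1) (i : Fin (d + 1)) :
    pderiv i (pot g p0 p1) =
      pot g (fun ξ => sym i ξ * p0 ξ + (if i = Fin.last d then 1 else 0) * p1 ξ)
        (fun ξ => sym i ξ * p1 ξ) := by
  rw [pot, pderiv_biharm (hg.mul h0) (hg.mul h1), pot]
  congr 1
  · ext ξ; ring
  · ext ξ; ring

/-- This is the harmonicity of `e^{2πi⟨x', ξ⟩ - 2π|ξ|xₙ}`: the normal square `(2π|ξ|)²` cancels the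
tangential ones. -/
lemma sum_sym_mul_sym (ξ : E d) : ∑ i, sym i ξ * sym i ξ = 0 := by
  rw [Fin.sum_univ_castSucc]
  simp only [sym_castSucc, sym_last]
  have h1 : ‖ξ‖ ^ 2 = ∑ j, ξ j ^ 2 := by
    rw [EuclideanSpace.norm_sq_eq]; simp
  have h2 : ∀ j, ((2 * Real.pi * ξ j : ℝ) : ℂ) * Complex.I * (((2 * Real.pi * ξ j : ℝ) : ℂ) * Complex.I)
      = ((-(2 * Real.pi) ^ 2 * ξ j ^ 2 : ℝ) : ℂ) := by
    intro j
    have := Complex.I_mul_I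
    push_cast
    linear_combination (2 * (Real.pi : ℂ) * (ξ j : ℂ)) ^ 2 * this
  simp only [h2]
  rw [← Complex.ofReal_sum, ← Finset.mul_sum, ← h1]
  push_cast; ring

/-- The coefficient `-μ / (λ + 2μ)`. -/
def lameA (lam mu : ℝ) : ℝ := -mu / (lam + 2 * mu)

/-- The symbol of the components of the explicit solution. -/
def solSym0 (lam mu : ℝ) (j : Fin (d + 1)) (ξ : E d) : ℂ :=
  -((if j = Fin.last d then 1 else lameA lam mu : ℝ) : ℂ) * sym j ξ

/-- The symbol of the components of the explicit solution, coefficient of `xₙ`. -/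
def solSym1 (lam mu : ℝ) (j : Fin (d + 1)) (ξ : E d) : ℂ :=
  ((1 + lameA lam mu : ℝ) : ℂ) * (sym (Fin.last d) ξ * sym j ξ)

/-- The symbol of the gradient of the explicit solution. -/
def gradSym0 (lam mu : ℝ) (i j : Fin (d + 1)) (ξ : E d) : ℂ :=
  sym i ξ * solSym0 lam mu j ξ + (if i = Fin.last d then 1 else 0) * solSym1 lam mu j ξ

/-- The symbol of the gradient of the explicit solution, coefficient of `xₙ`. -/
def gradSym1 (lam mu : ℝ) (i j : Fin (d + 1)) (ξ : E d) : ℂ := sym i ξ * solSym1 lam mu j ξ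

/-- The explicit solution of the Lamé system, with `wⁿ = harm (2π|ξ| g)` on the boundary. -/
def lameSol (lam mu : ℝ) (g : E d → ℂ) (j : Fin (d + 1)) : E (d + 1) → ℝ :=
  pot g (solSym0 lam mu j) (solSym1 lam mu j)

/-- The gradient of the explicit solution. -/
def lameGrad (lam mu : ℝ) (g : E d → ℂ) (i j : Fin (d + 1)) : E (d + 1) → ℝ :=
  pot g (gradSym0 lam mu i j) (gradSym1 lam mu i j)

lemma continuous_solSym0 (j : Fin (d + 1)) : Continuous (solSym0 (d := d) lam mu j) := by
  have := continuous_sym (d := d) j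
  unfold solSym0; fun_prop

lemma continuous_solSym1 (j : Fin (d + 1)) : Continuous (solSym1 (d := d) lam mu j) := by
  have := continuous_sym (d := d) j
  have := continuous_sym (d := d) (Fin.last d)
  unfold solSym1; fun_prop

lemma continuous_gradSym0 (i j : Fin (d + 1)) : Continuous (gradSym0 (d := d) lam mu i j) := by
  have := continuous_sym (d := d) i
  have := continuous_solSym0 (d := d) (lam := lam) (mu := mu) j
  have := continuous_solSym1 (d := d) (lam := lam) (mu := mu) j
  unfold gradSym0; fun_prop

lemma continuous_gradSym1 (i j : Fin (d + 1)) : Continuous (gradSym1 (d := d) lam mu i j) := by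
  have := continuous_sym (d := d) i
  have := continuous_solSym1 (d := d) (lam := lam) (mu := mu) j
  unfold gradSym1; fun_prop

lemma pderiv_lameSol (hg : BandLimited g) (i j : Fin (d + 1)) :
    pderiv i (lameSol lam mu g j) = lameGrad lam mu g i j :=
  pderiv_pot hg (continuous_solSym0 j) (continuous_solSym1 j) i

lemma contDiff_lameSol (hg : BandLimited g) (j : Fin (d + 1)) : ContDiff ℝ ∞ (lameSol lam mu g j) :=
  contDiff_pot hg (continuous_solSym0 j) (continuous_solSym1 j)

/-- The symbol of the stress of the explicit solution. -/
def stressSym (lam mu : ℝ) (G : Fin (d + 1) → Fin (d + 1) → E d → ℂ) (i j : Fin (d + 1)) (ξ : E d) : ℂ :=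
  (mu : ℂ) * (G i j ξ + G j i ξ) + ((if i = j then lam else 0 : ℝ) : ℂ) * ∑ l, G l l ξ

lemma continuous_stressSym {G : Fin (d + 1) → Fin (d + 1) → E d → ℂ}
    (hG : ∀ i j, Continuous (G i j)) (i j : Fin (d + 1)) : Continuous (stressSym lam mu G i j) := by
  have h1 := hG i j
  have h2 := hG j i
  have h3 : Continuous fun ξ => ∑ l, G l l ξ := continuous_finsetSum _ fun l _ => hG l l
  unfold stressSym; fun_prop

/-- The stress of the explicit solution. -/
def lameStress (lam mu : ℝ) (g : E d → ℂ) (i j : Fin (d + 1)) : E (d + 1) → ℝ :=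
  pot g (stressSym lam mu (gradSym0 lam mu) i j) (stressSym lam mu (gradSym1 lam mu) i j)

lemma lameStress_eq (hg : BandLimited g) (i j : Fin (d + 1)) (z : E (d + 1)) :
    lameStress lam mu g i j z = stress lam mu (fun i j => lameGrad lam mu g i j z) i j := by
  have c0 := fun i j => continuous_gradSym0 (d := d) (lam := lam) (mu := mu) i j
  have c1 := fun i j => continuous_gradSym1 (d := d) (lam := lam) (mu := mu) i j
  have s0 : Continuous fun ξ : E d => ∑ l, gradSym0 lam mu l l ξ :=
    continuous_finsetSum _ fun l _ => c0 l l
  have s1 : Continuous fun ξ : E d => ∑ l, gradSym1 lam mu l l ξ :=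
    continuous_finsetSum _ fun l _ => c1 l l
  have a0 : Continuous fun ξ : E d => (mu : ℂ) * (gradSym0 lam mu i j ξ + gradSym0 lam mu j i ξ) :=
    continuous_const.mul ((c0 i j).add (c0 j i))
  have a1 : Continuous fun ξ : E d => (mu : ℂ) * (gradSym1 lam mu i j ξ + gradSym1 lam mu j i ξ) :=
    continuous_const.mul ((c1 i j).add (c1 j i))
  have b0 : Continuous fun ξ : E d => ((if i = j then lam else 0 : ℝ) : ℂ) *
      ∑ l, gradSym0 lam mu l l ξ := continuous_const.mul s0
  have b1 : Continuous fun ξ : E d => ((if i = j then lam else 0 : ℝ) : ℂ) *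
      ∑ l, gradSym1 lam mu l l ξ := continuous_const.mul s1
  rw [lameStress]
  unfold stressSym
  rw [pot_add hg a0 a1 b0 b1, pot_const_mul, pot_const_mul,
    pot_add hg (c0 i j) (c1 i j) (c0 j i) (c1 j i),
    pot_sum hg _ (fun l => c0 l l) (fun l => c1 l l), stress]
  simp only [lameGrad]
  split_ifs <;> simp

lemma lameA_eq (hlam : 0 < lam) (hmu : 0 < mu) : lameA lam mu * (lam + 2 * mu) = -mu := by
  have : lam + 2 * mu ≠ 0 := by positivity
  rw [lameA, div_mul_cancel₀ _ this]

/-- Separates a full gradient from a purely normal correction, so that sums over the index can be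
evaluated with `sum_sym_mul_sym`. -/
lemma solSym0_eq (j : Fin (d + 1)) (ξ : E d) : solSym0 lam mu j ξ = -(lameA lam mu : ℂ) * sym j ξ -
    if j = Fin.last d then (1 - (lameA lam mu : ℂ)) * sym (Fin.last d) ξ else 0 := by
  unfold solSym0
  split_ifs with h
  · rw [h]; push_cast; ring
  · ring

/-- The divergence is `2a ∂ₙ²H`: the gradient part is divergence free because `H` is harmonic, and
the normal terms contribute `-(1 - a) + (1 + a)`. -/
lemma sum_gradSym0 (ξ : E d) : ∑ l, gradSym0 lam mu l l ξ =
    2 * (lameA lam mu : ℂ) * sym (Fin.last d) ξ ^ 2 := by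
  have e : ∀ l : Fin (d + 1), gradSym0 lam mu l l ξ = -(lameA lam mu : ℂ) * (sym l ξ * sym l ξ) +
      if l = Fin.last d then (2 * (lameA lam mu : ℂ)) * sym (Fin.last d) ξ ^ 2 else 0 := by
    intro l
    rw [gradSym0, solSym0_eq, solSym1]
    split_ifs with h
    · rw [h]; push_cast; ring
    · ring
  simp only [e, Finset.sum_add_distrib, ← Finset.mul_sum, sum_sym_mul_sym, Finset.sum_ite_eq',
    Finset.mem_univ, if_true]
  ring

lemma sum_gradSym1 (ξ : E d) : ∑ l, gradSym1 lam mu l l ξ = 0 := by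
  have e : ∀ l : Fin (d + 1), gradSym1 lam mu l l ξ =
      ((1 + lameA lam mu : ℝ) : ℂ) * sym (Fin.last d) ξ * (sym l ξ * sym l ξ) := by
    intro l; rw [gradSym1, solSym1]; ring
  simp only [e, ← Finset.mul_sum, sum_sym_mul_sym, mul_zero]

/-- The explicit solution solves the Lamé system. -/
lemma sum_pderiv_lameStress (hlam : 0 < lam) (hmu : 0 < mu) (hg : BandLimited g) (j : Fin (d + 1))
    (z : E (d + 1)) : ∑ i, pderiv i (lameStress lam mu g i j) z = 0 := by
  have c0 := fun i j => continuous_stressSym (lam := lam) (mu := mu)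
    (continuous_gradSym0 (d := d) (lam := lam) (mu := mu)) i j
  have c1 := fun i j => continuous_stressSym (lam := lam) (mu := mu)
    (continuous_gradSym1 (d := d) (lam := lam) (mu := mu)) i j
  have e : ∀ i, pderiv i (lameStress lam mu g i j) z = _ :=
    fun i => congrFun (pderiv_pot hg (c0 i j) (c1 i j) i) z
  have hs := fun i => continuous_sym (d := d) i
  have d0 : ∀ i, Continuous fun ξ : E d => sym i ξ * stressSym lam mu (gradSym0 lam mu) i j ξ +
      (if i = Fin.last d then 1 else 0) * stressSym lam mu (gradSym1 lam mu) i j ξ :=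
    fun i => ((hs i).mul (c0 i j)).add (continuous_const.mul (c1 i j))
  have d1 : ∀ i, Continuous fun ξ : E d => sym i ξ * stressSym lam mu (gradSym1 lam mu) i j ξ :=
    fun i => (hs i).mul (c1 i j)
  simp only [e]
  rw [← pot_sum hg _ d0 d1]
  have hA : (lameA lam mu : ℂ) * (lam + 2 * mu) = -mu := by
    exact_mod_cast lameA_eq hlam hmu
  have z0 : (fun ξ : E d => ∑ i, (sym i ξ * stressSym lam mu (gradSym0 lam mu) i j ξ +
      (if i = Fin.last d then 1 else 0) * stressSym lam mu (gradSym1 lam mu) i j ξ)) = fun _ => 0 := by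
    funext ξ
    set a : ℂ := (lameA lam mu : ℂ) with ha
    set s := sym (Fin.last d) ξ with hs
    -- Each summand is a multiple of `sym i ξ ^ 2`, which sums to zero, plus a term concentrated at
    -- the normal index, plus the gradient of `λ div` on the diagonal.
    have e1 : ∀ i, sym i ξ * stressSym lam mu (gradSym0 lam mu) i j ξ +
        (if i = Fin.last d then 1 else 0) * stressSym lam mu (gradSym1 lam mu) i j ξ =
        (sym i ξ * sym i ξ) * (mu * (-2 * a * sym j ξ -
          (if j = Fin.last d then (1 - a) * s - (1 + a) * s else 0))) +
        (if i = Fin.last d then (mu * (-(1 - a) + (1 + a) + 2 * (1 + a)) * s ^ 2 * sym j ξ) else 0) +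
        (if i = j then lam * (2 * a * s ^ 2) * sym j ξ else 0) := by
      intro i
      rw [stressSym, stressSym, sum_gradSym0, sum_gradSym1, gradSym0, gradSym0, gradSym1, gradSym1,
        solSym0_eq, solSym0_eq, solSym1, solSym1, ← ha, ← hs]
      push_cast
      rw [← ha]
      by_cases h1 : i = Fin.last d
      · subst h1
        by_cases h2 : j = Fin.last d
        · subst h2; simp only [if_true, ← hs]; ring
        · have h2' : ¬ Fin.last d = j := fun h => h2 h.symm
          simp only [h2, h2', if_true, if_false, ← hs]; push_cast; ring
      · by_cases h2 : j = Fin.last d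
        · subst h2; simp only [h1, if_true, if_false, ← hs]; push_cast; ring
        · by_cases h3 : i = j
          · subst h3; simp only [h1, if_true, if_false]; ring
          · simp only [h1, h2, h3, if_false]; push_cast; ring
    simp only [e1, Finset.sum_add_distrib, ← Finset.sum_mul, sum_sym_mul_sym, Finset.sum_ite_eq',
      Finset.mem_univ, if_true, zero_mul, zero_add]
    -- What survives is `2 s² sym j (μ + a(λ + 2μ))`, which vanishes by the choice of `a`.
    linear_combination 2 * s ^ 2 * sym j ξ * hA
  have z1 : (fun ξ : E d => ∑ i, sym i ξ * stressSym lam mu (gradSym1 lam mu) i j ξ) =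
      fun _ => 0 := by
    funext ξ
    have e1 : ∀ i, sym i ξ * stressSym lam mu (gradSym1 lam mu) i j ξ =
        (sym i ξ * sym i ξ) * (2 * mu * ((1 + lameA lam mu : ℝ) : ℂ) * sym (Fin.last d) ξ * sym j ξ) := by
      intro i
      rw [stressSym, sum_gradSym1, gradSym1, gradSym1, solSym1, solSym1]; ring
    simp only [e1, ← Finset.sum_mul, sum_sym_mul_sym, zero_mul]
  rw [z0, z1, pot_zero]

/-- At `xₙ = 0` the coefficients of the shear add up to `-a + (1 + a) - 1 = 0`; this dictates the
factor `1 + a` in front of `xₙ`. -/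
lemma lameStress_shear (i : Fin (d + 1)) (hi : i ≠ Fin.last d) (x : E d) :
    lameStress lam mu g (Fin.last d) i (consPoint x 0) = 0 := by
  rw [lameStress, pot, biharm_consPoint_zero]
  have : (fun ξ => stressSym lam mu (gradSym0 lam mu) (Fin.last d) i ξ * g ξ) = fun _ => 0 := by
    funext ξ
    have hi' : ¬ Fin.last d = i := fun h => hi h.symm
    rw [stressSym, gradSym0, gradSym0, solSym0_eq, solSym0_eq, solSym1, solSym1]
    simp only [hi, hi', if_true, if_false]
    push_cast; ring
  rw [this]
  simp [harm, charm]

/-- The coefficient `2μ(λ + μ) / (λ + 2μ)` in the Dirichlet to Neumann map. -/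
def lameC (lam mu : ℝ) : ℝ := -(2 * lameA lam mu * (lam + mu))

lemma lameC_pos (hlam : 0 < lam) (hmu : 0 < mu) : 0 < lameC lam mu := by
  have : lameA lam mu < 0 := by
    rw [lameA]; exact div_neg_of_neg_of_pos (by linarith) (by positivity)
  rw [lameC]; nlinarith

/-- At `xₙ = 0` the normal stress has symbol `2μa k² + 2λa k² = -c k²` with `k = 2π|ξ|`. Since the
normal displacement has density `k g`, this is the Dirichlet-to-Neumann relation with factor `-c k`.
-/
lemma lameStress_normal (hlam : 0 < lam) (hmu : 0 < mu) (x : E d) :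
    lameStress lam mu g (Fin.last d) (Fin.last d) (consPoint x 0) =
      -lameC lam mu * harm (fun ξ => ((2 * Real.pi * ‖ξ‖ : ℝ) : ℂ) ^ 2 * g ξ) (consPoint x 0) := by
  rw [lameStress, pot, biharm_consPoint_zero, ← harm_const_mul]
  congr 1
  funext ξ
  have hA : (lameA lam mu : ℂ) * (lam + 2 * mu) = -mu := by
    exact_mod_cast lameA_eq hlam hmu
  rw [stressSym, sum_gradSym0, gradSym0, solSym0_eq, solSym1, lameC, sym_last]
  simp only [if_true]
  push_cast
  ring

lemma memLp_harm_slice (hm : BandLimited m) (t : ℝ) : MemLp (fun x => harm m (consPoint x t)) 2 := by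
  refine memLp_two_of_lintegral
    ((hm.contDiff_harm.continuous.comp (continuous_consPoint_left t)).aestronglyMeasurable) ?_
  have h := hm.exp_mul t
  refine (lintegral_harm_slice_le hm t).trans_lt ?_
  have h2 := lintegral_sq_lt_top h.memLp
  refine lt_of_eq_of_lt (lintegral_congr fun ξ => ?_) h2
  rw [← ofReal_norm, ← ENNReal.ofReal_pow (norm_nonneg _), norm_mul, mul_pow,
    Complex.norm_real, Real.norm_of_nonneg (by positivity), ← Real.exp_nat_mul]
  congr 3
  push_cast; ring

lemma harm_consPoint_zero (m : E d → ℂ) (x : E d) :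
    harm m (consPoint x 0) = ((FourierTransformInv.fourierInv m : E d → ℂ) x).re := by
  rw [harm_consPoint]; simp

/-- Green's formula for the explicit solution. -/
lemma integral_lameDens_lameGrad (hlam : 0 < lam) (hmu : 0 < mu) (hg : BandLimited g)
    {f : E (d + 1) → E (d + 1)} {F : Fin (d + 1) → Fin (d + 1) → E (d + 1) → ℝ} {τ : E d → ℝ}
    (hf : ∀ i j, IsWeakPartial (halfSpace d) i (fun z => f z j) (F i j))
    (hF : ∀ i j, MemLp (F i j) 2 (volume.restrict (halfSpace d)))
    (hsub : ∀ j, SubexpL2 (fun z => f z j))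
    (hτ : HasFlatTrace Set.univ (fun z => f z (Fin.last d)) τ) :
    ∫ z in halfSpace d, lameDens lam mu (fun i j => lameGrad lam mu g i j z) (fun i j => F i j z) =
      lameC lam mu * ∫ ξ, (2 * Real.pi * ‖ξ‖) ^ 2 * (g ξ * (starRingEnd ℂ) (l2Fourier τ ξ)).re := by
  have c0 := fun i j => continuous_stressSym (lam := lam) (mu := mu)
    (continuous_gradSym0 (d := d) (lam := lam) (mu := mu)) i j
  have c1 := fun i j => continuous_stressSym (lam := lam) (mu := mu)
    (continuous_gradSym1 (d := d) (lam := lam) (mu := mu)) i j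
  set S := lameStress lam mu g with hS
  have hSs : ∀ i j, ContDiff ℝ ∞ (S i j) := fun i j => contDiff_pot hg (c0 i j) (c1 i j)
  have hSd : ∀ i j, ExpDecayL2 (S i j) := fun i j => expDecayL2_pot hg (c0 i j) (c1 i j)
  have hSd' : ∀ i j, ExpDecayL2 (pderiv i (S i j)) := by
    intro i j
    have e : pderiv i (S i j) = _ := pderiv_pot hg (c0 i j) (c1 i j) i
    rw [e]
    exact expDecayL2_pot hg (((continuous_sym i).mul (c0 i j)).add (continuous_const.mul (c1 i j)))
      ((continuous_sym i).mul (c1 i j))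
  have i0 : ∀ i j, IntegrableOn (fun z => f z j * S i j z) (halfSpace d) :=
    fun i j => (hsub j).integrableOn_mul (hSd i j)
  have i1 : ∀ i j, IntegrableOn (fun z => f z j * pderiv i (S i j) z) (halfSpace d) :=
    fun i j => (hsub j).integrableOn_mul (hSd' i j)
  have i2 : ∀ i j, IntegrableOn (fun z => F i j z * S i j z) (halfSpace d) :=
    fun i j => (subexpL2_of_memLp (hF i j)).integrableOn_mul (hSd i j)
  have hτ2 : MemLp τ 2 := ((hasFlatTrace_univ_iff (hf _ _)).1 hτ).1
  set h : E d → ℂ := fun ξ => ((2 * Real.pi * ‖ξ‖ : ℝ) : ℂ) ^ 2 * g ξ with hh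
  have hhb : BandLimited h := hg.mul (by fun_prop)
  have hSn : ∀ x, S (Fin.last d) (Fin.last d) (consPoint x 0) =
      -lameC lam mu * harm h (consPoint x 0) := fun x => lameStress_normal hlam hmu x
  -- Integrate by parts entry by entry. Tangential derivatives produce no boundary term, the shear
  -- entries of the stress vanish on the boundary, and only the entry with both indices normal
  -- contributes.
  have hterm : ∀ i j, ∫ z in halfSpace d, S i j z * F i j z =
      -(∫ z in halfSpace d, f z j * pderiv i (S i j) z) +
        if i = Fin.last d then if j = Fin.last d then
          lameC lam mu * ∫ x, harm h (consPoint x 0) * τ x else 0 else 0 := by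
    intro i j
    have e0 : ∫ z in halfSpace d, (f z j * pderiv i (S i j) z + F i j z * S i j z) =
        if i = Fin.last d then if j = Fin.last d then
          lameC lam mu * ∫ x, harm h (consPoint x 0) * τ x else 0 else 0 := by
      by_cases h1 : i = Fin.last d
      · subst h1
        by_cases h2 : j = Fin.last d
        · subst h2
          have i3 : Integrable fun x => τ x * S (Fin.last d) (Fin.last d) (consPoint x 0) := by
            simp only [hSn]
            exact hτ2.integrable_mul ((memLp_harm_slice hhb 0).const_mul _)
          rw [hτ.integral_eq_of_integrable (hf _ _) (hSs _ _) (i0 _ _) (i1 _ _) (i2 _ _) i3]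
          simp only [if_true, hSn]
          rw [← integral_neg, ← integral_const_mul]
          congr 1; ext x; ring
        · simp only [h2, if_true, if_false]
          exact (hf _ j).integral_eq_zero_of_integrable (hsub j).integrableUpToBoundary
            (integrableUpToBoundary_of_memLp (hF _ j)) (hSs _ j)
            (Or.inr fun x => lameStress_shear j h2 x) (i0 _ _) (i1 _ _) (i2 _ _)
      · simp only [h1, if_false]
        exact (hf i j).integral_eq_zero_of_integrable (hsub j).integrableUpToBoundary
          (integrableUpToBoundary_of_memLp (hF _ j)) (hSs _ j) (Or.inl h1) (i0 _ _) (i1 _ _) (i2 _ _)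
    rw [integral_add (i1 i j) (i2 i j)] at e0
    have e1 : ∀ z, S i j z * F i j z = F i j z * S i j z := fun z => mul_comm _ _
    simp only [e1]
    linarith
  have hdens : ∀ z, lameDens lam mu (fun i j => lameGrad lam mu g i j z) (fun i j => F i j z) =
      ∑ j, ∑ i, S i j z * F i j z := by
    intro z
    rw [lameDens_eq_sum_stress]
    refine Finset.sum_congr rfl fun j _ => Finset.sum_congr rfl fun i _ => ?_
    rw [hS, lameStress_eq hg]
  have i2' : ∀ i j, IntegrableOn (fun z => S i j z * F i j z) (halfSpace d) := fun i j => by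
    simpa only [mul_comm] using i2 i j
  simp only [hdens]
  rw [integral_finsetSum _ fun j _ => integrable_finsetSum _ fun i _ => i2' i j]
  have e2 : ∀ j, ∫ z in halfSpace d, ∑ i, S i j z * F i j z =
      if j = Fin.last d then lameC lam mu * ∫ x, harm h (consPoint x 0) * τ x else 0 := by
    intro j
    rw [integral_finsetSum _ fun i _ => i2' i j]
    simp only [hterm, Finset.sum_add_distrib, Finset.sum_neg_distrib, Finset.sum_ite_eq',
      Finset.mem_univ, if_true]
    rw [← integral_finsetSum _ fun i _ => i1 i j]
    -- The bulk terms of a column add up to `f z j` times the divergence of the stress, which is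
    -- zero.
    have : ∀ z, ∑ i, f z j * pderiv i (S i j) z = 0 := by
      intro z
      rw [← Finset.mul_sum, hS, sum_pderiv_lameStress hlam hmu hg, mul_zero]
    simp [this]
  simp only [e2, Finset.sum_ite_eq', Finset.mem_univ, if_true]
  congr 1
  simp only [harm_consPoint_zero]
  rw [integral_re_fourierInv_mul hhb.memLp hhb.integrable (memLp_toC hτ2)]
  congr 1; ext ξ
  simp only [hh]
  rw [mul_assoc, ← Complex.ofReal_pow, Complex.re_ofReal_mul]

end potential

/-! ### Energy estimates for the explicit solution -/

section estimates

variable {d : ℕ} {g g' : E d → ℂ} {lam mu : ℝ}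

/-- A bound for the symbols of the explicit solution and its gradient. -/
def symBound (lam mu : ℝ) : ℝ := 2 * (1 + |lameA lam mu|)

lemma symBound_nonneg : 0 ≤ symBound lam mu := by unfold symBound; positivity

lemma norm_solSym0_le (j : Fin (d + 1)) (ξ : E d) :
    ‖solSym0 lam mu j ξ‖ ≤ (1 + |lameA lam mu|) * (2 * Real.pi * ‖ξ‖) := by
  rw [solSym0, norm_mul, norm_neg, Complex.norm_real]
  gcongr
  · split_ifs
    · simp
    · simp
  · exact norm_sym_le j ξ

lemma norm_solSym1_le (j : Fin (d + 1)) (ξ : E d) :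
    ‖solSym1 lam mu j ξ‖ ≤ (1 + |lameA lam mu|) * (2 * Real.pi * ‖ξ‖) ^ 2 := by
  rw [solSym1, norm_mul, Complex.norm_real, norm_mul, sq]
  gcongr
  · exact (abs_add_le _ _).trans (by simp)
  · exact norm_sym_le _ ξ
  · exact norm_sym_le j ξ

lemma norm_gradSym0_le (i j : Fin (d + 1)) (ξ : E d) :
    ‖gradSym0 lam mu i j ξ‖ ≤ symBound lam mu * (2 * Real.pi * ‖ξ‖) ^ 2 := by
  have h1 : ‖sym i ξ * solSym0 lam mu j ξ‖ ≤
      (2 * Real.pi * ‖ξ‖) * ((1 + |lameA lam mu|) * (2 * Real.pi * ‖ξ‖)) := by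
    rw [norm_mul]
    gcongr
    · exact norm_sym_le i ξ
    · exact norm_solSym0_le j ξ
  have h2 : ‖(if i = Fin.last d then (1 : ℂ) else 0) * solSym1 lam mu j ξ‖ ≤
      1 * ((1 + |lameA lam mu|) * (2 * Real.pi * ‖ξ‖) ^ 2) := by
    rw [norm_mul]
    gcongr
    · split_ifs <;> simp
    · exact norm_solSym1_le j ξ
  rw [gradSym0, symBound]
  refine (norm_add_le _ _).trans ((add_le_add h1 h2).trans (le_of_eq ?_))
  ring

lemma norm_gradSym1_le (i j : Fin (d + 1)) (ξ : E d) :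
    ‖gradSym1 lam mu i j ξ‖ ≤ symBound lam mu * (2 * Real.pi * ‖ξ‖) ^ 3 := by
  rw [gradSym1, norm_mul]
  calc _ ≤ (2 * Real.pi * ‖ξ‖) * ((1 + |lameA lam mu|) * (2 * Real.pi * ‖ξ‖) ^ 2) := by
        gcongr
        · exact norm_sym_le i ξ
        · exact norm_solSym1_le j ξ
    _ = (1 + |lameA lam mu|) * (2 * Real.pi * ‖ξ‖) ^ 3 := by ring
    _ ≤ _ := by
        gcongr
        rw [symBound]
        linarith [abs_nonneg (lameA lam mu)]

/-- The squared `L²` norm of the boundary value `2π|ξ| g` of the explicit solution. -/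
def massL2 (g : E d → ℂ) : ℝ≥0∞ := ∫⁻ ξ, ENNReal.ofReal ((2 * Real.pi * ‖ξ‖) ^ 2 * ‖g ξ‖ ^ 2)

/-- The squared `Ḣ^{1/2}` norm of the boundary value `2π|ξ| g` of the explicit solution. -/
def massHHalf (g : E d → ℂ) : ℝ≥0∞ := ∫⁻ ξ, ENNReal.ofReal ((2 * Real.pi * ‖ξ‖) ^ 3 * ‖g ξ‖ ^ 2)

lemma lintegral_ofReal_const_mul {α : Type*} [MeasurableSpace α] {μ : Measure α} {c : ℝ} (hc : 0 ≤ c)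
    (f : α → ℝ) :
    ∫⁻ x, ENNReal.ofReal (c * f x) ∂μ = ENNReal.ofReal c * ∫⁻ x, ENNReal.ofReal (f x) ∂μ := by
  rw [← lintegral_const_mul' _ _ ENNReal.ofReal_ne_top]
  exact lintegral_congr fun x => ENNReal.ofReal_mul hc

/-- The exponential factor is simply dropped, so the bound is uniform in the height but gives no
decay: low frequencies may spoil square integrability in `xₙ` when the band is removed. This is why
the approximations are cut off vertically. -/
lemma lintegral_lameSol_slice_le (hg : BandLimited g) (j : Fin (d + 1)) {t : ℝ} (ht : 0 ≤ t) :
    ∫⁻ x, ‖lameSol lam mu g j (consPoint x t)‖ₑ ^ 2 ≤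
      ENNReal.ofReal (6 * symBound lam mu ^ 2) * massL2 g := by
  have hK := symBound_nonneg (lam := lam) (mu := mu)
  have hK1 : 1 + |lameA lam mu| ≤ symBound lam mu := by
    rw [symBound]; linarith [abs_nonneg (lameA lam mu)]
  refine (lintegral_biharm_slice_le (hg.mul (continuous_solSym0 j)) (hg.mul (continuous_solSym1 j))
    (n := fun ξ => symBound lam mu ^ 2 * (2 * Real.pi * ‖ξ‖ * ‖g ξ‖ ^ 2)) (fun ξ => ?_)
    (fun ξ => ?_) ht).trans ?_
  · have h := norm_solSym0_le (lam := lam) (mu := mu) j ξ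
    rw [norm_mul, mul_pow]
    calc _ ≤ (symBound lam mu * (2 * Real.pi * ‖ξ‖)) ^ 2 * ‖g ξ‖ ^ 2 := by
          gcongr
          exact h.trans (by gcongr)
      _ = _ := by ring
  · have h := norm_solSym1_le (lam := lam) (mu := mu) j ξ
    rw [norm_mul, mul_pow]
    calc _ ≤ (symBound lam mu * (2 * Real.pi * ‖ξ‖) ^ 2) ^ 2 * ‖g ξ‖ ^ 2 := by
          gcongr
          exact h.trans (by gcongr)
      _ = _ := by ring
  · rw [massL2, ← lintegral_ofReal_const_mul (by positivity)]
    refine lintegral_mono fun ξ => ENNReal.ofReal_le_ofReal ?_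
    have he : Real.exp (-(2 * Real.pi * ‖ξ‖ * t)) ≤ 1 := Real.exp_le_one_iff.2 (by
      simp only [Left.neg_nonpos_iff]; positivity)
    calc _ ≤ 6 * (1 * (2 * Real.pi * ‖ξ‖ * (symBound lam mu ^ 2 *
          (2 * Real.pi * ‖ξ‖ * ‖g ξ‖ ^ 2)))) := by gcongr
      _ = _ := by ring

/-- The constant is independent of the frequency band of `g`, which is what survives the passage to
general traces. -/
lemma lintegral_lameGrad_le (hg : BandLimited g) (i j : Fin (d + 1)) :
    ∫⁻ z in halfSpace d, ‖lameGrad lam mu g i j z‖ₑ ^ 2 ≤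
      ENNReal.ofReal (6 * symBound lam mu ^ 2) * massHHalf g := by
  have hK := symBound_nonneg (lam := lam) (mu := mu)
  have hc : Continuous fun ξ : E d => (2 * Real.pi * ‖ξ‖) ^ 3 := by fun_prop
  refine (lintegral_biharm_halfSpace_le (hg.mul (continuous_gradSym0 i j))
    (hg.mul (continuous_gradSym1 i j))
    (n := fun ξ => symBound lam mu ^ 2 * ((2 * Real.pi * ‖ξ‖) ^ 3 * ‖g ξ‖ ^ 2)) ?_
    (fun ξ => by positivity) (fun ξ => ?_) (fun ξ => ?_)).trans ?_
  · exact (hc.aemeasurable.mul (hg.memLp.1.norm.aemeasurable.pow_const 2)).const_mul _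
  · have h := norm_gradSym0_le (lam := lam) (mu := mu) i j ξ
    rw [norm_mul, mul_pow]
    calc _ ≤ (symBound lam mu * (2 * Real.pi * ‖ξ‖) ^ 2) ^ 2 * ‖g ξ‖ ^ 2 := by gcongr
      _ = _ := by ring
  · have h := norm_gradSym1_le (lam := lam) (mu := mu) i j ξ
    rw [norm_mul, mul_pow]
    calc _ ≤ (symBound lam mu * (2 * Real.pi * ‖ξ‖) ^ 3) ^ 2 * ‖g ξ‖ ^ 2 := by gcongr
      _ = _ := by ring
  · rw [massHHalf, ← lintegral_ofReal_const_mul (by positivity)]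
    refine lintegral_mono fun ξ => ENNReal.ofReal_le_ofReal (le_of_eq (by ring))

lemma isWeakPartial_of_contDiff {Ω : Set (E (d + 1))} (hΩ : IsOpen Ω) {f : E (d + 1) → ℝ}
    (hf : ContDiff ℝ ∞ f) (i : Fin (d + 1)) : IsWeakPartial Ω i f (pderiv i f) :=
  isWeakPartial_of_contDiffOn hΩ hf.contDiffOn i

lemma memLp_lameSol (hg : BandLimited g) (j : Fin (d + 1)) :
    MemLp (lameSol lam mu g j) 2 (volume.restrict (halfSpace d)) :=
  (expDecayL2_pot hg (continuous_solSym0 j) (continuous_solSym1 j)).memLp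

lemma memLp_lameGrad (hg : BandLimited g) (i j : Fin (d + 1)) :
    MemLp (lameGrad lam mu g i j) 2 (volume.restrict (halfSpace d)) :=
  (expDecayL2_pot hg (continuous_gradSym0 i j) (continuous_gradSym1 i j)).memLp

lemma lameSol_consPoint_zero (x : E d) : lameSol lam mu g (Fin.last d) (consPoint x 0) =
    harm (fun ξ => ((2 * Real.pi * ‖ξ‖ : ℝ) : ℂ) * g ξ) (consPoint x 0) := by
  rw [lameSol, pot, biharm_consPoint_zero]
  congr 1
  funext ξ
  rw [solSym0, sym_last]; simp

lemma hasFlatTrace_lameSol (hg : BandLimited g) :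
    HasFlatTrace Set.univ (lameSol lam mu g (Fin.last d))
      (fun x => harm (fun ξ => ((2 * Real.pi * ‖ξ‖ : ℝ) : ℂ) * g ξ) (consPoint x 0)) := by
  have h := hasFlatTrace_of_contDiff (contDiff_lameSol (lam := lam) (mu := mu) hg (Fin.last d)) (by
    simp only [lameSol_consPoint_zero]
    exact memLp_harm_slice (hg.mul (by fun_prop)) 0)
  simpa only [lameSol_consPoint_zero] using h

/-- The normal component of the explicit solution, cut off in the vertical direction. -/
def cutSol (lam mu : ℝ) (g : E d → ℂ) (z : E (d + 1)) : ℝ :=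
  vertCut d z * lameSol lam mu g (Fin.last d) z

/-- The gradient of `cutSol`. -/
def cutGrad (lam mu : ℝ) (g : E d → ℂ) (i : Fin (d + 1)) (z : E (d + 1)) : ℝ :=
  vertCut d z * lameGrad lam mu g i (Fin.last d) z +
    pderiv i (vertCut d) z * lameSol lam mu g (Fin.last d) z

lemma contDiff_cutSol (hg : BandLimited g) : ContDiff ℝ ∞ (cutSol lam mu g) :=
  (contDiff_vertCut d).mul (contDiff_lameSol hg _)

lemma pderiv_cutSol (hg : BandLimited g) (i : Fin (d + 1)) :
    pderiv i (cutSol lam mu g) = cutGrad lam mu g i := by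
  funext z
  have e : cutSol lam mu g = fun z => vertCut d z * lameSol lam mu g (Fin.last d) z := rfl
  rw [e, pderiv_mul ((contDiff_vertCut d).differentiable (by simp) z)
    ((contDiff_lameSol hg _).differentiable (by simp) z), pderiv_lameSol hg, cutGrad]

/-- Integrate the uniform slice bound over a strip of thickness `2`; hence `12 = 2 · 6`. -/
lemma lintegral_strip_lameSol_le (hg : BandLimited g) {χ : E (d + 1) → ℝ} {M : ℝ}
    (hM : ∀ z, |χ z| ≤ M) (hχ : ∀ z : E (d + 1), 2 < z (Fin.last d) → χ z = 0)
    (hχc : Continuous χ) :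
    ∫⁻ z in halfSpace d, ‖χ z * lameSol lam mu g (Fin.last d) z‖ₑ ^ 2 ≤
      ENNReal.ofReal (12 * M ^ 2 * symBound lam mu ^ 2) * massL2 g := by
  have hm : AEMeasurable (fun z => ‖χ z * lameSol lam mu g (Fin.last d) z‖ₑ ^ 2)
      (volume.restrict {z : E (d + 1) | z (Fin.last d) ∈ Set.Ioi 0}) :=
    (hχc.mul (contDiff_lameSol hg _).continuous).aestronglyMeasurable.enorm.pow_const 2
  rw [halfSpace_eq_slab, lintegral_slab measurableSet_Ioi hm]
  calc _ ≤ ∫⁻ t in Set.Ioi (0 : ℝ), (Set.Ioc (0 : ℝ) 2).indicator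
        (fun _ => ENNReal.ofReal (M ^ 2) * (ENNReal.ofReal (6 * symBound lam mu ^ 2) * massL2 g)) t := by
        refine setLIntegral_mono' measurableSet_Ioi fun t ht => ?_
        by_cases h2 : t ≤ 2
        · rw [Set.indicator_of_mem (show t ∈ Set.Ioc (0 : ℝ) 2 from ⟨ht, h2⟩)]
          calc _ ≤ ∫⁻ x : E d, ENNReal.ofReal (M ^ 2) *
                ‖lameSol lam mu g (Fin.last d) (consPoint x t)‖ₑ ^ 2 := by
                refine lintegral_mono fun x => ?_
                rw [enorm_mul, mul_pow]
                gcongr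
                rw [← ofReal_norm, ← ENNReal.ofReal_pow (norm_nonneg _)]
                refine ENNReal.ofReal_le_ofReal ?_
                have := hM (consPoint x t)
                rw [← Real.norm_eq_abs] at this
                gcongr
            _ ≤ _ := by
                rw [lintegral_const_mul' _ _ ENNReal.ofReal_ne_top]
                exact mul_le_mul_right (lintegral_lameSol_slice_le hg _ (le_of_lt ht)) _
        · have : ∀ x : E d, χ (consPoint x t) = 0 := fun x => hχ _ (by simpa using not_le.1 h2)
          simp [this]
    _ = ENNReal.ofReal (M ^ 2) * (ENNReal.ofReal (6 * symBound lam mu ^ 2) * massL2 g) *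
          ENNReal.ofReal 2 := by
        rw [setLIntegral_indicator measurableSet_Ioc, setLIntegral_const,
          Set.inter_eq_self_of_subset_left Set.Ioc_subset_Ioi_self, Real.volume_Ioc, sub_zero]
    _ = _ := by
        rw [← mul_assoc, ← ENNReal.ofReal_mul (by positivity), mul_right_comm,
          ← ENNReal.ofReal_mul (by positivity)]
        congr 2; ring

/-- `H¹` estimates for `cutSol`. -/
lemma exists_bound_cutSol (d : ℕ) (lam mu : ℝ) : ∃ C : ℝ≥0∞, C ≠ ⊤ ∧ ∀ g : E d → ℂ, BandLimited g →
    (∫⁻ z in halfSpace d, ‖cutSol lam mu g z‖ₑ ^ 2 ≤ C * (massL2 g + massHHalf g)) ∧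
    ∀ i, ∫⁻ z in halfSpace d, ‖cutGrad lam mu g i z‖ₑ ^ 2 ≤ C * (massL2 g + massHHalf g) := by
  obtain ⟨M, hM0, hM⟩ := exists_bound_deriv_vertBump
  have hcut0 : ∀ z : E (d + 1), 2 < z (Fin.last d) → vertCut d z = 0 := fun z hz => by
    simp [vertCut, vertBump_eq_zero hz.le]
  set K := symBound lam mu
  set C1 : ℝ≥0∞ := ENNReal.ofReal (12 * 1 ^ 2 * K ^ 2) with hC1
  set C2 : ℝ≥0∞ := ENNReal.ofReal (12 * M ^ 2 * K ^ 2) with hC2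
  set C3 : ℝ≥0∞ := ENNReal.ofReal (6 * K ^ 2) with hC3
  -- `C1` controls the function itself; `C3` and `C2` control the two terms of the product rule.
  refine ⟨C1 + (2 * C3 + 2 * C2), by finiteness, fun g hg => ?_⟩
  have b1 := lintegral_strip_lameSol_le (lam := lam) (mu := mu) hg
    (fun z => abs_vertCut_le z) hcut0 (contDiff_vertCut d).continuous
  refine ⟨b1.trans ?_, fun i => ?_⟩
  · gcongr
    · exact le_self_add
    · exact le_self_add
  · have hM' : ∀ z, |pderiv i (vertCut d) z| ≤ M := fun z => by
      rw [pderiv_vertCut]; split_ifs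
      · exact hM _
      · simpa using hM0
    have b2 := lintegral_strip_lameSol_le (lam := lam) (mu := mu) hg hM' (fun z hz => by
      rw [pderiv_vertCut, deriv_vertBump_eq_zero hz]; simp) ((contDiff_vertCut d).pderiv i).continuous
    have b3 := lintegral_lameGrad_le (lam := lam) (mu := mu) hg i (Fin.last d)
    calc _ ≤ ∫⁻ z in halfSpace d, (2 * ‖lameGrad lam mu g i (Fin.last d) z‖ₑ ^ 2 +
          2 * ‖pderiv i (vertCut d) z * lameSol lam mu g (Fin.last d) z‖ₑ ^ 2) := by
          refine lintegral_mono fun z => ?_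
          refine (enorm_add_sq_le _ _).trans ?_
          gcongr
          rw [enorm_mul]
          refine mul_le_of_le_one_left (by simp) ?_
          rw [← ofReal_norm, ENNReal.ofReal_le_one]
          exact abs_vertCut_le z
      _ ≤ 2 * (C3 * massHHalf g) + 2 * (C2 * massL2 g) := by
          rw [lintegral_add_left', lintegral_const_mul' _ _ (by norm_num),
            lintegral_const_mul' _ _ (by norm_num)]
          · exact add_le_add (mul_le_mul_right b3 2) (mul_le_mul_right b2 2)
          · exact ((memLp_lameGrad hg _ _).1.enorm.pow_const 2).const_mul 2
      _ ≤ 2 * (C3 * (massL2 g + massHHalf g)) + 2 * (C2 * (massL2 g + massHHalf g)) := by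
          gcongr
          · exact le_add_self
          · exact le_self_add
      _ = (2 * C3 + 2 * C2) * (massL2 g + massHHalf g) := by ring
      _ ≤ _ := mul_le_mul' le_add_self le_rfl

lemma BandLimited.sub (hg : BandLimited g) (hg' : BandLimited g') :
    BandLimited (fun ξ => g ξ - g' ξ) := by
  have := hg.add (hg'.mul (p := fun _ => -1) continuous_const)
  simpa [sub_eq_add_neg] using this

lemma pot_sub_left {p0 p1 : E d → ℂ} (hg : BandLimited g) (hg' : BandLimited g')
    (h0 : Continuous p0) (h1 : Continuous p1) (z : E (d + 1)) :
    pot (fun ξ => g ξ - g' ξ) p0 p1 z = pot g p0 p1 z - pot g' p0 p1 z := by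
  have hs := hg.sub hg'
  have h := biharm_add (hs.mul h0) (hs.mul h1) (hg'.mul h0) (hg'.mul h1) z
  simp only [← mul_add, sub_add_cancel] at h
  simp only [pot]
  rw [h]; ring

lemma cutSol_sub (hg : BandLimited g) (hg' : BandLimited g') (z : E (d + 1)) :
    cutSol lam mu (fun ξ => g ξ - g' ξ) z = cutSol lam mu g z - cutSol lam mu g' z := by
  simp only [cutSol, lameSol]
  rw [pot_sub_left hg hg' (continuous_solSym0 _) (continuous_solSym1 _)]; ring

lemma cutGrad_sub (hg : BandLimited g) (hg' : BandLimited g') (i : Fin (d + 1)) (z : E (d + 1)) :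
    cutGrad lam mu (fun ξ => g ξ - g' ξ) i z = cutGrad lam mu g i z - cutGrad lam mu g' i z := by
  simp only [cutGrad, lameSol, lameGrad]
  rw [pot_sub_left hg hg' (continuous_solSym0 _) (continuous_solSym1 _),
    pot_sub_left hg hg' (continuous_gradSym0 _ _) (continuous_gradSym1 _ _)]; ring

end estimates

/-! ### Band limited approximation -/

section bandPart

variable {d : ℕ} {φ : E d → ℝ} {lam mu : ℝ}

/-- The annuli `1 / (N + 1) ≤ |ξ| ≤ N + 1`. -/
def annulus (d N : ℕ) : Set (E d) := {ξ | 1 / ((N : ℝ) + 1) ≤ ‖ξ‖ ∧ ‖ξ‖ ≤ N + 1}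

lemma measurableSet_annulus (d N : ℕ) : MeasurableSet (annulus d N) :=
  (measurableSet_le measurable_const measurable_norm).inter
    (measurableSet_le measurable_norm measurable_const)

lemma annulus_mono (d : ℕ) : Monotone (annulus d) := by
  intro N M h ξ hξ
  have h' : (N : ℝ) ≤ M := by exact_mod_cast h
  exact ⟨(one_div_le_one_div_of_le (by positivity) (by linarith)).trans hξ.1, hξ.2.trans (by linarith)⟩

lemma eventually_mem_annulus {ξ : E d} (hξ : ξ ≠ 0) : ∀ᶠ N in atTop, ξ ∈ annulus d N := by
  have h1 : Tendsto (fun N : ℕ => 1 / ((N : ℝ) + 1)) atTop (𝓝 0) :=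
    tendsto_one_div_add_atTop_nhds_zero_nat
  have h2 : Tendsto (fun N : ℕ => (N : ℝ) + 1) atTop atTop :=
    tendsto_atTop_add_const_right _ _ tendsto_natCast_atTop_atTop
  filter_upwards [h1.eventually_le_const (norm_pos_iff.2 hξ), h2.eventually_ge_atTop ‖ξ‖] with N a b
  exact ⟨a, b⟩

/-- The part of `φ̂ / (2π|ξ|)` in an annulus. -/
def bandPart (φ : E d → ℝ) (N : ℕ) (ξ : E d) : ℂ :=
  (annulus d N).indicator (fun ξ => ((2 * Real.pi * ‖ξ‖ : ℝ) : ℂ)⁻¹ * l2Fourier φ ξ) ξ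

lemma annulus_pos {N : ℕ} {ξ : E d} (h : ξ ∈ annulus d N) : 0 < 2 * Real.pi * ‖ξ‖ := by
  have : 0 < ‖ξ‖ := lt_of_lt_of_le (by positivity) h.1
  positivity

lemma bandLimited_bandPart (hφ : MemLp (toC φ) 2) (N : ℕ) : BandLimited (bandPart φ N) := by
  have hm : Measurable fun ξ : E d => ((2 * Real.pi * ‖ξ‖ : ℝ) : ℂ)⁻¹ :=
    (by fun_prop : Measurable fun ξ : E d => ((2 * Real.pi * ‖ξ‖ : ℝ) : ℂ)).inv
  have hl := memLp_l2Fourier hφ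
  refine ⟨?_, 1 / ((N : ℝ) + 1), N + 1, by positivity, fun ξ hξ => ?_⟩
  · refine hl.of_le_mul (c := (N : ℝ) + 1)
      ((hm.aestronglyMeasurable.mul hl.1).indicator (measurableSet_annulus d N))
      (Eventually.of_forall fun ξ => ?_)
    by_cases h : ξ ∈ annulus d N
    · rw [bandPart, Set.indicator_of_mem h, norm_mul, norm_inv, Complex.norm_real,
        Real.norm_of_nonneg (annulus_pos h).le]
      gcongr
      rw [inv_le_comm₀ (annulus_pos h) (by positivity), ← one_div]
      refine h.1.trans ?_
      nlinarith [Real.pi_gt_three, norm_nonneg ξ]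
    · rw [bandPart, Set.indicator_of_notMem h, norm_zero]; positivity
  · by_contra h
    exact hξ (Set.indicator_of_notMem (s := annulus d N) (fun h' => h h') _)

lemma mul_bandPart (φ : E d → ℝ) (N : ℕ) (ξ : E d) :
    ((2 * Real.pi * ‖ξ‖ : ℝ) : ℂ) * bandPart φ N ξ = (annulus d N).indicator (l2Fourier φ) ξ := by
  by_cases h : ξ ∈ annulus d N
  · rw [bandPart, Set.indicator_of_mem h, Set.indicator_of_mem h, ← mul_assoc, mul_inv_cancel₀,
      one_mul]
    exact_mod_cast (annulus_pos h).ne'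
  · rw [bandPart, Set.indicator_of_notMem h, Set.indicator_of_notMem h, mul_zero]

lemma mul_norm_bandPart (φ : E d → ℝ) (N : ℕ) (ξ : E d) :
    (2 * Real.pi * ‖ξ‖) * ‖bandPart φ N ξ‖ = (annulus d N).indicator (fun ξ => ‖l2Fourier φ ξ‖) ξ := by
  have h := congrArg norm (mul_bandPart φ N ξ)
  rw [norm_mul, Complex.norm_real, Real.norm_of_nonneg (by positivity)] at h
  rw [h, norm_indicator_eq_indicator_norm]

lemma sq_mul_bandPart_re (φ u : E d → ℝ) (N : ℕ) (ξ : E d) :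
    (2 * Real.pi * ‖ξ‖) ^ 2 * (bandPart φ N ξ * (starRingEnd ℂ) (l2Fourier u ξ)).re =
      (annulus d N).indicator
        (fun ξ => 2 * Real.pi * ‖ξ‖ * (l2Fourier φ ξ * (starRingEnd ℂ) (l2Fourier u ξ)).re) ξ := by
  have h := mul_bandPart φ N ξ
  have e : (2 * Real.pi * ‖ξ‖) ^ 2 * (bandPart φ N ξ * (starRingEnd ℂ) (l2Fourier u ξ)).re =
      2 * Real.pi * ‖ξ‖ * ((((2 * Real.pi * ‖ξ‖ : ℝ) : ℂ) * bandPart φ N ξ) *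
        (starRingEnd ℂ) (l2Fourier u ξ)).re := by
    rw [mul_assoc (((2 * Real.pi * ‖ξ‖ : ℝ) : ℂ)), Complex.re_ofReal_mul]; ring
  rw [e, h]
  by_cases h : ξ ∈ annulus d N
  · rw [Set.indicator_of_mem h, Set.indicator_of_mem h]
  · rw [Set.indicator_of_notMem h, Set.indicator_of_notMem h]; simp

/-- The tail of the `H^{1/2}` norm. -/
def tailHHalf (φ : E d → ℝ) (N : ℕ) : ℝ≥0∞ :=
  ∫⁻ ξ in (annulus d N)ᶜ, (‖l2Fourier φ ξ‖ₑ ^ 2 + ‖quarterSymbolMul φ ξ‖ₑ ^ 2)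

/-- Two truncations agree on the smaller annulus; elsewhere, after multiplication by `2π|ξ|`, they
differ by `0` or by `φ̂` up to sign. -/
lemma norm_bandPart_sub_le (φ : E d → ℝ) {N M M' : ℕ} (h : N ≤ M) (h' : N ≤ M') (ξ : E d) :
    (2 * Real.pi * ‖ξ‖) * ‖bandPart φ M ξ - bandPart φ M' ξ‖ ≤
      (annulus d N)ᶜ.indicator (fun ξ => ‖l2Fourier φ ξ‖) ξ := by
  have e : (2 * Real.pi * ‖ξ‖) * ‖bandPart φ M ξ - bandPart φ M' ξ‖ =
      ‖(annulus d M).indicator (l2Fourier φ) ξ - (annulus d M').indicator (l2Fourier φ) ξ‖ := by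
    rw [← mul_bandPart, ← mul_bandPart, ← mul_sub, norm_mul, Complex.norm_real,
      Real.norm_of_nonneg (by positivity)]
  rw [e]
  by_cases hN : ξ ∈ annulus d N
  · rw [Set.indicator_of_mem (annulus_mono d h hN), Set.indicator_of_mem (annulus_mono d h' hN)]
    simp [hN]
  · rw [Set.indicator_of_mem (show ξ ∈ (annulus d N)ᶜ from hN)]
    by_cases hM : ξ ∈ annulus d M <;> by_cases hM' : ξ ∈ annulus d M' <;> simp [hM, hM']

/-- Together with `exists_bound_cutSol` this makes the cut-off approximations a Cauchy sequence in
`H¹`. -/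
lemma mass_bandPart_sub_le (φ : E d → ℝ) {N M M' : ℕ} (h : N ≤ M) (h' : N ≤ M') :
    massL2 (fun ξ => bandPart φ M ξ - bandPart φ M' ξ) +
      massHHalf (fun ξ => bandPart φ M ξ - bandPart φ M' ξ) ≤ 2 * tailHHalf φ N := by
  have hk := norm_bandPart_sub_le φ h h'
  have h1 : massL2 (fun ξ => bandPart φ M ξ - bandPart φ M' ξ) ≤ tailHHalf φ N := by
    rw [massL2, tailHHalf, ← lintegral_indicator (measurableSet_annulus d N).compl]
    refine lintegral_mono fun ξ => ?_
    rw [← mul_pow]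
    by_cases hN : ξ ∈ (annulus d N)ᶜ
    · rw [Set.indicator_of_mem hN]
      have := hk ξ
      rw [Set.indicator_of_mem hN] at this
      rw [ENNReal.ofReal_pow (by positivity)]
      refine le_trans ?_ le_self_add
      rw [← ofReal_norm (l2Fourier φ ξ)]
      gcongr
    · have := hk ξ
      rw [Set.indicator_of_notMem hN] at this
      have h0 : (2 * Real.pi * ‖ξ‖) * ‖bandPart φ M ξ - bandPart φ M' ξ‖ = 0 :=
        le_antisymm this (by positivity)
      rw [h0]; simp
  have h2 : massHHalf (fun ξ => bandPart φ M ξ - bandPart φ M' ξ) ≤ tailHHalf φ N := by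
    rw [massHHalf, tailHHalf, ← lintegral_indicator (measurableSet_annulus d N).compl]
    refine lintegral_mono fun ξ => ?_
    have e : (2 * Real.pi * ‖ξ‖) ^ 3 * ‖bandPart φ M ξ - bandPart φ M' ξ‖ ^ 2 =
      2 * Real.pi * ‖ξ‖ * ((2 * Real.pi * ‖ξ‖) * ‖bandPart φ M ξ - bandPart φ M' ξ‖) ^ 2 := by ring
    rw [e]
    by_cases hN : ξ ∈ (annulus d N)ᶜ
    · rw [Set.indicator_of_mem hN]
      have := hk ξ
      rw [Set.indicator_of_mem hN] at this
      refine le_trans ?_ le_add_self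
      rw [← ofReal_norm (quarterSymbolMul φ ξ), ← ENNReal.ofReal_pow (norm_nonneg _),
        quarterSymbolMul_norm_sq]
      gcongr
    · have := hk ξ
      rw [Set.indicator_of_notMem hN] at this
      have h0 : (2 * Real.pi * ‖ξ‖) * ‖bandPart φ M ξ - bandPart φ M' ξ‖ = 0 :=
        le_antisymm this (by positivity)
      rw [h0]; simp
  rw [two_mul]
  exact add_le_add h1 h2

/-- The annuli exhaust only the complement of the origin. In dimension zero the origin would carry
all the mass; `1 ≤ d` rules this out. -/
lemma ae_ne_zero (hd : 1 ≤ d) : ∀ᵐ ξ : E d, ξ ≠ 0 := by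
  have : Nonempty (Fin d) := ⟨⟨0, hd⟩⟩
  simp [ae_iff]

lemma tendsto_setLIntegral_annulus_compl (hd : 1 ≤ d) {f : E d → ℝ≥0∞} (hf : AEMeasurable f)
    (hfin : ∫⁻ ξ, f ξ ≠ ⊤) :
    Tendsto (fun N => ∫⁻ ξ in (annulus d N)ᶜ, f ξ) atTop (𝓝 0) := by
  simp only [← lintegral_indicator (measurableSet_annulus d _).compl]
  have h0 : ∫⁻ _ : E d, (0 : ℝ≥0∞) = 0 := by simp
  rw [← h0]
  refine tendsto_lintegral_of_dominated_convergence' f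
    (fun N => hf.indicator (measurableSet_annulus d N).compl)
    (fun N => Eventually.of_forall fun ξ => Set.indicator_le_self _ _ _) hfin ?_
  filter_upwards [ae_ne_zero hd] with ξ hξ
  refine tendsto_const_nhds.congr' ?_
  filter_upwards [eventually_mem_annulus hξ] with N hN
  simp [hN]

lemma tendsto_tailHHalf (hd : 1 ≤ d) (hφ : MemHHalf φ) : Tendsto (tailHHalf φ) atTop (𝓝 0) := by
  obtain ⟨h1, h2⟩ := memHHalf_iff.1 hφ
  have h3 := memLp_l2Fourier h1
  refine tendsto_setLIntegral_annulus_compl hd ((h3.1.enorm.pow_const 2).add (h2.1.enorm.pow_const 2)) ?_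
  rw [lintegral_add_left' (h3.1.enorm.pow_const 2)]
  exact ENNReal.add_ne_top.2 ⟨(lintegral_sq_lt_top h3).ne, (lintegral_sq_lt_top h2).ne⟩

lemma tendsto_of_tendsto_sq {f : ℕ → ℝ≥0∞} (h : Tendsto (fun n => f n ^ 2) atTop (𝓝 0)) :
    Tendsto f atTop (𝓝 0) := by
  have := (ENNReal.continuous_rpow_const (y := 2⁻¹)).tendsto 0 |>.comp h
  have e : ∀ x : ℝ≥0∞, (x ^ 2) ^ (2⁻¹ : ℝ) = x := fun x => by
    rw [← ENNReal.rpow_natCast, ← ENNReal.rpow_mul]; norm_num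
  simpa [Function.comp_def, e] using this

/-- The traces of the band limited approximations converge. -/
lemma tendsto_trace_bandPart (hd : 1 ≤ d) (hφ : MemLp (toC φ) 2) :
    Tendsto (fun N => eLpNorm (fun x => harm (fun ξ => ((2 * Real.pi * ‖ξ‖ : ℝ) : ℂ) * bandPart φ N ξ)
      (consPoint x 0) - φ x) 2 volume) atTop (𝓝 0) := by
  refine tendsto_of_tendsto_sq ?_
  have hl := memLp_l2Fourier hφ
  refine tendsto_of_tendsto_of_tendsto_of_le_of_le tendsto_const_nhds
    (tendsto_setLIntegral_annulus_compl hd (hl.1.enorm.pow_const 2) (lintegral_sq_lt_top hl).ne)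
    (fun n => zero_le) fun N => ?_
  have hb : BandLimited (fun ξ => ((2 * Real.pi * ‖ξ‖ : ℝ) : ℂ) * bandPart φ N ξ) :=
    (bandLimited_bandPart hφ N).mul (by fun_prop)
  beta_reduce
  rw [eLpNorm_two_sq]
  simp only [harm_consPoint_zero]
  refine (lintegral_re_fourierInv_sub hb.memLp hb.integrable hφ).trans ?_
  rw [← lintegral_indicator (measurableSet_annulus d N).compl]
  refine lintegral_mono fun ξ => ?_
  rw [mul_bandPart]
  by_cases h : ξ ∈ annulus d N
  · simp [h]
  · simp [h]

end bandPart

/-! ### Auxiliary facts on `L²` limits -/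

section limits

variable {α : Type*} [MeasurableSpace α] {μ : Measure α}

lemma exists_limit_of_eLpNorm_sub_le {f : ℕ → α → ℝ} (hf : ∀ n, MemLp (f n) 2 μ) {b : ℕ → ℝ≥0∞}
    (hb : Tendsto b atTop (𝓝 0))
    (h : ∀ N n m, N ≤ n → N ≤ m → eLpNorm (fun x => f n x - f m x) 2 μ ≤ b N) :
    ∃ g : α → ℝ, MemLp g 2 μ ∧ Tendsto (fun n => eLpNorm (fun x => f n x - g x) 2 μ) atTop (𝓝 0) := by
  have hc : CauchySeq fun n => (hf n).toLp (f n) := by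
    refine EMetric.cauchySeq_iff_le_tendsto_0.2 ⟨b, fun n m N hn hm => ?_, hb⟩
    rw [Lp.edist_toLp_toLp]
    exact h N n m hn hm
  obtain ⟨G, hG⟩ := cauchySeq_tendsto_of_complete hc
  refine ⟨G, Lp.memLp G, ?_⟩
  have := (Lp.tendsto_Lp_iff_tendsto_eLpNorm' _ G).1 hG
  refine this.congr fun n => eLpNorm_congr_ae ?_
  filter_upwards [(hf n).coeFn_toLp] with x hx
  simp [hx]

lemma integral_sq_le_of_lintegral_le {f : α → ℝ} (hf : AEStronglyMeasurable f μ) {c : ℝ} (hc : 0 ≤ c)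
    (h : ∫⁻ x, ‖f x‖ₑ ^ 2 ∂μ ≤ ENNReal.ofReal c) : ∫ x, f x ^ 2 ∂μ ≤ c := by
  rw [integral_eq_lintegral_of_nonneg_ae (Eventually.of_forall fun x => sq_nonneg _) (hf.pow 2)]
  refine ENNReal.toReal_le_of_le_ofReal hc (le_trans (le_of_eq ?_) h)
  refine lintegral_congr fun x => ?_
  rw [← ofReal_norm, ← ENNReal.ofReal_pow (norm_nonneg _), Real.norm_eq_abs, sq_abs]

lemma integral_mul_add_mul {f g p q : α → ℝ} (hf : MemLp f 2 μ) (hg : MemLp g 2 μ) (hp : MemLp p 2 μ)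
    (hq : MemLp q 2 μ) :
    ∫ x, (f x * p x + g x * q x) ∂μ = ∫ x, f x * p x ∂μ + ∫ x, g x * q x ∂μ :=
  integral_add (hf.integrable_mul hp) (hg.integrable_mul hq)

end limits

/-! ### Traces in `H^{1/2}` and the Dirichlet-to-Neumann identity. -/

section traces

variable {d : ℕ} {lam mu : ℝ}

lemma iUnion_annulus_ae_eq_univ (hd : 1 ≤ d) :
    (⋃ N, annulus d N : Set (E d)) =ᵐ[volume] Set.univ := by
  refine eventuallyEq_univ.2 ?_
  filter_upwards [ae_ne_zero hd] with ξ hξ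
  obtain ⟨N, hN⟩ := (eventually_mem_annulus hξ).exists
  exact Set.mem_iUnion.2 ⟨N, hN⟩

lemma lintegral_le_of_annulus (hd : 1 ≤ d) {f : E d → ℝ≥0∞} {B : ℝ≥0∞}
    (h : ∀ N, ∫⁻ ξ in annulus d N, f ξ ≤ B) : ∫⁻ ξ, f ξ ≤ B := by
  rw [← setLIntegral_univ, ← setLIntegral_congr (iUnion_annulus_ae_eq_univ hd),
    setLIntegral_iUnion_of_directed _ (annulus_mono d).directed_le]
  exact iSup_le h

lemma tendsto_integral_annulus (hd : 1 ≤ d) {f : E d → ℝ} (hf : Integrable f) :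
    Tendsto (fun N => ∫ ξ, (annulus d N).indicator f ξ) atTop (𝓝 (∫ ξ, f ξ)) := by
  simp only [integral_indicator (measurableSet_annulus d _)]
  have h := tendsto_setIntegral_of_monotone (measurableSet_annulus d) (annulus_mono d)
    (f := f) (μ := volume) hf.integrableOn
  rwa [setIntegral_congr_set (iUnion_annulus_ae_eq_univ hd), setIntegral_univ] at h

lemma quarterSymbolMul_mul_conj (φ u : E d → ℝ) (ξ : E d) :
    (quarterSymbolMul φ ξ * (starRingEnd ℂ) (quarterSymbolMul u ξ)).re =
      2 * Real.pi * ‖ξ‖ * (l2Fourier φ ξ * (starRingEnd ℂ) (l2Fourier u ξ)).re := by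
  have h0 : 0 ≤ 2 * Real.pi * ‖ξ‖ := by positivity
  have h : (2 * Real.pi * ‖ξ‖) ^ (1 / 2 : ℝ) * (2 * Real.pi * ‖ξ‖) ^ (1 / 2 : ℝ) =
      2 * Real.pi * ‖ξ‖ := by
    rw [← Real.sqrt_eq_rpow, Real.mul_self_sqrt h0]
  simp only [quarterSymbolMul, map_mul, Complex.conj_ofReal]
  rw [mul_mul_mul_comm, ← Complex.ofReal_mul, h, Complex.re_ofReal_mul]

lemma integrable_symbol_mul {φ u : E d → ℝ} (hφ : MemHHalf φ) (hu : MemHHalf u) :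
    Integrable fun ξ =>
      2 * Real.pi * ‖ξ‖ * (l2Fourier φ ξ * (starRingEnd ℂ) (l2Fourier u ξ)).re := by
  simp only [← quarterSymbolMul_mul_conj]
  have h : MemLp (fun ξ => (starRingEnd ℂ) (quarterSymbolMul u ξ)) 2 := (memHHalf_iff.1 hu).2.star
  exact ((memHHalf_iff.1 hφ).2.integrable_mul h).re

lemma lameDens_const_mul_right {m : ℕ} (s : ℝ) (A B : Fin m → Fin m → ℝ) :
    lameDens lam mu A (fun i j => s * B i j) = s * lameDens lam mu A B := by
  simp only [lameDens_eq_sum_stress, Finset.mul_sum]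
  refine Finset.sum_congr rfl fun j _ => Finset.sum_congr rfl fun i _ => by ring

lemma massHHalf_bandPart (φ : E d → ℝ) (N : ℕ) :
    massHHalf (bandPart φ N) = ∫⁻ ξ in annulus d N, ‖quarterSymbolMul φ ξ‖ₑ ^ 2 := by
  rw [massHHalf, ← lintegral_indicator (measurableSet_annulus d N)]
  refine lintegral_congr fun ξ => ?_
  have e : (2 * Real.pi * ‖ξ‖) ^ 3 * ‖bandPart φ N ξ‖ ^ 2 =
      2 * Real.pi * ‖ξ‖ * ((2 * Real.pi * ‖ξ‖) * ‖bandPart φ N ξ‖) ^ 2 := by ring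
  rw [e, mul_norm_bandPart]
  by_cases h : ξ ∈ annulus d N
  · rw [Set.indicator_of_mem h, Set.indicator_of_mem h, ← ofReal_norm,
      ← ENNReal.ofReal_pow (norm_nonneg _), quarterSymbolMul_norm_sq]
  · rw [Set.indicator_of_notMem h, Set.indicator_of_notMem h]; simp

/-- Choosing `s = c / M` leaves `D - c² t / M ≥ 0`. In the application `t` is a truncated `Ḣ^{1/2}`
energy of the trace, `D` the energy of the given field and `q` that of the explicit field. -/
lemma quad_bound {t D q c M : ℝ} (hc : 0 < c) (hM : 0 < M) (hq : q ≤ M * t)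
    (h : ∀ s : ℝ, 0 ≤ D - 2 * s * (c * t) + s ^ 2 * q) : t ≤ M * D / c ^ 2 := by
  have h1 := h (c / M)
  have h2 : (c / M) ^ 2 * q ≤ (c / M) ^ 2 * (M * t) := by gcongr
  have h3 : D - 2 * (c / M) * (c * t) + (c / M) ^ 2 * (M * t) = D - c ^ 2 * t / M := by
    field_simp; ring
  have h4 : c ^ 2 * t / M ≤ D := by linarith
  rw [le_div_iff₀ (by positivity)]
  rw [div_le_iff₀ hM] at h4
  linarith

/-- Normal traces of `H¹` vector fields are in `H^{1/2}`. -/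
lemma memHHalf_of_hasFlatTrace (hd : 1 ≤ d) {f : E (d + 1) → E (d + 1)}
    {F : Fin (d + 1) → Fin (d + 1) → E (d + 1) → ℝ} {φ : E d → ℝ}
    (hf : ∀ i j, IsWeakPartial (halfSpace d) i (fun z => f z j) (F i j))
    (hF : ∀ i j, MemLp (F i j) 2 (volume.restrict (halfSpace d)))
    (hsub : ∀ j, SubexpL2 (fun z => f z j))
    (hφ : HasFlatTrace Set.univ (fun z => f z (Fin.last d)) φ) : MemHHalf φ := by
  have hφ2 : MemLp (toC φ) 2 := memLp_toC ((hasFlatTrace_univ_iff (hf _ _)).1 hφ).1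
  refine memHHalf_iff.2 ⟨hφ2, memLp_two_of_lintegral
    (continuous_quarterSymbol.aestronglyMeasurable.mul (memLp_l2Fourier hφ2).1) ?_⟩
  -- The claim does not involve the Lamé constants, so both are set to `1`.
  set G := fun N => lameGrad 1 1 (bandPart φ N) with hG
  have hb := bandLimited_bandPart hφ2
  have hGm : ∀ N i j, MemLp (G N i j) 2 (volume.restrict (halfSpace d)) :=
    fun N i j => memLp_lameGrad (hb N) i j
  set D := ∫ z in halfSpace d, lameDens 1 1 (fun i j => F i j z) (fun i j => F i j z) with hD
  set K := 6 * symBound 1 1 ^ 2 with hK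
  have hK0 : 0 < K := by
    have : 0 < symBound 1 1 := by unfold symBound; positivity
    positivity
  -- The constant of `lameDens_self_le` in dimension `d + 1`, times the bound `K` for each of the
  -- `(d + 1)²` entries of the gradient.
  set M : ℝ := (2 * 1 + 1 * ((d + 1 : ℕ) : ℝ)) * (((d + 1 : ℕ) : ℝ) * (((d + 1 : ℕ) : ℝ) * K)) with hM
  have hM0 : 0 < M := by positivity
  have key : ∀ N, ∫⁻ ξ in annulus d N, ‖quarterSymbolMul φ ξ‖ₑ ^ 2 ≤
      ENNReal.ofReal (M * D / lameC 1 1 ^ 2) := by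
    intro N
    -- This is `∫ 2π|ξ| |φ̂|²` over the annulus. It is finite because of the truncation, and the aim
    -- is a bound independent of `N`.
    set T : ℝ := ∫ ξ, (2 * Real.pi * ‖ξ‖) ^ 2 *
      (bandPart φ N ξ * (starRingEnd ℂ) (l2Fourier φ ξ)).re with hT
    have hpos : ∀ ξ, 0 ≤ (2 * Real.pi * ‖ξ‖) ^ 2 *
        (bandPart φ N ξ * (starRingEnd ℂ) (l2Fourier φ ξ)).re := by
      intro ξ
      rw [sq_mul_bandPart_re]
      refine Set.indicator_nonneg (fun ξ _ => ?_) ξ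
      rw [Complex.mul_conj, Complex.ofReal_re]
      exact mul_nonneg (by positivity) (Complex.normSq_nonneg _)
    have hmass : massHHalf (bandPart φ N) = ENNReal.ofReal T := by
      rw [hT, ofReal_integral_eq_lintegral_ofReal _ (Eventually.of_forall hpos), massHHalf_bandPart,
        ← lintegral_indicator (measurableSet_annulus d N)]
      · refine lintegral_congr fun ξ => ?_
        rw [sq_mul_bandPart_re]
        by_cases h : ξ ∈ annulus d N
        · rw [Set.indicator_of_mem h, Set.indicator_of_mem h, ← ofReal_norm,
            ← ENNReal.ofReal_pow (norm_nonneg _), quarterSymbolMul_norm_sq, Complex.mul_conj,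
            Complex.ofReal_re, Complex.normSq_eq_norm_sq]
        · rw [Set.indicator_of_notMem h, Set.indicator_of_notMem h]; simp
      · have h1 : MemLp (fun ξ => ((2 * Real.pi * ‖ξ‖ : ℝ) : ℂ) ^ 2 * bandPart φ N ξ) 2 :=
          ((hb N).mul (p := fun ξ => ((2 * Real.pi * ‖ξ‖ : ℝ) : ℂ) ^ 2) (by fun_prop)).memLp
        have h2 : MemLp (fun ξ => (starRingEnd ℂ) (l2Fourier φ ξ)) 2 := (memLp_l2Fourier hφ2).star
        refine (h1.integrable_mul h2).re.congr (Eventually.of_forall fun ξ => ?_)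
        change (((2 * Real.pi * ‖ξ‖ : ℝ) : ℂ) ^ 2 * bandPart φ N ξ *
          (starRingEnd ℂ) (l2Fourier φ ξ)).re = _
        rw [mul_assoc, ← Complex.ofReal_pow, Complex.re_ofReal_mul]
    rw [← massHHalf_bandPart, hmass]
    refine ENNReal.ofReal_le_ofReal ?_
    have hT0 : 0 ≤ T := integral_nonneg hpos
    -- The mixed energy of the explicit field and the given one is exactly `c T`, while the energy
    -- of the explicit field is at most `M T`. Nonnegativity of the energy of `F - s G` then bounds
    -- `T`.
    have hGF := integral_lameDens_lameGrad one_pos one_pos (hb N) hf hF hsub hφ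
    have i0 : ∀ {A B : Fin (d + 1) → Fin (d + 1) → E (d + 1) → ℝ},
        (∀ i j, MemLp (A i j) 2 (volume.restrict (halfSpace d))) →
        (∀ i j, MemLp (B i j) 2 (volume.restrict (halfSpace d))) →
        IntegrableOn (fun z => lameDens 1 1 (fun i j => A i j z) (fun i j => B i j z)) (halfSpace d) :=
      fun hA hB => integrable_lameDens hA hB
    refine quad_bound (lameC_pos one_pos one_pos) hM0 (q := ∫ z in halfSpace d,
      lameDens 1 1 (fun i j => G N i j z) (fun i j => G N i j z)) ?_ fun s => ?_
    · have h1 : ∀ i j, ∫ z in halfSpace d, G N i j z ^ 2 ≤ K * T := by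
        intro i j
        refine integral_sq_le_of_lintegral_le (hGm N i j).1 (by positivity) ?_
        rw [ENNReal.ofReal_mul hK0.le, ← hmass]
        exact lintegral_lameGrad_le (hb N) i j
      calc _ ≤ ∫ z in halfSpace d, (2 * 1 + 1 * ((d + 1 : ℕ) : ℝ)) * ∑ i, ∑ j, G N i j z ^ 2 := by
            refine integral_mono (i0 (hGm N) (hGm N)) ?_ fun z => lameDens_self_le one_pos one_pos _
            exact (integrable_finsetSum _ fun i _ => integrable_finsetSum _ fun j _ =>
              (hGm N i j).integrable_sq).const_mul _
        _ = (2 * 1 + 1 * ((d + 1 : ℕ) : ℝ)) * ∑ i, ∑ j, ∫ z in halfSpace d, G N i j z ^ 2 := by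
            rw [integral_const_mul, integral_finsetSum _ fun i _ => integrable_finsetSum _ fun j _ =>
              (hGm N i j).integrable_sq]
            congr 1
            exact Finset.sum_congr rfl fun i _ =>
              integral_finsetSum _ fun j _ => (hGm N i j).integrable_sq
        _ ≤ (2 * 1 + 1 * ((d + 1 : ℕ) : ℝ)) * ∑ i : Fin (d + 1), ∑ j : Fin (d + 1), K * T := by
            gcongr with i _ j _
            exact h1 i j
        _ = _ := by simp [hM]; ring
    · have h0 : 0 ≤ ∫ z in halfSpace d, lameDens 1 1 (fun i j => F i j z - s * G N i j z)
          (fun i j => F i j z - s * G N i j z) :=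
        integral_nonneg fun z => lameDens_self_nonneg one_pos one_pos _
      have e : ∀ z, lameDens 1 1 (fun i j => F i j z - s * G N i j z)
          (fun i j => F i j z - s * G N i j z) =
          lameDens 1 1 (fun i j => F i j z) (fun i j => F i j z) -
          2 * s * lameDens 1 1 (fun i j => G N i j z) (fun i j => F i j z) +
          s ^ 2 * lameDens 1 1 (fun i j => G N i j z) (fun i j => G N i j z) := by
        intro z
        rw [lameDens_sub_right, lameDens_const_mul_right,
          lameDens_comm (fun i j => F i j z - s * G N i j z) (fun i j => F i j z),
          lameDens_comm (fun i j => F i j z - s * G N i j z) (fun i j => G N i j z),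
          lameDens_sub_right, lameDens_sub_right, lameDens_const_mul_right,
          lameDens_const_mul_right, lameDens_comm (fun i j => F i j z) (fun i j => G N i j z)]
        ring
      simp only [e] at h0
      rw [integral_add, integral_sub, integral_const_mul, integral_const_mul, hGF] at h0
      · exact h0
      · exact i0 hF hF
      · exact (i0 (hGm N) hF).const_mul _
      · exact (i0 hF hF).sub ((i0 (hGm N) hF).const_mul _)
      · exact (i0 (hGm N) (hGm N)).const_mul _
  exact (lintegral_le_of_annulus hd key).trans_lt ENNReal.ofReal_lt_top

lemma HasFlatTrace.sub {f f' g g' : E (d + 1) → ℝ} {t t' : E d → ℝ}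
    (hfg : IsWeakPartial (halfSpace d) (Fin.last d) f g)
    (hfg' : IsWeakPartial (halfSpace d) (Fin.last d) f' g')
    (hf : IntegrableUpToBoundary f) (hg : IntegrableUpToBoundary g)
    (hf' : IntegrableUpToBoundary f') (hg' : IntegrableUpToBoundary g')
    (h : HasFlatTrace Set.univ f t) (h' : HasFlatTrace Set.univ f' t') :
    HasFlatTrace Set.univ (fun z => f z - f' z) (fun x => t x - t' x) := by
  rw [hasFlatTrace_univ_iff (hfg.sub (isOpen_halfSpace d) hfg')]
  obtain ⟨h1, h2⟩ := (hasFlatTrace_univ_iff hfg).1 h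
  obtain ⟨h1', h2'⟩ := (hasFlatTrace_univ_iff hfg').1 h'
  refine ⟨h1.sub h1', fun η hη => ?_⟩
  have hp := hη.pderiv (Fin.last d)
  obtain ⟨ρ, hρ, hηρ⟩ := exists_slice_bound hη
  have hηL : MemLp (fun x => η (consPoint x 0)) 2 :=
    hρ.mono ((hη.1.continuous.comp (continuous_consPoint_left 0)).aestronglyMeasurable)
      (Eventually.of_forall fun x => (hηρ x 0).trans (le_abs_self _))
  have a1 := (hf.integrableOn_mul hp.1.continuous hp.2.1).add (hg.integrableOn_mul hη.1.continuous hη.2.1)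
  have a2 := (hf'.integrableOn_mul hp.1.continuous hp.2.1).add
    (hg'.integrableOn_mul hη.1.continuous hη.2.1)
  have b1 : Integrable fun x => t x * η (consPoint x 0) := h1.integrable_mul hηL
  have b2 : Integrable fun x => t' x * η (consPoint x 0) := h1'.integrable_mul hηL
  have e := (integral_sub a1 a2).trans (congrArg₂ (· - ·) (h2 η hη) (h2' η hη))
  have e' := integral_sub b1 b2
  simp only [sub_mul]
  rw [e', neg_sub]
  calc _ = _ := integral_congr_ae (Eventually.of_forall fun z => ?_)
    _ = _ := e
    _ = _ := by ring
  simp only [Pi.add_apply]; ring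

lemma memLp_cutSol {g : E d → ℂ} (hg : BandLimited g) :
    MemLp (cutSol lam mu g) 2 (volume.restrict (halfSpace d)) :=
  (memLp_lameSol (lam := lam) (mu := mu) hg (Fin.last d)).mono
    (contDiff_cutSol hg).continuous.aestronglyMeasurable (Eventually.of_forall fun z => by
      rw [cutSol, norm_mul]
      exact mul_le_of_le_one_left (norm_nonneg _) (abs_vertCut_le z))

lemma memLp_cutGrad {g : E d → ℂ} (hg : BandLimited g) (i : Fin (d + 1)) :
    MemLp (cutGrad lam mu g i) 2 (volume.restrict (halfSpace d)) := by
  obtain ⟨M, hM0, hM⟩ := exists_bound_deriv_vertBump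
  refine MemLp.add ?_ ?_
  · refine (memLp_lameGrad (lam := lam) (mu := mu) hg i (Fin.last d)).mono
      (((contDiff_vertCut d).continuous.aestronglyMeasurable).mul (memLp_lameGrad hg _ _).1)
      (Eventually.of_forall fun z => ?_)
    rw [norm_mul]
    exact mul_le_of_le_one_left (norm_nonneg _) (abs_vertCut_le z)
  · refine (memLp_lameSol (lam := lam) (mu := mu) hg (Fin.last d)).of_le_mul (c := M)
      ((((contDiff_vertCut d).pderiv i).continuous.aestronglyMeasurable).mul
        (memLp_lameSol hg _).1) (Eventually.of_forall fun z => ?_)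
    rw [norm_mul, pderiv_vertCut]
    gcongr
    split_ifs
    · exact hM _
    · simpa using hM0

lemma cutSol_consPoint_zero {g : E d → ℂ} (x : E d) : cutSol lam mu g (consPoint x 0) =
    harm (fun ξ => ((2 * Real.pi * ‖ξ‖ : ℝ) : ℂ) * g ξ) (consPoint x 0) := by
  rw [cutSol, vertCut_consPoint, vertBump_zero, one_mul, lameSol_consPoint_zero]

lemma hasFlatTrace_cutSol {g : E d → ℂ} (hg : BandLimited g) :
    HasFlatTrace Set.univ (cutSol lam mu g)
      (fun x => harm (fun ξ => ((2 * Real.pi * ‖ξ‖ : ℝ) : ℂ) * g ξ) (consPoint x 0)) := by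
  have h := hasFlatTrace_of_contDiff (contDiff_cutSol (lam := lam) (mu := mu) hg) (by
    simp only [cutSol_consPoint_zero]
    exact memLp_harm_slice (hg.mul (by fun_prop)) 0)
  simpa only [cutSol_consPoint_zero] using h

/-- An `H¹` extension of `φ`, approximated by `cutSol`. -/
lemma exists_extension (hd : 1 ≤ d) (lam mu : ℝ) {φ : E d → ℝ} (hφ : MemHHalf φ) :
    ∃ (z : E (d + 1) → ℝ) (Z : Fin (d + 1) → E (d + 1) → ℝ),
      (∀ i, IsWeakPartial (halfSpace d) i z (Z i)) ∧ MemLp z 2 (volume.restrict (halfSpace d)) ∧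
      (∀ i, MemLp (Z i) 2 (volume.restrict (halfSpace d))) ∧ HasFlatTrace Set.univ z φ ∧
      ∀ i, Tendsto (fun N => eLpNorm (fun x => cutGrad lam mu (bandPart φ N) i x - Z i x) 2
        (volume.restrict (halfSpace d))) atTop (𝓝 0) := by
  have hφ2 := (memHHalf_iff.1 hφ).1
  have hb := bandLimited_bandPart hφ2
  obtain ⟨C, hC, hCb⟩ := exists_bound_cutSol d lam mu
  have hsm := fun N => memLp_cutSol (lam := lam) (mu := mu) (hb N)
  have hgm := fun N i => memLp_cutGrad (lam := lam) (mu := mu) (hb N) i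
  -- The mass estimates concern squared norms; the root turns them into a Cauchy modulus for the
  -- `L²` norms.
  set b : ℕ → ℝ≥0∞ := fun N => (C * (2 * tailHHalf φ N)) ^ (2⁻¹ : ℝ) with hbdef
  have hb0 : Tendsto b atTop (𝓝 0) := by
    have h1 := ENNReal.Tendsto.const_mul (a := C)
      (ENNReal.Tendsto.const_mul (a := 2) (tendsto_tailHHalf hd hφ) (Or.inr (by norm_num))) (Or.inr hC)
    have := ((ENNReal.continuous_rpow_const (y := 2⁻¹)).tendsto _).comp h1
    simpa [Function.comp_def] using this
  have root : ∀ (f : E (d + 1) → ℝ) (N : ℕ),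
      ∫⁻ z in halfSpace d, ‖f z‖ₑ ^ 2 ≤ C * (2 * tailHHalf φ N) →
      eLpNorm f 2 (volume.restrict (halfSpace d)) ≤ b N := by
    intro f N h
    rw [← eLpNorm_two_sq] at h
    have := ENNReal.rpow_le_rpow h (by norm_num : (0 : ℝ) ≤ 2⁻¹)
    rwa [← ENNReal.rpow_natCast, ← ENNReal.rpow_mul, show ((2 : ℕ) : ℝ) * 2⁻¹ = 1 by norm_num,
      ENNReal.rpow_one] at this
  have bound : ∀ N n m, N ≤ n → N ≤ m → C * (massL2 (fun ξ => bandPart φ n ξ - bandPart φ m ξ) +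
      massHHalf (fun ξ => bandPart φ n ξ - bandPart φ m ξ)) ≤ C * (2 * tailHHalf φ N) :=
    fun N n m hn hm => mul_le_mul_right (mass_bandPart_sub_le φ hn hm) C
  obtain ⟨z, hz, hzt⟩ := exists_limit_of_eLpNorm_sub_le hsm hb0 fun N n m hn hm => by
    refine root _ N ?_
    simp only [← cutSol_sub (hb n) (hb m)]
    exact ((hCb _ ((hb n).sub (hb m))).1).trans (bound N n m hn hm)
  have hZ := fun i => exists_limit_of_eLpNorm_sub_le (fun N => hgm N i) hb0 fun N n m hn hm => by
    refine root _ N ?_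
    simp only [← cutGrad_sub (hb n) (hb m)]
    exact ((hCb _ ((hb n).sub (hb m))).2 i).trans (bound N n m hn hm)
  choose Z hZ hZt using hZ
  have hw : ∀ N i, IsWeakPartial (halfSpace d) i (cutSol lam mu (bandPart φ N))
      (cutGrad lam mu (bandPart φ N) i) := fun N i => by
    rw [← pderiv_cutSol (hb N)]
    exact isWeakPartial_of_contDiff (isOpen_halfSpace d) (contDiff_cutSol (hb N)) i
  have hzw : ∀ i, IsWeakPartial (halfSpace d) i z (Z i) := fun i =>
    isWeakPartial_of_tendsto (fun N => hw N i) hsm (fun N => hgm N i) hz (hZ i) hzt (hZt i)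
  refine ⟨z, Z, hzw, hz, hZ, ?_, hZt⟩
  rw [hasFlatTrace_univ_iff (hzw _)]
  refine ⟨hφ.memLp, fun η hη => ?_⟩
  have hp := hη.pderiv (Fin.last d)
  obtain ⟨ρ, hρ, hηρ⟩ := exists_slice_bound hη
  have hηL : MemLp (fun x => η (consPoint x 0)) 2 :=
    hρ.mono ((hη.1.continuous.comp (continuous_consPoint_left 0)).aestronglyMeasurable)
      (Eventually.of_forall fun x => (hηρ x 0).trans (le_abs_self _))
  have hη2 : MemLp η 2 (volume.restrict (halfSpace d)) :=
    (hη.1.continuous.memLp_of_hasCompactSupport hη.2.1).restrict _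
  have hp2 : MemLp (pderiv (Fin.last d) η) 2 (volume.restrict (halfSpace d)) :=
    (hp.1.continuous.memLp_of_hasCompactSupport hp.2.1).restrict _
  set tr : ℕ → E d → ℝ := fun N x =>
    harm (fun ξ => ((2 * Real.pi * ‖ξ‖ : ℝ) : ℂ) * bandPart φ N ξ) (consPoint x 0) with htr
  have htrm : ∀ N, MemLp (tr N) 2 := fun N => memLp_harm_slice ((hb N).mul (by fun_prop)) 0
  have eN : ∀ N, ∫ x in halfSpace d, (cutSol lam mu (bandPart φ N) x * pderiv (Fin.last d) η x +
      cutGrad lam mu (bandPart φ N) (Fin.last d) x * η x) = -∫ x, tr N x * η (consPoint x 0) := by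
    exact fun N => ((hasFlatTrace_univ_iff (hw N _)).1 (hasFlatTrace_cutSol (hb N))).2 η hη
  have l1 := tendsto_integral_mul_of_tendsto_eLpNorm hsm hz hp2 hzt
  have l2 := tendsto_integral_mul_of_tendsto_eLpNorm (fun N => hgm N (Fin.last d)) (hZ _) hη2 (hZt _)
  have l3 := tendsto_integral_mul_of_tendsto_eLpNorm htrm hφ.memLp hηL (tendsto_trace_bandPart hd hφ2)
  rw [integral_mul_add_mul hz (hZ _) hp2 hη2]
  -- The Green formula of the smooth approximations passes to the limit term by term, so the limit
  -- has trace `φ`.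
  refine tendsto_nhds_unique (l1.add l2) (l3.neg.congr fun N => ?_)
  rw [← eN N, integral_mul_add_mul (hsm N) (hgm N _) hp2 hη2]

/-- The displacement gradient of a vector field that only has a normal component. -/
def normalGrad (Z : Fin (d + 1) → E (d + 1) → ℝ) (i j : Fin (d + 1)) (x : E (d + 1)) : ℝ :=
  if j = Fin.last d then Z i x else 0

lemma memLp_normalGrad {Z : Fin (d + 1) → E (d + 1) → ℝ}
    (hZ : ∀ i, MemLp (Z i) 2 (volume.restrict (halfSpace d))) (i j : Fin (d + 1)) :
    MemLp (normalGrad Z i j) 2 (volume.restrict (halfSpace d)) := by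
  unfold normalGrad
  split_ifs
  · exact hZ i
  · simp

/-- A weakly shear free field does not see the tangential part of `H¹` vector fields. -/
lemma integral_lameDens_eq_normalGrad {w v : E (d + 1) → E (d + 1)}
    {W V : Fin (d + 1) → Fin (d + 1) → E (d + 1) → ℝ} {z : E (d + 1) → ℝ}
    {Z : Fin (d + 1) → E (d + 1) → ℝ} {φ : E d → ℝ}
    (hw : ∀ i j, IsWeakPartial (halfSpace d) i (fun x => w x j) (W i j))
    (hW : ∀ i j, MemLp (W i j) 2 (volume.restrict (halfSpace d)))
    (hs : ∀ ζ : E (d + 1) → E (d + 1), (∀ j, MemHOne (halfSpace d) (fun x => ζ x j)) →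
      HasFlatTrace Set.univ (fun x => ζ x (Fin.last d)) 0 → lameForm lam mu (halfSpace d) w ζ = 0)
    (hv : ∀ i j, IsWeakPartial (halfSpace d) i (fun x => v x j) (V i j))
    (hv2 : ∀ j, MemLp (fun x => v x j) 2 (volume.restrict (halfSpace d)))
    (hV : ∀ i j, MemLp (V i j) 2 (volume.restrict (halfSpace d)))
    (hz : ∀ i, IsWeakPartial (halfSpace d) i z (Z i))
    (hz2 : MemLp z 2 (volume.restrict (halfSpace d)))
    (hZ : ∀ i, MemLp (Z i) 2 (volume.restrict (halfSpace d)))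
    (htv : HasFlatTrace Set.univ (fun x => v x (Fin.last d)) φ) (htz : HasFlatTrace Set.univ z φ) :
    ∫ x in halfSpace d, lameDens lam mu (fun i j => W i j x) (fun i j => V i j x) =
      ∫ x in halfSpace d, lameDens lam mu (fun i j => W i j x) (fun i j => normalGrad Z i j x) := by
  set n : Fin (d + 1) → E (d + 1) → ℝ := fun j x => if j = Fin.last d then z x else 0 with hn
  have hnp : ∀ i j, IsWeakPartial (halfSpace d) i (n j) (normalGrad Z i j) := by
    intro i j
    unfold normalGrad
    by_cases h : j = Fin.last d
    · simpa only [hn, h, if_true] using hz i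
    · simpa only [hn, h, if_false] using isWeakPartial_zero _ i
  have hn2 : ∀ j, MemLp (n j) 2 (volume.restrict (halfSpace d)) := by
    intro j
    by_cases h : j = Fin.last d
    · simpa only [hn, h, if_true] using hz2
    · simp [hn, h]
  -- Subtracting the purely normal field with the same normal trace gives a field that the shear
  -- free condition can be tested with.
  set ζ : E (d + 1) → E (d + 1) := fun x => WithLp.toLp 2 (fun j => v x j - n j x) with hζ
  have hζp : ∀ i j, IsWeakPartial (halfSpace d) i (fun x => ζ x j)
      (fun x => V i j x - normalGrad Z i j x) :=
    fun i j => (hv i j).sub (isOpen_halfSpace d) (hnp i j)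
  have hnm := memLp_normalGrad hZ
  have h0 := hs ζ (fun j => ⟨(hv2 j).sub (hn2 j), fun i => ⟨_, hζp i j, (hV i j).sub (hnm i j)⟩⟩) (by
    have := htv.sub (hv _ _) (hz _) (integrableUpToBoundary_of_memLp (hv2 _))
      (integrableUpToBoundary_of_memLp (hV _ _)) (integrableUpToBoundary_of_memLp hz2)
      (integrableUpToBoundary_of_memLp (hZ _)) htz
    simp only [sub_self] at this
    have e : (fun x => ζ x (Fin.last d)) = fun x => v x (Fin.last d) - z x := by
      funext x; simp [hζ, hn]
    rw [e]
    exact this)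
  rw [lameForm_eq (isOpen_halfSpace d) hw hζp] at h0
  simp only [lameDens_sub_right] at h0
  rw [integral_sub (integrable_lameDens hW hV) (integrable_lameDens hW hnm)] at h0
  linarith

/-- For fixed `W` the form is a finite sum of `L²` pairings with the stress of `W`. -/
lemma tendsto_integral_lameDens {W F : Fin (d + 1) → Fin (d + 1) → E (d + 1) → ℝ}
    {G : ℕ → Fin (d + 1) → Fin (d + 1) → E (d + 1) → ℝ}
    (hW : ∀ i j, MemLp (W i j) 2 (volume.restrict (halfSpace d)))
    (hF : ∀ i j, MemLp (F i j) 2 (volume.restrict (halfSpace d)))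
    (hG : ∀ N i j, MemLp (G N i j) 2 (volume.restrict (halfSpace d)))
    (h : ∀ i j, Tendsto (fun N => eLpNorm (fun x => G N i j x - F i j x) 2
      (volume.restrict (halfSpace d))) atTop (𝓝 0)) :
    Tendsto (fun N => ∫ x in halfSpace d, lameDens lam mu (fun i j => W i j x) (fun i j => G N i j x))
      atTop (𝓝 (∫ x in halfSpace d, lameDens lam mu (fun i j => W i j x) (fun i j => F i j x))) := by
  have hS : ∀ i j, MemLp (fun x => stress lam mu (fun i j => W i j x) i j) 2
      (volume.restrict (halfSpace d)) := by
    intro i j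
    simp only [stress]
    refine (((hW i j).add (hW j i)).const_mul mu).add ?_
    split_ifs
    · exact (memLp_finsetSum _ fun l _ => hW l l).const_mul lam
    · simp
  have e : ∀ A : Fin (d + 1) → Fin (d + 1) → E (d + 1) → ℝ,
      (∀ i j, MemLp (A i j) 2 (volume.restrict (halfSpace d))) →
      ∫ x in halfSpace d, lameDens lam mu (fun i j => W i j x) (fun i j => A i j x) =
        ∑ j, ∑ i, ∫ x in halfSpace d, A i j x * stress lam mu (fun i j => W i j x) i j := by
    intro A hA
    have hi : ∀ i j, IntegrableOn (fun x => A i j x * stress lam mu (fun i j => W i j x) i j)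
        (halfSpace d) := fun i j => (hA i j).integrable_mul (hS i j)
    simp only [lameDens_eq_sum_stress, mul_comm (stress _ _ _ _ _)]
    rw [integral_finsetSum _ fun j _ => integrable_finsetSum _ fun i _ => hi i j]
    exact Finset.sum_congr rfl fun j _ => integral_finsetSum _ fun i _ => hi i j
  rw [e F hF]
  simp only [fun N => e (G N) (hG N)]
  exact tendsto_finsetSum _ fun j _ => tendsto_finsetSum _ fun i _ =>
    tendsto_integral_mul_of_tendsto_eLpNorm (fun N => hG N i j) (hF i j) (hS i j) (h i j)

lemma halfLaplacianForm_comm (u v : E d → ℝ) : halfLaplacianForm u v = halfLaplacianForm v u := by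
  unfold halfLaplacianForm
  congr 1; ext x
  simp only [Complex.mul_re, Complex.conj_re, Complex.conj_im]; ring

/-- The Lamé energy of a shear free field with normal trace `u`, tested with an `H¹` vector field, is
the energy of the half-Laplacian of the normal traces. -/
theorem lameForm_eq_halfLaplacianForm (hd : 1 ≤ d) (hlam : 0 < lam) (hmu : 0 < mu)
    {w v : E (d + 1) → E (d + 1)}
    {W V : Fin (d + 1) → Fin (d + 1) → E (d + 1) → ℝ} {u φ : E d → ℝ}
    (hw : ∀ i j, IsWeakPartial (halfSpace d) i (fun x => w x j) (W i j))
    (hW : ∀ i j, MemLp (W i j) 2 (volume.restrict (halfSpace d)))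
    (hsub : ∀ j, SubexpL2 (fun x => w x j))
    (hs : ∀ ζ : E (d + 1) → E (d + 1), (∀ j, MemHOne (halfSpace d) (fun x => ζ x j)) →
      HasFlatTrace Set.univ (fun x => ζ x (Fin.last d)) 0 → lameForm lam mu (halfSpace d) w ζ = 0)
    (hu : MemHHalf u) (htw : HasFlatTrace Set.univ (fun x => w x (Fin.last d)) u)
    (hv : ∀ i j, IsWeakPartial (halfSpace d) i (fun x => v x j) (V i j))
    (hv2 : ∀ j, MemLp (fun x => v x j) 2 (volume.restrict (halfSpace d)))
    (hV : ∀ i j, MemLp (V i j) 2 (volume.restrict (halfSpace d)))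
    (hφ : MemHHalf φ) (htv : HasFlatTrace Set.univ (fun x => v x (Fin.last d)) φ) :
    lameForm lam mu (halfSpace d) w v = lameC lam mu * halfLaplacianForm u φ := by
  obtain ⟨z, Z, hz, hz2, hZ, htz, hlim⟩ := exists_extension hd lam mu hφ
  rw [lameForm_eq (isOpen_halfSpace d) hw hv,
    integral_lameDens_eq_normalGrad hw hW hs hv hv2 hV hz hz2 hZ htv htz]
  have hφ2 := (memHHalf_iff.1 hφ).1
  have hb := bandLimited_bandPart hφ2
  have hcw : ∀ N i, IsWeakPartial (halfSpace d) i (cutSol lam mu (bandPart φ N))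
      (cutGrad lam mu (bandPart φ N) i) := fun N i => by
    rw [← pderiv_cutSol (hb N)]
    exact isWeakPartial_of_contDiff (isOpen_halfSpace d) (contDiff_cutSol (hb N)) i
  have hcm := fun N => memLp_cutSol (lam := lam) (mu := mu) (hb N)
  have hcg := fun N i => memLp_cutGrad (lam := lam) (mu := mu) (hb N) i
  have l1 := tendsto_integral_lameDens (lam := lam) (mu := mu) hW (memLp_normalGrad hZ)
    (fun N => memLp_normalGrad (hcg N)) fun i j => by
      by_cases h : j = Fin.last d
      · simpa only [normalGrad, h, if_true] using hlim i
      · simp [normalGrad, h]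
  have hN : ∀ N, ∫ x in halfSpace d, lameDens lam mu (fun i j => W i j x)
      (fun i j => normalGrad (cutGrad lam mu (bandPart φ N)) i j x) =
      lameC lam mu * ∫ ξ, (annulus d N).indicator (fun ξ => 2 * Real.pi * ‖ξ‖ *
        (l2Fourier φ ξ * (starRingEnd ℂ) (l2Fourier u ξ)).re) ξ := by
    intro N
    have hsw : ∀ i j, IsWeakPartial (halfSpace d) i
        (fun x => (WithLp.toLp 2 (fun j => lameSol lam mu (bandPart φ N) j x) : E (d + 1)) j)
        (lameGrad lam mu (bandPart φ N) i j) := fun i j => by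
      rw [← pderiv_lameSol (hb N)]
      exact isWeakPartial_of_contDiff (isOpen_halfSpace d) (contDiff_lameSol (hb N) j) i
    have htr : HasFlatTrace Set.univ (cutSol lam mu (bandPart φ N))
        (fun x => harm (fun ξ => ((2 * Real.pi * ‖ξ‖ : ℝ) : ℂ) * bandPart φ N ξ) (consPoint x 0)) :=
      hasFlatTrace_cutSol (hb N)
    -- The cut-off normal field and the full explicit solution have the same normal trace, so `w`
    -- does not distinguish them. The first converges as `N → ∞`; the second solves the Lamé system,
    -- and by symmetry of the form Green's formula applies with `w` as the rough field.
    rw [← integral_lameDens_eq_normalGrad hw hW hs hsw (fun j => memLp_lameSol (hb N) j)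
      (fun i j => memLp_lameGrad (hb N) i j) (hcw N) (hcm N) (hcg N) (hasFlatTrace_lameSol (hb N)) htr]
    simp only [lameDens_comm (fun i j => W i j _)]
    rw [integral_lameDens_lameGrad hlam hmu (hb N) hw hW hsub htw]
    simp only [sq_mul_bandPart_re]
  simp only [hN] at l1
  rw [halfLaplacianForm_comm, halfLaplacianForm_eq hφ hu]
  exact tendsto_nhds_unique l1
    ((tendsto_integral_annulus hd (integrable_symbol_mul hφ hu)).const_mul (lameC lam mu))

end traces
/-! ### Localization to the half ball -/

section localization

variable {d : ℕ} {f g : E (d + 1) → ℝ}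

lemma isOpen_halfBall (d : ℕ) : IsOpen (halfBall d) := Metric.isOpen_ball.inter (isOpen_halfSpace d)

lemma halfBall_subset_halfSpace (d : ℕ) : halfBall d ⊆ halfSpace d := Set.inter_subset_right

lemma preimage_ball_eq (d : ℕ) :
    {x' : E d | consPoint x' 0 ∈ Metric.ball (0 : E (d + 1)) 1} = Metric.ball 0 1 := by
  ext x
  have h := norm_consPoint_sq x 0
  have e : ‖consPoint x 0‖ = ‖x‖ := by
    rw [← sq_eq_sq₀ (norm_nonneg _) (norm_nonneg _), h]; ring
  simp [e]

/-- On the half ball `xₙ < 1`, so undoing the weight costs at most a factor `e`. -/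
lemma SubexpL2.memLp_halfBall (hf : SubexpL2 f) : MemLp f 2 (volume.restrict (halfBall d)) := by
  have h1 := (hf 1 one_pos).mono_measure
    (Measure.restrict_mono (halfBall_subset_halfSpace d) (le_refl volume))
  have hc : Continuous fun z : E (d + 1) => Real.exp (z (Fin.last d)) := by fun_prop
  have e : f = fun z => Real.exp (z (Fin.last d)) * (Real.exp (-(1 * z (Fin.last d))) * f z) := by
    funext z
    rw [← mul_assoc, ← Real.exp_add]; simp
  rw [e]
  refine h1.of_le_mul (c := Real.exp 1) (hc.aestronglyMeasurable.mul h1.1) ?_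
  rw [ae_restrict_iff' (isOpen_halfBall d).measurableSet]
  refine Eventually.of_forall fun z hz => ?_
  rw [norm_mul, Real.norm_of_nonneg (Real.exp_pos _).le]
  gcongr
  have h2 : ‖z‖ < 1 := by simpa using hz.1
  exact ((le_abs_self _).trans (PiLp.norm_apply_le z (Fin.last d))).trans h2.le

lemma IsWeakPartial.integral_weakPartial_eq (hfg : IsWeakPartial (halfBall d) (Fin.last d) f g)
    (η : E (d + 1) → ℝ) :
    ∫ x in Metric.ball 0 1 ∩ halfSpace d, (f x * pderiv (Fin.last d) η x +
      weakPartial (Metric.ball 0 1 ∩ halfSpace d) (Fin.last d) f x * η x) =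
    ∫ x in halfBall d, (f x * pderiv (Fin.last d) η x + g x * η x) := by
  refine integral_congr_ae ?_
  filter_upwards [hfg.weakPartial_ae_eq (isOpen_halfBall d)] with x hx
  rw [← hx]

/-- The trace on the flat part of the half ball is the restriction of the trace on the hyperplane. -/
lemma HasFlatTrace.restrict_ball {t : E d → ℝ} (hfg : IsWeakPartial (halfSpace d) (Fin.last d) f g)
    (h : HasFlatTrace Set.univ f t) : HasFlatTrace (Metric.ball 0 1) f t := by
  obtain ⟨h1, h2⟩ := (hasFlatTrace_univ_iff hfg).1 h
  refine ⟨h1.restrict _, fun η hη => ?_⟩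
  rw [preimage_ball_eq]
  have e1 := (hfg.mono (isOpen_halfSpace d) (halfBall_subset_halfSpace d)).integral_weakPartial_eq η
  have e2 : ∫ x in halfSpace d, (f x * pderiv (Fin.last d) η x + g x * η x) =
      ∫ x in halfBall d, (f x * pderiv (Fin.last d) η x + g x * η x) := by
    refine setIntegral_eq_of_subset_of_forall_sdiff_eq_zero (measurableSet_halfSpace d)
      (halfBall_subset_halfSpace d) fun x hx => ?_
    have hx' : x ∉ Metric.ball (0 : E (d + 1)) 1 := fun h => hx.2 ⟨h, hx.1⟩
    rw [hη.eq_zero hx', (hη.pderiv _).eq_zero hx']; ring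
  rw [e1, ← e2, h2 η (hη.mono (Set.subset_univ _))]
  congr 1
  symm
  refine setIntegral_eq_integral_of_forall_compl_eq_zero fun x hx => ?_
  rw [← preimage_ball_eq] at hx
  rw [hη.eq_zero hx, mul_zero]

/-- Extend constantly in the vertical direction and multiply by a cut-off that is `1` on the copy of
the support of `θ` in the hyperplane. -/
lemma exists_testFunction_extending {U : Set (E (d + 1))} (hU : IsOpen U) {θ : E d → ℝ}
    (hθ : IsTestFunction {x | consPoint x 0 ∈ U} θ) :
    ∃ η, IsTestFunction U η ∧ ∀ x, η (consPoint x 0) = θ x := by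
  set K : Set (E (d + 1)) := (fun x => consPoint x 0) '' tsupport θ with hK
  have hKc : IsCompact K := hθ.2.1.isCompact.image (continuous_consPoint_left 0)
  obtain ⟨L, hL, hKL, hLU⟩ := exists_compact_between hKc hU (by
    rintro _ ⟨x, hx, rfl⟩
    exact hθ.2.2 hx)
  obtain ⟨χ, hχ, -, hsupp, h1⟩ := exists_contMDiff_support_eq_eq_one_iff (n := ⊤)
    (modelWithCornersSelf ℝ (E (d + 1))) isOpen_interior hKc.isClosed hKL
  have hχL : tsupport χ ⊆ L := by
    rw [tsupport, hsupp]
    exact closure_minimal interior_subset hL.isClosed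
  have hsub : tsupport (fun z => χ z * θ (horiz z)) ⊆ tsupport χ := tsupport_mul_subset_left
  refine ⟨fun z => χ z * θ (horiz z), ⟨hχ.contDiff.mul (hθ.1.comp (contDiff_horiz d)),
    hL.of_isClosed_subset (isClosed_tsupport _) (hsub.trans hχL), hsub.trans (hχL.trans hLU)⟩,
    fun x => ?_⟩
  beta_reduce
  rw [horiz_consPoint]
  by_cases hx : x ∈ tsupport θ
  · rw [(h1 _).1 ⟨x, hx, rfl⟩, one_mul]
  · rw [image_eq_zero_of_notMem_tsupport hx, mul_zero]

/-- The trace is determined locally by Green's formula. -/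
lemma HasFlatTrace.ae_eq_on {t τ : E d → ℝ} (hfg : IsWeakPartial (halfSpace d) (Fin.last d) f g)
    (h : HasFlatTrace Set.univ f t) {U : Set (E (d + 1))} (hU : IsOpen U)
    (hτ : LocallyIntegrableOn τ {x | consPoint x 0 ∈ U})
    (hG : ∀ η, IsTestFunction U η →
      ∫ z in halfSpace d, (f z * pderiv (Fin.last d) η z + g z * η z) =
        -∫ x in {x | consPoint x 0 ∈ U}, τ x * η (consPoint x 0)) :
    ∀ᵐ x, consPoint x 0 ∈ U → t x = τ x := by
  obtain ⟨h1, h2⟩ := (hasFlatTrace_univ_iff hfg).1 h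
  have hU' : IsOpen {x : E d | consPoint x 0 ∈ U} := hU.preimage (continuous_consPoint_left 0)
  have ht : LocallyIntegrableOn t {x | consPoint x 0 ∈ U} :=
    (h1.locallyIntegrable (by norm_num)).locallyIntegrableOn _
  have key := hU'.ae_eq_zero_of_integral_contDiff_smul_eq_zero (f := fun x => t x - τ x)
    (μ := (volume : Measure (E d))) (ht.sub hτ) fun θ a b c => by
      have hθ : IsTestFunction {x | consPoint x 0 ∈ U} θ := ⟨a, b, c⟩
      obtain ⟨η, hη, hηθ⟩ := exists_testFunction_extending hU hθ
      have e1 := h2 η (hη.mono (Set.subset_univ _))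
      rw [hG η hη] at e1
      simp only [hηθ] at e1
      have e2 : ∫ x in {x | consPoint x 0 ∈ U}, t x * θ x = ∫ x, t x * θ x :=
        setIntegral_eq_integral_of_forall_compl_eq_zero fun x hx => by rw [hθ.eq_zero hx, mul_zero]
      have e3 : ∫ x in {x | consPoint x 0 ∈ U}, θ x • (t x - τ x) = ∫ x, θ x • (t x - τ x) :=
        setIntegral_eq_integral_of_forall_compl_eq_zero fun x hx => by rw [hθ.eq_zero hx, zero_smul]
      rw [← e3]
      have e4 := integral_sub (hθ.integrableOn_mul ht hU'.measurableSet)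
        (hθ.integrableOn_mul hτ hU'.measurableSet)
      have e5 : ∀ x, θ x • (t x - τ x) = t x * θ x - τ x * θ x := fun x => by
        rw [smul_eq_mul]; ring
      simp only [e5]
      rw [e4, e2]
      linarith
  filter_upwards [key] with x hx hxU
  exact sub_eq_zero.1 (hx hxU)

/-- Extension by zero of functions that vanish on the spherical part of the boundary. -/
lemma IsWeakPartial.indicator_halfBall {i : Fin (d + 1)} (hfg : IsWeakPartial (halfBall d) i f g)
    (hf : MemLp f 2 (volume.restrict (halfBall d))) (hg : MemLp g 2 (volume.restrict (halfBall d)))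
    (h0 : VanishesOnCap f) :
    IsWeakPartial (halfSpace d) i ((halfBall d).indicator f) ((halfBall d).indicator g) := by
  have hm := (isOpen_halfBall d).measurableSet
  have loc : ∀ k : E (d + 1) → ℝ, MemLp k 2 (volume.restrict (halfBall d)) →
      LocallyIntegrableOn ((halfBall d).indicator k) (halfSpace d) := fun k hk =>
    (((memLp_indicator_iff_restrict hm).2 hk).locallyIntegrable (by norm_num)).locallyIntegrableOn _
  refine ⟨loc f hf, loc g hg, fun η hη => ?_⟩
  have e : ∀ k σ : E (d + 1) → ℝ, ∫ x in halfSpace d, (halfBall d).indicator k x * σ x =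
      ∫ x in halfBall d, k x * σ x := by
    intro k σ
    have : ∀ x, (halfBall d).indicator k x * σ x = (halfBall d).indicator (fun x => k x * σ x) x :=
      fun x => by by_cases hx : x ∈ halfBall d <;> simp [hx]
    simp only [this]
    rw [setIntegral_indicator hm, Set.inter_eq_self_of_subset_right (halfBall_subset_halfSpace d)]
  rw [e, e]
  have h1 : MemLp η 2 (volume.restrict (halfBall d)) :=
    (hη.1.continuous.memLp_of_hasCompactSupport hη.2.1).restrict _
  have h2 : MemLp (pderiv i η) 2 (volume.restrict (halfBall d)) :=
    ((hη.pderiv i).1.continuous.memLp_of_hasCompactSupport (hη.pderiv i).2.1).restrict _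
  -- The test functions admitted in `VanishesOnCap` are those supported in the open half space,
  -- which are exactly the ones that define weak derivatives there.
  have h3 : ∫ x in halfBall d, (f x * pderiv i η x + g x * η x) = 0 := by
    rw [← h0 i η hη]
    refine integral_congr_ae ?_
    filter_upwards [hfg.weakPartial_ae_eq (isOpen_halfBall d)] with x hx
    rw [hx]
  rw [integral_mul_add_mul hf hg h2 h1] at h3
  linarith

/-- The trace of the extension by zero. -/
lemma HasFlatTrace.ae_eq_indicator {t τ : E d → ℝ}
    (hfg : IsWeakPartial (halfBall d) (Fin.last d) f g)
    (hfg' : IsWeakPartial (halfSpace d) (Fin.last d) ((halfBall d).indicator f)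
      ((halfBall d).indicator g))
    (hτ : HasFlatTrace (Metric.ball 0 1) f τ)
    (h : HasFlatTrace Set.univ ((halfBall d).indicator f) t) :
    t =ᵐ[volume] (Metric.ball 0 1).indicator τ := by
  have hm := (isOpen_halfBall d).measurableSet
  have e : ∀ σ ρ : E (d + 1) → ℝ, ∫ x in halfSpace d, ((halfBall d).indicator f x * σ x +
      (halfBall d).indicator g x * ρ x) = ∫ x in halfBall d, (f x * σ x + g x * ρ x) := by
    intro σ ρ
    have : ∀ x, (halfBall d).indicator f x * σ x + (halfBall d).indicator g x * ρ x =
        (halfBall d).indicator (fun x => f x * σ x + g x * ρ x) x :=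
      fun x => by by_cases hx : x ∈ halfBall d <;> simp [hx]
    simp only [this]
    rw [setIntegral_indicator hm, Set.inter_eq_self_of_subset_right (halfBall_subset_halfSpace d)]
  -- The trace is identified separately inside the unit ball and outside the closed unit ball, where
  -- the extension vanishes; the sphere in between is a null set.
  have i1 := h.ae_eq_on hfg' (τ := τ) (Metric.isOpen_ball (x := 0) (ε := 1))
    (locallyIntegrableOn_of_locallyIntegrable_restrict (hτ.1.locallyIntegrable (by norm_num)))
    fun η hη => by
      rw [e, ← hτ.2 η hη, hfg.integral_weakPartial_eq]
  have i2 := h.ae_eq_on hfg' (τ := fun _ => 0) (U := (Metric.closedBall 0 1)ᶜ)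
    Metric.isClosed_closedBall.isOpen_compl (locallyIntegrableOn_zero) fun η hη => by
      rw [e]
      simp only [zero_mul, integral_zero, neg_zero]
      refine setIntegral_eq_zero_of_forall_eq_zero fun x hx => ?_
      have hx' : x ∉ (Metric.closedBall (0 : E (d + 1)) 1)ᶜ := fun h =>
        h (Metric.ball_subset_closedBall hx.1)
      rw [hη.eq_zero hx', (hη.pderiv _).eq_zero hx']; ring
  have i3 : ∀ᵐ x : E d, x ∉ Metric.sphere (0 : E d) 1 :=
    measure_eq_zero_iff_ae_notMem.1 (Measure.addHaar_sphere_of_ne_zero volume 0 one_ne_zero)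
  filter_upwards [i1, i2, i3] with x h1 h2 h3
  have hx1 : consPoint x 0 ∈ Metric.ball (0 : E (d + 1)) 1 ↔ x ∈ Metric.ball (0 : E d) 1 :=
    Set.ext_iff.1 (preimage_ball_eq d) x
  have hn : ‖consPoint x 0‖ = ‖x‖ := by
    rw [← sq_eq_sq₀ (norm_nonneg _) (norm_nonneg _), norm_consPoint_sq]; ring
  by_cases hx : x ∈ Metric.ball (0 : E d) 1
  · rw [Set.indicator_of_mem hx, h1 (hx1.2 hx)]
  · rw [Set.indicator_of_notMem hx]
    refine h2 ?_
    simp only [Metric.mem_sphere, dist_zero_right, Metric.mem_ball, not_lt] at h3 hx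
    simp only [Set.mem_compl_iff, Metric.mem_closedBall, dist_zero_right, hn, not_le]
    exact lt_of_le_of_ne hx (Ne.symm h3)

lemma HasFlatTrace.sub_ball {f' g' : E (d + 1) → ℝ} {t t' : E d → ℝ}
    (hfg : IsWeakPartial (halfBall d) (Fin.last d) f g)
    (hfg' : IsWeakPartial (halfBall d) (Fin.last d) f' g')
    (hf : MemLp f 2 (volume.restrict (halfBall d))) (hg : MemLp g 2 (volume.restrict (halfBall d)))
    (hf' : MemLp f' 2 (volume.restrict (halfBall d)))
    (hg' : MemLp g' 2 (volume.restrict (halfBall d)))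
    (h : HasFlatTrace (Metric.ball 0 1) f t) (h' : HasFlatTrace (Metric.ball 0 1) f' t') :
    HasFlatTrace (Metric.ball 0 1) (fun z => f z - f' z) (fun x => t x - t' x) := by
  refine ⟨h.1.sub h'.1, fun η hη => ?_⟩
  have e1 := h.2 η hη
  have e2 := h'.2 η hη
  rw [hfg.integral_weakPartial_eq] at e1
  rw [hfg'.integral_weakPartial_eq] at e2
  rw [(hfg.sub (isOpen_halfBall d) hfg').integral_weakPartial_eq]
  have h1 : MemLp η 2 (volume.restrict (halfBall d)) :=
    (hη.1.continuous.memLp_of_hasCompactSupport hη.2.1).restrict _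
  have hp := hη.pderiv (Fin.last d)
  have h2 : MemLp (pderiv (Fin.last d) η) 2 (volume.restrict (halfBall d)) :=
    (hp.1.continuous.memLp_of_hasCompactSupport hp.2.1).restrict _
  obtain ⟨ρ, hρ, hηρ⟩ := exists_slice_bound (hη.mono (Set.subset_univ _))
  have h3 : MemLp (fun x => η (consPoint x 0)) 2
      (volume.restrict {x' : E d | consPoint x' 0 ∈ Metric.ball (0 : E (d + 1)) 1}) :=
    (hρ.mono ((hη.1.continuous.comp (continuous_consPoint_left 0)).aestronglyMeasurable)
      (Eventually.of_forall fun x => (hηρ x 0).trans (le_abs_self _))).restrict _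
  rw [integral_mul_add_mul hf hg h2 h1] at e1
  rw [integral_mul_add_mul hf' hg' h2 h1] at e2
  have e3 := integral_mul_add_mul (hf.sub hf') (hg.sub hg') h2 h1
  simp only [Pi.sub_apply] at e3
  rw [e3]
  have s1 := integral_sub (hf.integrable_mul h2) (hf'.integrable_mul h2)
  have s2 := integral_sub (hg.integrable_mul h1) (hg'.integrable_mul h1)
  have s3 := integral_sub (h.1.integrable_mul h3) (h'.1.integrable_mul h3)
  simp only [Pi.mul_apply] at s1 s2 s3
  simp only [sub_mul]
  rw [s1, s2, s3]
  linarith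

end localization

/-! ### The obstacle problems -/

section obstacle

variable {d : ℕ} {lam mu : ℝ} {ψ u : E d → ℝ} {w : E (d + 1) → E (d + 1)}

lemma IsLameExtension.contDiffOn (hw : IsLameExtension lam mu u w) (j : Fin (d + 1)) :
    ContDiffOn ℝ ∞ (fun x => w x j) (halfSpace d) :=
  contDiffOn_euclidean.1 hw.smooth j

lemma IsLameExtension.isWeakPartial (hw : IsLameExtension lam mu u w) (i j : Fin (d + 1)) :
    IsWeakPartial (halfSpace d) i (fun x => w x j) (pderiv i (fun x => w x j)) :=
  isWeakPartial_of_contDiffOn (isOpen_halfSpace d) (hw.contDiffOn j) i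

/-- Finite energy provides some square integrable weak derivative; by uniqueness it is the classical
one. -/
lemma IsLameExtension.memLp_pderiv (hw : IsLameExtension lam mu u w) (i j : Fin (d + 1)) :
    MemLp (pderiv i (fun x => w x j)) 2 (volume.restrict (halfSpace d)) := by
  obtain ⟨g, hg, hg2⟩ := hw.energy j i
  exact hg2.ae_eq (hg.ae_eq (isOpen_halfSpace d) (hw.isWeakPartial i j))

/-- Finite energy alone does not control the size of `w`; one square integrable slice, here at
height `1`, and the normal derivative in `L²` do. -/
lemma IsLameExtension.subexpL2 (hw : IsLameExtension lam mu u w) (j : Fin (d + 1)) :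
    SubexpL2 (fun x => w x j) := by
  obtain ⟨C, hC, h⟩ := exists_slice_growth (hw.contDiffOn j) (hw.memLp_pderiv _ j)
    (hw.slice 1 one_pos j).memLp
  exact subexpL2_of_growth
    ((hw.contDiffOn j).continuousOn.aestronglyMeasurable (measurableSet_halfSpace d)) hC h

lemma IsLameExtension.hasFlatTrace (hw : IsLameExtension lam mu u w) (hu : MemHHalf u) :
    HasFlatTrace Set.univ (fun x => w x (Fin.last d)) u :=
  hasFlatTrace_of_tendsto_slice (hw.contDiffOn _) (hw.subexpL2 _).integrableUpToBoundary
    (integrableUpToBoundary_of_memLp (hw.memLp_pderiv _ _)) (fun t ht => (hw.slice t ht _).memLp)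
    hu.memLp hw.trace_L2

lemma lameDens_indicator {A : Fin (d + 1) → Fin (d + 1) → ℝ}
    (F : Fin (d + 1) → Fin (d + 1) → E (d + 1) → ℝ) (s : Set (E (d + 1))) (x : E (d + 1)) :
    lameDens lam mu A (fun i j => s.indicator (F i j) x) =
      s.indicator (fun x => lameDens lam mu A (fun i j => F i j x)) x := by
  by_cases hx : x ∈ s
  · simp [hx]
  · simp [hx, lameDens]

/-- The Lamé extension of a solution of the obstacle problem for the half-Laplacian solves the thin
obstacle problem for the Lamé system. -/
theorem isLameThinObstacleSolution (hd : 1 ≤ d) (hlam : 0 < lam) (hmu : 0 < mu)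
    (hu : IsHalfLaplacianObstacleSolution ψ u) (hw : IsLameExtension lam mu u w) :
    IsLameThinObstacleSolution lam mu ψ w := by
  have hB := isOpen_halfBall d
  have hH := isOpen_halfSpace d
  have hBH := halfBall_subset_halfSpace d
  have hwp := hw.isWeakPartial
  have hwpB : ∀ i j, IsWeakPartial (halfBall d) i (fun x => w x j) (pderiv i (fun x => w x j)) :=
    fun i j => (hwp i j).mono hH hBH
  have hW := hw.memLp_pderiv
  have hWB : ∀ i j, MemLp (pderiv i (fun x => w x j)) 2 (volume.restrict (halfBall d)) :=
    fun i j => (hW i j).mono_measure (Measure.restrict_mono hBH le_rfl)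
  have hw2 : ∀ j, MemLp (fun x => w x j) 2 (volume.restrict (halfBall d)) :=
    fun j => (hw.subexpL2 j).memLp_halfBall
  have htw := hw.hasFlatTrace hu.mem
  have htwB := htw.restrict_ball (hwp _ _)
  refine ⟨⟨fun j => ⟨hw2 j, fun i => ⟨_, hwpB i j, hWB i j⟩⟩, u, htwB,
    ae_restrict_of_ae hu.ge_obstacle⟩, fun ζ hζ hcap => ?_⟩
  obtain ⟨hζ1, g, hg, hψg⟩ := hζ
  choose Z hZ hZ2 using fun j => (hζ1 j).2
  have hfp : ∀ i j, IsWeakPartial (halfBall d) i (fun x => ζ x j - w x j)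
      (fun x => Z j i x - pderiv i (fun x => w x j) x) := fun i j => (hZ j i).sub hB (hwpB i j)
  have hf2 : ∀ j, MemLp (fun x => ζ x j - w x j) 2 (volume.restrict (halfBall d)) :=
    fun j => (hζ1 j).1.sub (hw2 j)
  set F : Fin (d + 1) → Fin (d + 1) → E (d + 1) → ℝ :=
    fun i j x => Z j i x - pderiv i (fun x => w x j) x with hFdef
  have hF2 : ∀ i j, MemLp (F i j) 2 (volume.restrict (halfBall d)) :=
    fun i j => (hZ2 j i).sub (hWB i j)
  -- The variation, extended by zero. The vanishing on the cap prevents a jump across the sphere, so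
  -- its weak derivatives are the zero extensions.
  set v : E (d + 1) → E (d + 1) :=
    fun x => WithLp.toLp 2 (fun j => (halfBall d).indicator (fun x => ζ x j - w x j) x) with hv
  have hvp : ∀ i j, IsWeakPartial (halfSpace d) i (fun x => v x j) ((halfBall d).indicator (F i j)) :=
    fun i j => (hfp i j).indicator_halfBall (hf2 j) (hF2 i j) (hcap j)
  have ind2 : ∀ k : E (d + 1) → ℝ, MemLp k 2 (volume.restrict (halfBall d)) →
      MemLp ((halfBall d).indicator k) 2 (volume.restrict (halfSpace d)) :=
    fun k hk => ((memLp_indicator_iff_restrict hB.measurableSet).2 hk).restrict _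
  have hv2 : ∀ j, MemLp (fun x => v x j) 2 (volume.restrict (halfSpace d)) :=
    fun j => ind2 _ (hf2 j)
  have hV2 := fun i j => ind2 _ (hF2 i j)
  obtain ⟨φ, hφ⟩ := exists_hasFlatTrace (hvp (Fin.last d) (Fin.last d)) (hv2 _) (hV2 _ _)
  have hφH : MemHHalf φ := memHHalf_of_hasFlatTrace hd hvp hV2 (fun j => subexpL2_of_memLp (hv2 j)) hφ
  have htf := hg.sub_ball (hZ _ _) (hwpB _ _) (hζ1 _).1 (hZ2 _ _) (hw2 _) (hWB _ _) htwB
  have hφe : φ =ᵐ[volume] (Metric.ball 0 1).indicator (fun x => g x - u x) :=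
    HasFlatTrace.ae_eq_indicator (hfp _ _) (hvp _ _) htf hφ
  -- The competitor is `g ≥ ψ` in the unit ball and `u ≥ ψ` outside.
  have hvar := hu.variational (fun x => u x + φ x) (hu.mem.add hφH) (by
    filter_upwards [hφe, hu.ge_obstacle, (ae_restrict_iff' measurableSet_ball).1 hψg] with x h1 h2 h3
    rw [h1]
    by_cases hx : x ∈ Metric.ball (0 : E d) 1
    · rw [Set.indicator_of_mem hx]; linarith [h3 hx]
    · rw [Set.indicator_of_notMem hx]; linarith)
  simp only [add_sub_cancel_left] at hvar
  have key := lameForm_eq_halfLaplacianForm hd hlam hmu hwp hW hw.subexpL2 hw.shear_free hu.mem htw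
    hvp hv2 hV2 hφH hφ
  have e1 : lameForm lam mu (halfBall d) w (fun x => ζ x - w x) =
      lameForm lam mu (halfSpace d) w v := by
    rw [lameForm_eq hB hwpB hfp, lameForm_eq hH hwp hvp]
    simp only [lameDens_indicator]
    have ind : ∀ x, (halfBall d).indicator
        (fun y => lameDens lam mu (fun i j => pderiv i (fun x => w x j) x) fun i j => F i j y) x =
        (halfBall d).indicator
        (fun y => lameDens lam mu (fun i j => pderiv i (fun x => w x j) y) fun i j => F i j y) x :=
      fun x => by by_cases hx : x ∈ halfBall d <;> simp [hx]
    simp only [ind]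
    rw [setIntegral_indicator hB.measurableSet, Set.inter_eq_self_of_subset_right hBH]
  rw [e1, key]
  exact mul_nonneg (lameC_pos hlam hmu).le hvar

end obstacle
end

end LameObstacle

theorem proposition3p1 (d : ℕ) (hd : 1 ≤ d) (lam mu : ℝ) (hlam : 0 < lam) (hmu : 0 < mu)
    (ψ u : LameObstacle.E d → ℝ) (w : LameObstacle.E (d + 1) → LameObstacle.E (d + 1))
    (hψ : LameObstacle.MemHHalf ψ)
    (hu : LameObstacle.IsHalfLaplacianObstacleSolution ψ u)
    (hw : LameObstacle.IsLameExtension lam mu u w) :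
    LameObstacle.IsLameThinObstacleSolution lam mu ψ w := by
  exact LameObstacle.isLameThinObstacleSolution hd hlam hmu hu hw
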